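/- Let $k$ be an even integer, $q=e^{2\pi i\tau}$, $\tau=u+iv\in\mathbb H$, and let $F:\mathbb H\to\mathbb C$ be a harmonic Maass form of weight $2-k$ on $\mathrm{SL}_2(\mathbb Z)$ (smooth, modular of weight $2-k$, annihilated by the weight $2-k$ hyperbolic Laplacian, and equal to a polynomial in $q^{-1}$ up to $O(e^{-\varepsilon v})$, for some $\varepsilon>0$, as $v\to\infty$) with Fourier expansion $$F(\tau)=\sum_{l\ge -m}c_F^+(l)q^l+\sum_{n\ge1}c_F^-(-n)\,\Gamma(k-1,4\pi n v)\,q^{-n},\qquad c_F^+(-m)=1,$$ where $m\ge 0$ is an integer and all $c_F^{\pm}$ are real. Suppose that $F$ is a weak Hecke eigenform: $\xi_{2-k}F:=2iv^{2-k}\,\overline{\partial F/\partial\bar\tau}$ is a nonzero multiple of a normalized Hecke eigenform $G=\sum_{n\ge1}a(n)q^n$ ($a(1)=1$), a cusp form of weight $k$ on $\mathrm{SL}_2(\mathbb Z)$. For even $r$ let $b(r)=\lfloor r/12\rfloor$ if $r\not\equiv2\pmod{12}$ and $b(r)=\lfloor r/12\rfloor-1$ if $r\equiv 2\pmod{12}$,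 and let $\widetilde E_r=1,\;E_4^2E_6,\;E_4,\;E_6,\;E_4^2,\;E_4E_6$ for $r\equiv0,2,4,6,8,10\pmod{12}$ respectively. With $\Delta=(E_4^3-E_6^2)/1728$, $j=E_4^3/\Delta$ and $(f\,|\,T_\kappa(n))(\tau)=n^{\kappa-1}\sum_{ad=n}d^{-\kappa}\sum_{0\le b<d}f\big(\tfrac{a\tau+b}{d}\big)$, put $$H_n(F;\tau)=\Delta(\tau)^{b(k-2)}\,\widetilde E_{k-2}(\tau)\left(n^{k-1}F(\tau)\,|\,T_{2-k}(n)-a(n)F(\tau)\right)\qquad(n\ge2),$$ and let $P_n(F;x)\in\mathbb R[x]$ be the polynomial with $P_n(F;j(\tau))=H_n(F;\tau)$ for all $\tau\in\mathbb H$; it exists for every $n\ge2$, and is monic of degree $mn-b(k-2)$. Then, for all sufficiently large $n$, all complex zeros of $P_n(F;x)$ are simple and lie in $[0,1728]$. Moreover the zeros are equidistributed in $[0,1728]=j(\mathcal A)$ as $n\to\infty$, where $\mathcal A=\{\tau\in\mathbb H:|\tau|=1,\ -\tfrac12\le\operatorname{Re}\tau\le0\}$, with respect to the probability measure obtained by transporting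 through $j$ the measure on $\mathcal A$ that is uniform in $\operatorname{Re}\tau$. That is, for all $0\le\alpha\le\beta\le1728$, $$\lim_{n\to\infty}\frac{\#\{x\in[\alpha,\beta]:P_n(F;x)=0\}}{\deg P_n(F;x)}=2\cdot\mathrm{Leb}\left\{\operatorname{Re}\tau:\ \tau\in\mathcal A,\ j(\tau)\in[\alpha,\beta]\right\}.$$ -/

import Mathlib

open UpperHalfPlane ModularForm MatrixGroups Polynomial

noncomputable section

namespace HeckeZeros

/-- The modular invariant `j = E₄ ^ 3 / Δ` on the upper half-plane. -/
def jInv (τ : ℍ) : ℂ := E₄ τ ^ 3 / discriminant τ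

/-- The function `Ẽ_k` for even `k`: the product of powers of `E₄` and `E₆` attached to the residue
class of `k` modulo `12`. -/
def Etilde (k : ℤ) (τ : ℍ) : ℂ :=
  if k % 12 = 2 then E₄ τ ^ 2 * E₆ τ
  else if k % 12 = 4 then E₄ τ
  else if k % 12 = 6 then E₆ τ
  else if k % 12 = 8 then E₄ τ ^ 2
  else if k % 12 = 10 then E₄ τ * E₆ τ
  else 1

/-- `b(k) = ⌊k / 12⌋`, lowered by one when `k ≡ 2 (mod 12)`. -/
def bExp (k : ℤ) : ℤ := if k % 12 = 2 then k / 12 - 1 else k / 12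

/-- The partial derivative `∂/∂u` of a function of `z = u + iv`. -/
def dU (f : ℂ → ℂ) (z : ℂ) : ℂ := fderiv ℝ f z 1

/-- The partial derivative `∂/∂v` of a function of `z = u + iv`. -/
def dV (f : ℂ → ℂ) (z : ℂ) : ℂ := fderiv ℝ f z Complex.I

/-- A function on `ℍ`, viewed as a function of a complex variable (only its values on the open
upper half-plane matter). -/
def lift (F : ℍ → ℂ) (z : ℂ) : ℂ := F (ofComplex z)

/-- The weight `κ` hyperbolic Laplacian
`Δ_κ = -v² (∂²/∂u² + ∂²/∂v²) + iκv (∂/∂u + i ∂/∂v)`. -/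
def hypLaplacian (κ : ℤ) (F : ℍ → ℂ) (τ : ℍ) : ℂ :=
  -(τ.im : ℂ) ^ 2 * (dU (dU (lift F)) τ + dV (dV (lift F)) τ) +
    Complex.I * κ * τ.im * (dU (lift F) τ + Complex.I * dV (lift F) τ)

/-- The operator `ξ_κ F = 2i v^κ · conj (∂F/∂τ̄)`, where `∂/∂τ̄ = (∂/∂u + i ∂/∂v) / 2`. -/
def xi (κ : ℤ) (F : ℍ → ℂ) (τ : ℍ) : ℂ :=
  2 * Complex.I * (τ.im : ℂ) ^ κ *
    (starRingEnd ℂ) ((dU (lift F) τ + Complex.I * dV (lift F) τ) / 2)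

/-- Harmonic Maass forms of weight `κ` on `SL₂(ℤ)`: smooth, modular of weight `κ`, annihilated by
the weight `κ` hyperbolic Laplacian, and equal to a polynomial in `q⁻¹` up to an exponentially
decaying error at the cusp. -/
structure IsHarmonicMaassForm (κ : ℤ) (F : ℍ → ℂ) : Prop where
  smooth : ContDiffOn ℝ (⊤ : ℕ∞) (lift F) {z : ℂ | 0 < z.im}
  modular : ∀ γ : SL(2, ℤ), F ∣[κ] γ = F
  harmonic : ∀ τ : ℍ, hypLaplacian κ F τ = 0
  growth : ∃ (p : ℂ[X]) (ε : ℝ), 0 < ε ∧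
    (fun τ : ℍ ↦ F τ - p.eval (Complex.exp (-(2 * Real.pi * Complex.I * (τ : ℂ)))))
      =O[atImInfty] fun τ : ℍ ↦ Real.exp (-ε * τ.im)

/-- The power `q ^ l`, `q = exp (2πiτ)`. -/
def qPow (l : ℤ) (τ : ℍ) : ℂ := Complex.exp (2 * Real.pi * Complex.I * l * (τ : ℂ))

/-- The upper incomplete gamma function `Γ(s, x) = ∫_x^∞ e^{-t} t^{s-1} dt`, for `x > 0`. -/
def upperGamma (s x : ℝ) : ℝ := ∫ t in Set.Ioi x, Real.exp (-t) * t ^ (s - 1)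

/-- `F` has the weight `2 - k` Fourier expansion
`F = ∑_{l ≥ -m} c⁺(l) q^l + ∑_{n ≥ 1} c⁻(-n) Γ(k - 1, 4πnv) q^{-n}`. -/
def HasFourierExpansion (k : ℤ) (m : ℕ) (F : ℍ → ℂ) (cPlus cMinus : ℤ → ℂ) : Prop :=
  ∀ τ : ℍ, ∃ Fplus Fminus : ℂ,
    HasSum (fun i : ℕ ↦ cPlus ((i : ℤ) - m) * qPow ((i : ℤ) - m) τ) Fplus ∧
    HasSum (fun i : ℕ ↦ cMinus (-((i : ℤ) + 1)) *
      (upperGamma ((k : ℝ) - 1) (4 * Real.pi * ((i : ℝ) + 1) * τ.im) : ℂ) *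
        qPow (-((i : ℤ) + 1)) τ) Fminus ∧
    F τ = Fplus + Fminus

/-- The weight `κ` Hecke operator
`(f | T_κ(n))(τ) = n^{κ-1} ∑_{ad = n} d^{-κ} ∑_{0 ≤ b < d} f((aτ + b) / d)`. -/
def heckeOp (κ : ℤ) (n : ℕ) (f : ℍ → ℂ) (τ : ℍ) : ℂ :=
  (n : ℂ) ^ (κ - 1) * ∑ d ∈ n.divisors, (d : ℂ) ^ (-κ) *
    ∑ b ∈ Finset.range d, f (ofComplex ((((n / d : ℕ) : ℂ) * (τ : ℂ) + (b : ℂ)) / (d : ℂ)))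

/-- The `n`-th Fourier coefficient of a cusp form on `SL₂(ℤ)`. -/
def cuspCoeff {k : ℤ} (G : CuspForm 𝒮ℒ k) (n : ℕ) : ℂ := (qExpansion 1 G).coeff n

/-- Normalized Hecke eigenforms on `SL₂(ℤ)`: cusp forms with first Fourier coefficient `1` that are
eigenvectors of every Hecke operator. -/
structure IsNormalizedEigenform {k : ℤ} (G : CuspForm 𝒮ℒ k) : Prop where
  coeff_one : cuspCoeff G 1 = 1
  eigen : ∀ n : ℕ, 1 ≤ n → ∃ c : ℂ, ∀ τ : ℍ, heckeOp k n G τ = c * G τ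

/-- `H_n(F; τ) = Δ^{b(k-2)} Ẽ_{k-2} (n^{k-1} F | T_{2-k}(n) - a(n) F)`. -/
def heckeFun (k : ℤ) (F : ℍ → ℂ) (a : ℕ → ℂ) (n : ℕ) (τ : ℍ) : ℂ :=
  discriminant τ ^ bExp (k - 2) * Etilde (k - 2) τ *
    ((n : ℂ) ^ (k - 1) * heckeOp (2 - k) n F τ - a n * F τ)

/-- The arc `𝒜 = {τ ∈ ℍ : |τ| = 1, -1/2 ≤ Re τ ≤ 0}`. -/
def arcA : Set ℍ := {τ | ‖(τ : ℂ)‖ = 1 ∧ -(1 / 2) ≤ τ.re ∧ τ.re ≤ 0}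

/-- The real parts of the points of `𝒜` at which `j` takes a value in `[a, b]`. -/
def arcProjection (a b : ℝ) : Set ℝ :=
  {t | ∃ τ ∈ arcA, τ.re = t ∧ ∃ x ∈ Set.Icc a b, jInv τ = (x : ℂ)}

/-- The real zeros of the polynomials `P n` are equidistributed in `[0, 1728]` as `n → ∞`, where
`[0, 1728] = j(𝒜)` carries the probability measure transported by `j` from the one on `𝒜` that is
uniform in `Re τ ∈ [-1/2, 0]`: for each subinterval `[a, b]`, the proportion of the zeros lying in
`[a, b]` tends to the mass of `[a, b]`. -/
def ZerosEquidistributed (P : ℕ → ℝ[X]) : Prop :=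
  ∀ a b : ℝ, 0 ≤ a → a ≤ b → b ≤ 1728 →
    Filter.Tendsto
      (fun n : ℕ ↦ ({x : ℝ | x ∈ Set.Icc a b ∧ (P n).IsRoot x}.ncard : ℝ) / (P n).natDegree)
      Filter.atTop (nhds (2 * MeasureTheory.volume.real (arcProjection a b)))

end HeckeZeros

end

noncomputable section

namespace HeckeZeros

open Filter Topology
open scoped Manifold

/-! ### Integral matrices acting on the upper half-plane -/

/-! Write `k = r + 2`, so that `F` has weight `-r`, and put `N = mn`. The operator `∂/∂τ̄` carries
the weight `-r` Hecke sum of `F` to the weight `r + 2` Hecke operator acting on the shadow `G`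
(`dbar_heckeSum_of_dbar`). As `G` is an eigenform with real eigenvalues `a(n)`, the combination
`n^{k-1} F | T_{2-k}(n) - a(n) F` is holomorphic. Multiplication by `Δ^b Ẽ`, of weight `r`, gives a
holomorphic invariant function with leading term `q^{-(N-b)}`. It is therefore a monic polynomial in
`j` of degree `N - b`, with real coefficients because `F` has real Fourier coefficients
(`IsWeakEigenform.exists_polynomial`).

The zeros are found on the arc by the method of Rankin and Swinnerton-Dyer. The Hecke sum runs over
`SL₂(ℤ)`-classes of integral matrices of determinant `n`, and a representative with bottom row `(c,
d)` moves `τ` to height `n Im τ / |cτ + d|²`. On the arc, `|cτ + d|² < 2` leaves three classes: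
`nτ`, `-n/τ` and `-n/(τ + 1)`. The first two contribute `q^{-N}` and `τ^r` times its conjugate.
After multiplication by `e^{-irθ/2}`, `τ = e^{iθ}`, they add up to `2 e^{2πN Im τ} cos(2πN Re τ +
rθ/2)`. The third is at most about `e^{2πN Im τ}`, and everything else, the `a(n) F` term included,
is exponentially smaller. The total error is at most `3/2` against an amplitude of `2`
(`eventually_abs_arcFun_sub_le`), so the real function on the arc changes sign between consecutive
points where the phase is a multiple of `π`.

The phase runs from `π(-N + r/3)` at `ρ` to `πr/4` at `i`. The sign changes, together with the zeros
that `Ẽ` forces at `ρ` and `i`, number exactly `N - b` (`card_zeros_eq`). As `j` is injective on the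
arc, they exhaust the roots and all roots are simple. The zero with index `h` has `2N Re τ = h +
O(1)`, so the number of zeros over an interval of real parts is `2N` times its length up to a
bounded error. This is the equidistribution.

Two side facts use the same tools. Injectivity of `j` on the arc (`jInv_injOn_arcA`) comes from the
asymptotics applied to `j` itself: the Hecke sum of `j` is a polynomial in `j`, yet its growth in
`n` detects the height of the point. The case `m = 0` is impossible (`not_tendsto_one`), since it
would force `a(n) = σ_{k-1}(n)`, which is too large for a cusp form. -/

/-- The point `(aτ + b) / d`. -/
def heckePt (a b d : ℕ) (τ : ℍ) : ℍ := ofComplex (((a : ℂ) * (τ : ℂ) + (b : ℂ)) / (d : ℂ))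

/-- The Hecke sum `∑_{ad = n} d^r ∑_{0 ≤ b < d} F((aτ + b) / d)`. -/
def heckeSum (r n : ℕ) (F : ℍ → ℂ) (τ : ℍ) : ℂ :=
  ∑ d ∈ n.divisors, (d : ℂ) ^ r * ∑ b ∈ Finset.range d, F (heckePt (n / d) b d τ)

lemma heckePt_aux (a b d : ℕ) (τ : ℍ) :
    (((a : ℂ) * (τ : ℂ) + (b : ℂ)) / (d : ℂ)).im = a * τ.im / d := by
  have : (((a : ℂ) * (τ : ℂ) + (b : ℂ)) / (d : ℂ)) =
      (((a : ℝ) : ℂ) * (τ : ℂ) + ((b : ℝ) : ℂ)) / ((d : ℝ) : ℂ) := by push_cast; rfl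
  rw [this, Complex.div_ofReal_im]
  simp

lemma coe_heckePt {a b d : ℕ} (ha : 0 < a) (hd : 0 < d) (τ : ℍ) :
    (heckePt a b d τ : ℂ) = ((a : ℂ) * (τ : ℂ) + (b : ℂ)) / (d : ℂ) := by
  have h : 0 < (((a : ℂ) * (τ : ℂ) + (b : ℂ)) / (d : ℂ)).im := by
    rw [heckePt_aux]
    have := τ.im_pos
    positivity
  rw [heckePt, ofComplex_apply_of_im_pos h]

lemma heckePt_im {a b d : ℕ} (ha : 0 < a) (hd : 0 < d) (τ : ℍ) :
    (heckePt a b d τ).im = a * τ.im / d := by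
  rw [← coe_im, coe_heckePt ha hd, heckePt_aux]

/-- The powers `n ^ (k - 1)` and `n ^ ((2 - k) - 1)` cancel for `k = r + 2`, so everything below can
be done with the unnormalised `heckeSum` and natural exponents. -/
lemma heckeOp_eq_heckeSum {r n : ℕ} (hn : 0 < n) (F : ℍ → ℂ) (τ : ℍ) :
    (n : ℂ) ^ (((r : ℤ) + 2) - 1) * heckeOp (2 - ((r : ℤ) + 2)) n F τ = heckeSum r n F τ := by
  have hn' : (n : ℂ) ≠ 0 := by exact_mod_cast hn.ne'
  unfold heckeOp heckeSum heckePt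
  rw [← mul_assoc, ← zpow_add₀ hn']
  simp only [show ((r : ℤ) + 2) - 1 + (2 - ((r : ℤ) + 2) - 1) = 0 by ring, zpow_zero, one_mul,
    show -(2 - ((r : ℤ) + 2)) = (r : ℤ) by ring, zpow_natCast]

/-- The denominator `cτ + d` of an integral matrix. -/
def den (A : Matrix (Fin 2) (Fin 2) ℤ) (τ : ℍ) : ℂ := (A 1 0 : ℂ) * τ + (A 1 1 : ℂ)

/-- The action of an integral matrix of positive determinant on the upper half-plane. -/
def moeb (A : Matrix (Fin 2) (Fin 2) ℤ) (τ : ℍ) : ℍ :=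
  ofComplex (((A 0 0 : ℂ) * τ + (A 0 1 : ℂ)) / den A τ)

lemma den_ne_zero {A : Matrix (Fin 2) (Fin 2) ℤ} (hA : 0 < A.det) (τ : ℍ) : den A τ ≠ 0 := by
  intro h
  have him := congrArg Complex.im h
  have hre := congrArg Complex.re h
  simp only [den, Complex.add_im, Complex.mul_im, Complex.intCast_re, Complex.intCast_im,
    coe_im, zero_mul, add_zero, Complex.zero_im, mul_eq_zero, Int.cast_eq_zero, τ.im_ne_zero,
    or_false] at him
  simp only [den, him, Int.cast_zero, zero_mul, zero_add, Complex.intCast_re, Complex.zero_re,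
    Int.cast_eq_zero] at hre
  rw [Matrix.det_fin_two, him, hre] at hA
  simp at hA

lemma moeb_aux (A : Matrix (Fin 2) (Fin 2) ℤ) (τ : ℍ) :
    (((A 0 0 : ℂ) * τ + (A 0 1 : ℂ)) / den A τ).im = A.det * τ.im / Complex.normSq (den A τ) := by
  rw [Complex.div_im, Matrix.det_fin_two]
  simp [den]
  ring

lemma moeb_pos {A : Matrix (Fin 2) (Fin 2) ℤ} (hA : 0 < A.det) (τ : ℍ) :
    0 < (((A 0 0 : ℂ) * τ + (A 0 1 : ℂ)) / den A τ).im := by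
  rw [moeb_aux]
  have h1 : (0 : ℝ) < A.det := by exact_mod_cast hA
  have h2 := Complex.normSq_pos.mpr (den_ne_zero hA τ)
  have := τ.im_pos
  positivity

lemma coe_moeb {A : Matrix (Fin 2) (Fin 2) ℤ} (hA : 0 < A.det) (τ : ℍ) :
    (moeb A τ : ℂ) = ((A 0 0 : ℂ) * τ + (A 0 1 : ℂ)) / den A τ := by
  rw [moeb, ofComplex_apply_of_im_pos (moeb_pos hA τ)]

lemma im_moeb {A : Matrix (Fin 2) (Fin 2) ℤ} (hA : 0 < A.det) (τ : ℍ) :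
    (moeb A τ).im = A.det * τ.im / Complex.normSq (den A τ) := by
  rw [← coe_im, coe_moeb hA, moeb_aux]

lemma den_mul {A B : Matrix (Fin 2) (Fin 2) ℤ} (hB : 0 < B.det) (τ : ℍ) :
    den (A * B) τ = den A (moeb B τ) * den B τ := by
  have h := den_ne_zero hB τ
  conv_rhs => rw [den, coe_moeb hB]
  field_simp
  simp only [den, Matrix.mul_apply, Fin.sum_univ_two, Int.cast_add, Int.cast_mul]
  ring

lemma moeb_mul {A B : Matrix (Fin 2) (Fin 2) ℤ} (hA : 0 < A.det) (hB : 0 < B.det) (τ : ℍ) :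
    moeb (A * B) τ = moeb A (moeb B τ) := by
  have hAB : 0 < (A * B).det := by rw [Matrix.det_mul]; positivity
  have h := den_ne_zero hB τ
  have h' := den_ne_zero hA (moeb B τ)
  apply UpperHalfPlane.ext
  rw [coe_moeb hAB, coe_moeb hA, den_mul hB, div_eq_div_iff (mul_ne_zero h' h) h', coe_moeb hB]
  field_simp
  simp only [den, Matrix.mul_apply, Fin.sum_univ_two, Int.cast_add, Int.cast_mul]
  ring

lemma SL_det_pos (γ : SL(2, ℤ)) : 0 < (γ : Matrix (Fin 2) (Fin 2) ℤ).det := by simp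

lemma moeb_SL (γ : SL(2, ℤ)) (τ : ℍ) : moeb (γ : Matrix (Fin 2) (Fin 2) ℤ) τ = γ • τ := by
  apply UpperHalfPlane.ext
  rw [coe_moeb (SL_det_pos γ), coe_specialLinearGroup_apply]
  simp [den]

/-- Modularity of weight `-r` on `SL₂(ℤ)`, written without denominators. -/
def IsModular (r : ℕ) (F : ℍ → ℂ) : Prop :=
  ∀ (γ : SL(2, ℤ)) (τ : ℍ), den (γ : Matrix (Fin 2) (Fin 2) ℤ) τ ^ r * F (γ • τ) = F τ

lemma isModular_iff {r : ℕ} {F : ℍ → ℂ} :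
    IsModular r F ↔ ∀ γ : SL(2, ℤ), F ∣[-(r : ℤ)] γ = F := by
  have (γ : SL(2, ℤ)) (τ : ℍ) : (F ∣[-(r : ℤ)] γ) τ =
      den (γ : Matrix (Fin 2) (Fin 2) ℤ) τ ^ r * F (γ • τ) := by
    rw [SL_slash_apply, neg_neg, zpow_natCast, mul_comm]
    rfl
  constructor
  · intro h γ
    ext τ
    rw [this, h]
  · intro h γ τ
    rw [← this, h]

/-- The function `τ ↦ (cτ + d)^r F(Aτ)`. -/
def slashed (r : ℕ) (F : ℍ → ℂ) (A : Matrix (Fin 2) (Fin 2) ℤ) (τ : ℍ) : ℂ :=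
  den A τ ^ r * F (moeb A τ)

/-- `slashed r F A` depends only on the class of `A` in `SL₂(ℤ) \ M₂(ℤ)`. A representative of a term
of the Hecke sum can thus be changed freely. -/
lemma slashed_SL_mul {r : ℕ} {F : ℍ → ℂ} (hF : IsModular r F) (γ : SL(2, ℤ))
    {A : Matrix (Fin 2) (Fin 2) ℤ} (hA : 0 < A.det) (τ : ℍ) :
    slashed r F (γ * A) τ = slashed r F A τ := by
  rw [slashed, den_mul hA, moeb_mul (SL_det_pos γ) hA, slashed, ← hF γ (moeb A τ), moeb_SL]
  ring

lemma slashed_mul_SL (r : ℕ) (F : ℍ → ℂ) (γ : SL(2, ℤ))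
    {A : Matrix (Fin 2) (Fin 2) ℤ} (hA : 0 < A.det) (τ : ℍ) :
    slashed r F (A * γ) τ =
      den (γ : Matrix (Fin 2) (Fin 2) ℤ) τ ^ r * slashed r F A (γ • τ) := by
  rw [slashed, den_mul (SL_det_pos γ), moeb_mul hA (SL_det_pos γ), slashed, moeb_SL]
  ring

/-! ### Coset representatives of determinant `n` and modularity of Hecke sums -/

/-- The upper triangular representatives of the integral matrices of determinant `n`. -/
def repMat (n : ℕ) (s : (_ : ℕ) × ℕ) : Matrix (Fin 2) (Fin 2) ℤ :=
  !![((n / s.1 : ℕ) : ℤ), (s.2 : ℤ); 0, (s.1 : ℤ)]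

/-- The indices `(d, b)` with `d ∣ n` and `0 ≤ b < d`. -/
def repIdx (n : ℕ) : Finset ((_ : ℕ) × ℕ) := n.divisors.sigma fun d ↦ Finset.range d

lemma mem_repIdx {n : ℕ} (hn : 0 < n) {s : (_ : ℕ) × ℕ} :
    s ∈ repIdx n ↔ s.1 ∣ n ∧ s.2 < s.1 := by
  simp [repIdx, hn.ne']

lemma det_repMat {n : ℕ} {s : (_ : ℕ) × ℕ} (h : s.1 ∣ n) : (repMat n s).det = n := by
  rw [repMat, Matrix.det_fin_two_of, mul_zero, sub_zero]
  exact_mod_cast Nat.div_mul_cancel h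

lemma slashed_repMat (n r : ℕ) (F : ℍ → ℂ) (s : (_ : ℕ) × ℕ) (τ : ℍ) :
    slashed r F (repMat n s) τ = (s.1 : ℂ) ^ r * F (heckePt (n / s.1) s.2 s.1 τ) := by
  simp [slashed, den, repMat, moeb, heckePt, -Int.natCast_ediv]

lemma heckeSum_eq_sum_slashed (r n : ℕ) (F : ℍ → ℂ) (τ : ℍ) :
    heckeSum r n F τ = ∑ s ∈ repIdx n, slashed r F (repMat n s) τ := by
  rw [Finset.sum_congr rfl fun s _ ↦ slashed_repMat n r F s τ, repIdx, Finset.sum_sigma,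
    heckeSum]
  simp only [Finset.mul_sum]

/-- The hypotheses on `B` are the conditions defining `FixedDetMatrices.reps`. Positivity of the
determinant makes the lower right entry positive, which removes the absolute values. -/
lemma exists_eq_repMat {n : ℕ} (hn : 0 < n) {B : Matrix (Fin 2) (Fin 2) ℤ} (hB : B.det = n)
    (h1 : B 1 0 = 0) (h2 : 0 < B 0 0) (h3 : 0 ≤ B 0 1) (h4 : |B 0 1| < |B 1 1|) :
    ∃ s ∈ repIdx n, B = repMat n s := by
  have hn' : (0 : ℤ) < n := by exact_mod_cast hn
  rw [Matrix.det_fin_two, h1, mul_zero, sub_zero] at hB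
  have hd : 0 < B 1 1 := by
    rw [← hB] at hn'
    exact pos_of_mul_pos_right hn' h2.le
  rw [abs_of_nonneg h3, abs_of_pos hd] at h4
  obtain ⟨a, ha⟩ := Int.eq_ofNat_of_zero_le h2.le
  obtain ⟨b, hb⟩ := Int.eq_ofNat_of_zero_le h3
  obtain ⟨d, hd'⟩ := Int.eq_ofNat_of_zero_le hd.le
  rw [ha, hd'] at hB
  rw [hd'] at hd
  rw [hb, hd'] at h4
  have hB' : a * d = n := by exact_mod_cast hB
  have hd0 : 0 < d := by exact_mod_cast hd
  refine ⟨⟨d, b⟩, (mem_repIdx hn).mpr ⟨⟨a, by rw [← hB', mul_comm]⟩, by exact_mod_cast h4⟩, ?_⟩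
  have ha' : n / d = a := by rw [← hB', Nat.mul_div_cancel _ hd0]
  ext i j
  fin_cases i <;> fin_cases j
  · simp [repMat, ha, ha', -Int.natCast_ediv]
  · simp [repMat, hb]
  · simp [repMat, h1]
  · simp [repMat, hd']

lemma exists_SL_mul_eq_repMat {n : ℕ} (hn : 0 < n) (A : Matrix (Fin 2) (Fin 2) ℤ)
    (hA : A.det = n) : ∃ (γ : SL(2, ℤ)), ∃ s ∈ repIdx n, A = γ * repMat n s := by
  have hn' : (n : ℤ) ≠ 0 := by exact_mod_cast hn.ne'
  let A' : FixedDetMatrix (Fin 2) ℤ n := ⟨A, hA⟩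
  -- Induction along the generators `S` and `T`: a reduced matrix is its own representative, and a
  -- further factor `S` or `T` is absorbed into `γ`.
  have orb : ∃ γ : SL(2, ℤ), γ • A' ∈ FixedDetMatrices.reps (n : ℤ) := by
    apply FixedDetMatrices.induction_on (C := fun B ↦ ∃ γ : SL(2, ℤ), γ • B ∈
      FixedDetMatrices.reps (n : ℤ)) hn'
    · intro B h1 h2 h3 h4
      exact ⟨1, by rw [one_smul]; exact ⟨h1, h2, h3, h4⟩⟩
    · rintro B ⟨γ, hγ⟩
      exact ⟨γ * ModularGroup.S⁻¹, by rwa [mul_smul, inv_smul_smul]⟩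
    · rintro B ⟨γ, hγ⟩
      exact ⟨γ * ModularGroup.T⁻¹, by rwa [mul_smul, inv_smul_smul]⟩
  obtain ⟨γ, h1, h2, h3, h4⟩ := orb
  obtain ⟨s, hs, h⟩ := exists_eq_repMat hn (γ • A').2 h1 h2 h3 h4
  refine ⟨γ⁻¹, s, hs, ?_⟩
  have h' : (γ : Matrix (Fin 2) (Fin 2) ℤ) * A = repMat n s := h
  rw [← h', ← Matrix.mul_assoc, ← Matrix.SpecialLinearGroup.coe_mul]
  simp

/-- The connecting matrix `γ` must be upper triangular with positive diagonal, hence unipotent. So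
the diagonals agree and `b ≡ b'` modulo `d`, which is equality in the range `0 ≤ b < d`. -/
lemma repMat_eq_of_SL_mul {n : ℕ} (hn : 0 < n) {s t : (_ : ℕ) × ℕ} (hs : s ∈ repIdx n)
    (ht : t ∈ repIdx n) (γ : SL(2, ℤ)) (h : repMat n s = γ * repMat n t) : s = t := by
  rw [mem_repIdx hn] at hs ht
  obtain ⟨d, b⟩ := s
  obtain ⟨d', b'⟩ := t
  simp only at hs ht
  have ha : 0 < n / d := Nat.div_pos (Nat.le_of_dvd hn hs.1) (by omega)
  have ha' : 0 < n / d' := Nat.div_pos (Nat.le_of_dvd hn ht.1) (by omega)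
  have e00 := congrFun (congrFun h 0) 0
  have e01 := congrFun (congrFun h 0) 1
  have e10 := congrFun (congrFun h 1) 0
  have e11 := congrFun (congrFun h 1) 1
  simp only [repMat, Matrix.mul_apply, Fin.sum_univ_two, Matrix.of_apply, Matrix.cons_val',
    Matrix.cons_val_zero, Matrix.cons_val_one, mul_zero, add_zero, Matrix.cons_val_fin_one]
    at e00 e01 e10 e11
  have hdet := γ.det_coe
  rw [Matrix.det_fin_two] at hdet
  have hc : γ 1 0 = 0 := by
    rcases mul_eq_zero.mp e10.symm with h | h
    · exact h
    · omega
  rw [hc] at hdet e11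
  simp only [mul_zero, sub_zero, zero_mul, zero_add] at hdet e11
  have hpos : 0 < γ 0 0 := by
    by_contra hneg
    have : (0 : ℤ) < (n / d : ℕ) := by exact_mod_cast ha
    have h' : (0 : ℤ) < (n / d' : ℕ) := by exact_mod_cast ha'
    nlinarith
  have h00 : γ 0 0 = 1 := by
    rcases Int.mul_eq_one_iff_eq_one_or_neg_one.mp hdet with h | h <;> omega
  rw [h00, one_mul] at hdet
  rw [hdet, one_mul] at e11
  have hdd : d = d' := by exact_mod_cast e11
  subst hdd
  rw [h00, one_mul] at e01
  have hb : b = b' := by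
    have h1 : (b : ℤ) % d = b := Int.emod_eq_of_lt (by positivity) (by exact_mod_cast hs.2)
    have h2 : (b' : ℤ) % d = b' := Int.emod_eq_of_lt (by positivity) (by exact_mod_cast ht.2)
    have h3 : (b : ℤ) % d = (b' : ℤ) % d := by rw [e01, Int.add_mul_emod_self_right]
    rw [h1, h2] at h3
    exact_mod_cast h3
  rw [hb]

/-- Right multiplication by `γ` permutes the left `SL₂(ℤ)`-classes of determinant `n`. Injectivity
of the induced self-map of the finite index set already gives bijectivity. -/
lemma sum_slashed_mul_SL {r n : ℕ} (hn : 0 < n) {F : ℍ → ℂ} (hF : IsModular r F)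
    (γ : SL(2, ℤ)) (τ : ℍ) :
    ∑ s ∈ repIdx n, slashed r F (repMat n s * γ) τ =
      ∑ s ∈ repIdx n, slashed r F (repMat n s) τ := by
  have hdet (s) (hs : s ∈ repIdx n) : (repMat n s * (γ : Matrix (Fin 2) (Fin 2) ℤ)).det = n := by
    rw [Matrix.det_mul, det_repMat ((mem_repIdx hn).mp hs).1]
    simp
  have hex (s) (hs : s ∈ repIdx n) : ∃ t ∈ repIdx n, ∃ δ : SL(2, ℤ),
      repMat n s * (γ : Matrix (Fin 2) (Fin 2) ℤ) = δ * repMat n t := by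
    obtain ⟨δ, t, ht, h⟩ := exists_SL_mul_eq_repMat hn _ (hdet s hs)
    exact ⟨t, ht, δ, h⟩
  choose! i hi δ hδ using hex
  have hinj : Set.InjOn i (repIdx n) := by
    intro s hs t ht hst
    refine repMat_eq_of_SL_mul hn hs ht (δ s * (δ t)⁻¹) ?_
    have h1 := hδ s hs
    have h2 := hδ t ht
    rw [hst] at h1
    have h3 : repMat n (i t) = ((δ t)⁻¹ : SL(2, ℤ)) *
        (repMat n t * (γ : Matrix (Fin 2) (Fin 2) ℤ)) := by
      rw [h2, ← Matrix.mul_assoc, ← Matrix.SpecialLinearGroup.coe_mul]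
      simp
    have h4 : repMat n s = repMat n s * (γ : Matrix (Fin 2) (Fin 2) ℤ) * (γ⁻¹ : SL(2, ℤ)) := by
      rw [Matrix.mul_assoc, ← Matrix.SpecialLinearGroup.coe_mul]
      simp
    rw [h4, h1, h3, Matrix.SpecialLinearGroup.coe_mul]
    simp only [Matrix.mul_assoc]
    rw [← Matrix.SpecialLinearGroup.coe_mul γ γ⁻¹]
    simp
  refine Finset.sum_nbij i (fun s hs ↦ hi s hs) hinj
    (Finset.surjOn_of_injOn_of_card_le i (fun s hs ↦ hi s hs) hinj le_rfl) fun s hs ↦ ?_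
  rw [hδ s hs, slashed_SL_mul hF]
  rw [det_repMat ((mem_repIdx hn).mp (hi s hs)).1]
  exact_mod_cast hn

/-- Hecke sums preserve modularity. -/
theorem IsModular.heckeSum {r n : ℕ} (hn : 0 < n) {F : ℍ → ℂ} (hF : IsModular r F) :
    IsModular r (heckeSum r n F) := by
  intro γ τ
  rw [heckeSum_eq_sum_slashed, heckeSum_eq_sum_slashed, Finset.mul_sum,
    ← sum_slashed_mul_SL hn hF γ τ]
  refine Finset.sum_congr rfl fun s hs ↦ ?_
  rw [slashed_mul_SL]
  rw [det_repMat ((mem_repIdx hn).mp hs).1]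
  exact_mod_cast hn

/-! ### Asymptotics of Hecke sums on the unit arc -/

/-- `F = q^{-m} + O(q^{1-m})` near the cusp. -/
def HasLeadingTerm (m : ℕ) (F : ℍ → ℂ) : Prop :=
  ∃ C v₀ : ℝ, 0 < C ∧ 0 < v₀ ∧ ∀ τ : ℍ, v₀ ≤ τ.im →
    ‖F τ - qPow (-(m : ℤ)) τ‖ ≤ C * Real.exp (2 * Real.pi * ((m : ℝ) - 1) * τ.im)

lemma norm_qPow (l : ℤ) (τ : ℍ) : ‖qPow l τ‖ = Real.exp (-(2 * Real.pi * l * τ.im)) := by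
  rw [qPow, Complex.norm_exp]
  congr 1
  simp [Complex.mul_re]

lemma norm_le_of_hasLeadingTerm {m : ℕ} {F : ℍ → ℂ} {C : ℝ} {τ : ℍ} (hC : 0 ≤ C)
    (h : ‖F τ - qPow (-(m : ℤ)) τ‖ ≤ C * Real.exp (2 * Real.pi * ((m : ℝ) - 1) * τ.im)) :
    ‖F τ‖ ≤ (1 + C) * Real.exp (2 * Real.pi * m * τ.im) := by
  have h1 : ‖qPow (-(m : ℤ)) τ‖ = Real.exp (2 * Real.pi * m * τ.im) := by
    rw [norm_qPow]
    congr 1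
    push_cast
    ring
  have h2 : Real.exp (2 * Real.pi * ((m : ℝ) - 1) * τ.im) ≤ Real.exp (2 * Real.pi * m * τ.im) := by
    apply Real.exp_le_exp.mpr
    have := τ.im_pos
    have := Real.pi_pos
    have h3 : 0 ≤ 2 * Real.pi * τ.im := by positivity
    nlinarith
  calc ‖F τ‖ = ‖qPow (-(m : ℤ)) τ + (F τ - qPow (-(m : ℤ)) τ)‖ := by congr 1; ring
    _ ≤ _ := norm_add_le _ _
    _ ≤ Real.exp (2 * Real.pi * m * τ.im) + C * Real.exp (2 * Real.pi * m * τ.im) := by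
      rw [h1]
      gcongr
      exact h.trans (by gcongr)
    _ = _ := by ring

/-- `F e^{-2πm Im τ}` is continuous and bounded near the cusp, hence bounded on the whole
fundamental domain. -/
lemma HasLeadingTerm.bound_fd {m : ℕ} {F : ℍ → ℂ} (hF : HasLeadingTerm m F)
    (hc : Continuous F) :
    ∃ C : ℝ, 0 < C ∧ ∀ τ ∈ ModularGroup.fd, ‖F τ‖ ≤ C * Real.exp (2 * Real.pi * m * τ.im) := by
  obtain ⟨C, v₀, hC, -, h⟩ := hF
  have hc' : Continuous fun τ : ℍ ↦ F τ * (Real.exp (-(2 * Real.pi * m * τ.im)) : ℂ) := by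
    fun_prop
  have hn (τ : ℍ) : ‖F τ * (Real.exp (-(2 * Real.pi * m * τ.im)) : ℂ)‖ =
      ‖F τ‖ * Real.exp (-(2 * Real.pi * m * τ.im)) := by
    rw [norm_mul, Complex.norm_real, Real.norm_of_nonneg (Real.exp_pos _).le]
  obtain ⟨D, hD⟩ := ModularGroup.exists_bound_fundamental_domain_of_isBigO hc' (t := 0) (by
    refine Asymptotics.IsBigO.of_bound (1 + C) ?_
    rw [atImInfty_basis.eventually_iff]
    refine ⟨v₀, trivial, fun τ hτ ↦ ?_⟩
    rw [hn]
    have h1 := norm_le_of_hasLeadingTerm hC.le (h τ hτ)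
    rw [Real.exp_neg, Real.rpow_zero, norm_one, mul_one, mul_inv_le_iff₀ (Real.exp_pos _)]
    exact h1)
  refine ⟨|D| + 1, by positivity, fun τ hτ ↦ ?_⟩
  have h1 := hD τ hτ
  rw [hn, Real.rpow_zero, mul_one, Real.exp_neg, mul_inv_le_iff₀ (Real.exp_pos _)] at h1
  refine h1.trans ?_
  gcongr
  exact (le_abs_self D).trans (by linarith)

lemma normSq_den_of_norm_one {A : Matrix (Fin 2) (Fin 2) ℤ} {τ : ℍ} (hτ : ‖(τ : ℂ)‖ = 1) :
    Complex.normSq (den A τ) =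
      (A 1 0 : ℝ) ^ 2 + (A 1 1 : ℝ) ^ 2 + 2 * (A 1 0 : ℝ) * (A 1 1 : ℝ) * τ.re := by
  have h : τ.re * τ.re + τ.im * τ.im = 1 := by
    have := Complex.normSq_eq_norm_sq (τ : ℂ)
    rw [hτ, Complex.normSq_apply] at this
    simpa using this
  rw [Complex.normSq_apply]
  simp [den]
  linear_combination (A 1 0 : ℝ) ^ 2 * h

lemma re_im_of_norm_one {τ : ℍ} (hτ : ‖(τ : ℂ)‖ = 1) : τ.re ^ 2 + τ.im ^ 2 = 1 := by
  have := Complex.normSq_eq_norm_sq (τ : ℂ)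
  rw [hτ, Complex.normSq_apply] at this
  simp only [coe_re, coe_im] at this
  linarith

lemma half_le_im_of_mem_arcA {τ : ℍ} (hτ : τ ∈ arcA) : 1 / 2 ≤ τ.im := by
  have h := re_im_of_norm_one hτ.1
  have := hτ.2.1
  have := hτ.2.2
  have := τ.im_pos
  nlinarith

lemma im_le_one_of_mem_arcA {τ : ℍ} (hτ : τ ∈ arcA) : τ.im ≤ 1 := by
  have h := re_im_of_norm_one hτ.1
  have := τ.im_pos
  nlinarith [sq_nonneg τ.re]

/-- For `t ∈ [-1/2, 0]` the form is bounded below by `c² + d²` if `cd ≤ 0` and by `c² - cd + d²` if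
`cd > 0`. Both are integral, so a value below `2` leaves a short list. -/
lemma bottom_row_of_small {c d : ℤ} {t : ℝ} (ht : -(1 / 2) ≤ t) (ht' : t ≤ 0)
    (h : (c : ℝ) ^ 2 + (d : ℝ) ^ 2 + 2 * (c : ℝ) * (d : ℝ) * t < 2) (h0 : c ≠ 0 ∨ d ≠ 0) :
    (c = 0 ∧ (d = 1 ∨ d = -1)) ∨ ((c = 1 ∨ c = -1) ∧ (d = 0 ∨ d = c)) := by
  rcases le_or_gt (c * d) 0 with hcd | hcd
  · have h1 : (c : ℝ) * d ≤ 0 := by exact_mod_cast hcd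
    have h2 : (c : ℝ) ^ 2 + (d : ℝ) ^ 2 < 2 := by nlinarith
    have h3 : c ^ 2 + d ^ 2 < 2 := by exact_mod_cast h2
    have hc1 : c ≤ 1 := by nlinarith
    have hc2 : -1 ≤ c := by nlinarith
    have hd1 : d ≤ 1 := by nlinarith
    have hd2 : -1 ≤ d := by nlinarith
    interval_cases c <;> interval_cases d <;> simp_all
  · have h1 : (0 : ℝ) < (c : ℝ) * d := by exact_mod_cast hcd
    have h2 : (c : ℝ) ^ 2 + (d : ℝ) ^ 2 - c * d < 2 := by nlinarith
    have h3 : c ^ 2 + d ^ 2 - c * d < 2 := by exact_mod_cast h2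
    have h4 : c = d := by
      by_contra hne
      have : 1 ≤ (c - d) ^ 2 := by
        have : 0 < (c - d) ^ 2 := by
          have : c - d ≠ 0 := sub_ne_zero.mpr hne
          positivity
        omega
      nlinarith
    subst h4
    have hc1 : c ≤ 1 := by nlinarith
    have hc2 : -1 ≤ c := by nlinarith
    interval_cases c <;> simp_all

/-- The bottom row of `γ * repMat n s` is `(γ₁₀ a, γ₁₀ b + γ₁₁ d)`. If it is `(0, ±1)` then `d = 1`.
If it is `±(1, 0)` or `±(1, 1)`, then `a = 1` and `b` is congruent to `0` or `1` modulo `n`. -/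
lemma rep_of_small_den {n : ℕ} (hn : 2 ≤ n) {τ : ℍ} (hτ : τ ∈ arcA) {s : (_ : ℕ) × ℕ}
    (hs : s ∈ repIdx n) (γ : SL(2, ℤ))
    (h : Complex.normSq (den (γ * repMat n s) τ) < 2) :
    s = ⟨1, 0⟩ ∨ s = ⟨n, 0⟩ ∨ s = ⟨n, 1⟩ := by
  obtain ⟨d, b⟩ := s
  rw [mem_repIdx (by omega)] at hs
  obtain ⟨⟨a, had⟩, hb⟩ := hs
  simp only at had hb
  have hd0 : 0 < d := by omega
  have ha' : n / d = a := by rw [had, Nat.mul_div_cancel_left _ hd0]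
  have ha0 : 0 < a := by
    rcases Nat.eq_zero_or_pos a with h | h
    · simp [h] at had
      omega
    · exact h
  have hdet : 0 < ((γ : Matrix (Fin 2) (Fin 2) ℤ) * repMat n ⟨d, b⟩).det := by
    rw [Matrix.det_mul, det_repMat ⟨a, had⟩]
    simp
    omega
  have e10 : ((γ : Matrix (Fin 2) (Fin 2) ℤ) * repMat n ⟨d, b⟩) 1 0 = γ 1 0 * a := by
    simp [Matrix.mul_apply, Fin.sum_univ_two, repMat, ha', -Int.natCast_ediv]
  have e11 : ((γ : Matrix (Fin 2) (Fin 2) ℤ) * repMat n ⟨d, b⟩) 1 1 =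
      γ 1 0 * b + γ 1 1 * d := by
    simp [Matrix.mul_apply, Fin.sum_univ_two, repMat]
  have hne : γ 1 0 * a ≠ 0 ∨ γ 1 0 * b + γ 1 1 * d ≠ 0 := by
    by_contra hcon
    push Not at hcon
    rw [Matrix.det_fin_two, e10, e11, hcon.1, hcon.2] at hdet
    simp at hdet
  rw [normSq_den_of_norm_one hτ.1, e10, e11] at h
  have hr := bottom_row_of_small hτ.2.1 hτ.2.2 h hne
  rcases hr with ⟨h1, h2⟩ | ⟨h1, h2⟩
  · left
    have hc : γ 1 0 = 0 := by
      rcases mul_eq_zero.mp h1 with h | h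
      · exact h
      · omega
    rw [hc, zero_mul, zero_add] at h2
    have hd1 : d = 1 := by
      have : (d : ℤ) ∣ 1 := by
        rcases h2 with h2 | h2
        · exact ⟨γ 1 1, by linarith⟩
        · exact ⟨-γ 1 1, by linarith⟩
      have := Int.eq_one_of_dvd_one (by positivity) this
      exact_mod_cast this
    subst hd1
    simp
    omega
  · right
    have ha1 : a = 1 := by
      have : (a : ℤ) ∣ 1 := by
        rcases h1 with h1 | h1
        · exact ⟨γ 1 0, by linarith⟩
        · exact ⟨-γ 1 0, by linarith⟩
      have := Int.eq_one_of_dvd_one (by positivity) this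
      exact_mod_cast this
    subst ha1
    rw [mul_one] at had
    subst had
    simp only [Nat.cast_one, mul_one] at h1 h2
    rcases h2 with h2 | h2
    · left
      have : (n : ℤ) ∣ b := by
        rcases h1 with h1 | h1 <;> rw [h1] at h2
        · exact ⟨-γ 1 1, by linarith⟩
        · exact ⟨γ 1 1, by linarith⟩
      have : n ∣ b := by exact_mod_cast this
      have := Nat.eq_zero_of_dvd_of_lt this hb
      rw [this]
    · right
      have : (n : ℤ) ∣ (b : ℤ) - 1 := by
        rcases h1 with h1 | h1 <;> rw [h1] at h2
        · exact ⟨-γ 1 1, by linarith⟩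
        · exact ⟨γ 1 1, by linarith⟩
      have hb1 : (b : ℤ) - 1 = 0 := by
        rcases Nat.eq_zero_or_pos b with h0 | h0
        · subst h0
          rw [Nat.cast_zero, zero_sub, dvd_neg] at this
          have := Int.eq_one_of_dvd_one (by positivity) this
          omega
        · exact Int.eq_zero_of_dvd_of_nonneg_of_lt (by omega) (by omega) this
      have : b = 1 := by omega
      rw [this]

lemma card_repIdx_le (n : ℕ) : (repIdx n).card ≤ (n + 1) ^ 2 := by
  rw [repIdx, Finset.card_sigma]
  simp only [Finset.card_range]
  calc ∑ d ∈ n.divisors, d ≤ ∑ d ∈ n.divisors, (n + 1) :=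
        Finset.sum_le_sum fun d hd ↦ (Nat.divisor_le hd).trans (by omega)
    _ = n.divisors.card * (n + 1) := by simp
    _ ≤ _ := by
      rw [sq]
      gcongr
      exact (Nat.card_divisors_le_self n).trans (by omega)

/-- The point is moved into the fundamental domain, where the growth of `F` is controlled by the
height. Outside the three special classes that height is `n Im τ / |cτ + d|² ≤ n Im τ / 2`, which
halves the exponent. -/
lemma norm_slashed_le_of_not_special {r n m : ℕ} (hn : 2 ≤ n) {F : ℍ → ℂ} (hF : IsModular r F)
    {C : ℝ} (hC : 0 < C)
    (hbd : ∀ τ ∈ ModularGroup.fd, ‖F τ‖ ≤ C * Real.exp (2 * Real.pi * m * τ.im))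
    {τ : ℍ} (hτ : τ ∈ arcA) {s : (_ : ℕ) × ℕ} (hs : s ∈ repIdx n) (h1 : s ≠ ⟨1, 0⟩)
    (h2 : s ≠ ⟨n, 0⟩) (h3 : s ≠ ⟨n, 1⟩) :
    ‖slashed r F (repMat n s) τ‖ ≤ C * (2 * n) ^ r * Real.exp (Real.pi * m * n * τ.im) := by
  have hdet := det_repMat ((mem_repIdx (by omega)).mp hs).1
  have hpos : 0 < (repMat n s).det := by rw [hdet]; exact_mod_cast (by omega)
  obtain ⟨γ, hγ⟩ := ModularGroup.exists_smul_mem_fd (moeb (repMat n s) τ)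
  rw [← moeb_SL, ← moeb_mul (SL_det_pos γ) hpos] at hγ
  rw [← slashed_SL_mul hF γ hpos]
  set A := (γ : Matrix (Fin 2) (Fin 2) ℤ) * repMat n s with hA
  have hAdet : A.det = n := by rw [hA, Matrix.det_mul, hdet]; simp
  have hApos : 0 < A.det := by rw [hAdet]; exact_mod_cast (by omega)
  have hx2 : 2 ≤ Complex.normSq (den A τ) := by
    by_contra hcon
    rcases rep_of_small_den hn hτ hs γ (not_le.mp hcon) with h | h | h <;> contradiction
  have him := im_moeb hApos τ
  rw [hAdet] at him
  set x := Complex.normSq (den A τ)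
  have hn0 : (0 : ℝ) < n := by exact_mod_cast (by omega)
  have hn1 : (1 : ℝ) ≤ n := by exact_mod_cast (by omega)
  -- Points of the fundamental domain have height at least `1/2`, so `|cτ + d|² ≤ 2n Im τ ≤ 2n`, and
  -- `n ≥ 1` allows the square to be dropped.
  have hden : ‖den A τ‖ ≤ 2 * n := by
    have hh : 1 / 2 ≤ (moeb A τ).im := by
      have := ModularGroup.three_le_four_mul_im_sq_of_mem_fd hγ
      have := (moeb A τ).im_pos
      nlinarith
    rw [him, le_div_iff₀ (by linarith)] at hh
    have hv := im_le_one_of_mem_arcA hτ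
    have hx : x ≤ 2 * n := by push_cast at hh; nlinarith
    have hx' : ‖den A τ‖ ^ 2 ≤ 2 * n := by rw [← Complex.normSq_eq_norm_sq]; exact hx
    nlinarith [norm_nonneg (den A τ)]
  rw [slashed, norm_mul, norm_pow]
  have hb := hbd _ hγ
  have he : Real.exp (2 * Real.pi * m * (moeb A τ).im) ≤ Real.exp (Real.pi * m * n * τ.im) := by
    apply Real.exp_le_exp.mpr
    have h4 : (moeb A τ).im ≤ n * τ.im / 2 := by
      rw [him]
      push_cast
      have := τ.im_pos
      gcongr
    have := Real.pi_pos
    calc 2 * Real.pi * m * (moeb A τ).im ≤ 2 * Real.pi * m * (n * τ.im / 2) := by gcongr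
      _ = _ := by ring
  calc ‖den A τ‖ ^ r * ‖F (moeb A τ)‖
      ≤ (2 * n) ^ r * (C * Real.exp (Real.pi * m * n * τ.im)) := by
        gcongr
        exact hb.trans (by gcongr)
    _ = _ := by ring

lemma eventually_mul_pow_mul_exp_neg_le (K : ℝ) (j : ℕ) {ε : ℝ} (hε : 0 < ε) :
    ∀ᶠ n : ℕ in atTop, K * (n : ℝ) ^ j * Real.exp (-n) ≤ ε := by
  have h := ((Real.tendsto_pow_mul_exp_neg_atTop_nhds_zero j).comp
    tendsto_natCast_atTop_atTop).const_mul K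
  rw [mul_zero] at h
  filter_upwards [h.eventually_lt_const hε] with n hn
  rw [mul_assoc]
  exact hn.le

lemma norm_slashed_sub_le {r m : ℕ} {F : ℍ → ℂ} {C v₀ : ℝ}
    (hlead : ∀ τ : ℍ, v₀ ≤ τ.im →
      ‖F τ - qPow (-(m : ℤ)) τ‖ ≤ C * Real.exp (2 * Real.pi * ((m : ℝ) - 1) * τ.im))
    (A : Matrix (Fin 2) (Fin 2) ℤ) (τ : ℍ) (h : v₀ ≤ (moeb A τ).im) :
    ‖slashed r F A τ - den A τ ^ r * qPow (-(m : ℤ)) (moeb A τ)‖ ≤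
      ‖den A τ‖ ^ r * (C * Real.exp (2 * Real.pi * ((m : ℝ) - 1) * (moeb A τ).im)) := by
  rw [slashed, ← mul_sub, norm_mul, norm_pow]
  gcongr
  exact hlead _ h

lemma slashed_repMat_one_zero_sub {r n m : ℕ} (hn : 0 < n) {F : ℍ → ℂ} {C v₀ : ℝ}
    (hlead : ∀ τ : ℍ, v₀ ≤ τ.im →
      ‖F τ - qPow (-(m : ℤ)) τ‖ ≤ C * Real.exp (2 * Real.pi * ((m : ℝ) - 1) * τ.im))
    (τ : ℍ) (h : v₀ ≤ n * τ.im) :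
    ‖slashed r F (repMat n ⟨1, 0⟩) τ - qPow (-((m * n : ℕ) : ℤ)) τ‖ ≤
      C * Real.exp (2 * Real.pi * ((m : ℝ) - 1) * (n * τ.im)) := by
  have hdet : (repMat n ⟨1, 0⟩).det = n := det_repMat (one_dvd n)
  have hpos : 0 < (repMat n ⟨1, 0⟩).det := by rw [hdet]; exact_mod_cast hn
  have hden : den (repMat n ⟨1, 0⟩) τ = 1 := by simp [den, repMat]
  have him : (moeb (repMat n ⟨1, 0⟩) τ).im = n * τ.im := by
    rw [im_moeb hpos, hdet, hden]
    simp
  have hq : qPow (-(m : ℤ)) (moeb (repMat n ⟨1, 0⟩) τ) = qPow (-((m * n : ℕ) : ℤ)) τ := by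
    rw [qPow, qPow, coe_moeb hpos, hden]
    congr 1
    simp [repMat]
    ring
  have := norm_slashed_sub_le (r := r) hlead (repMat n ⟨1, 0⟩) τ (by rwa [him])
  rwa [hq, hden, him, one_pow, one_mul, norm_one, one_pow, one_mul] at this

lemma coe_S_smul (τ : ℍ) : ((ModularGroup.S • τ : ℍ) : ℂ) = -1 / τ := by
  rw [modular_S_smul, coe_mk, neg_div, one_div, inv_neg]

/-- `S` replaces `τ/n` by `-n/τ`, with denominator `τ` of absolute value `1`. This term is therefore
as large as the one from `nτ`. -/
lemma slashed_repMat_zero_sub {r n m : ℕ} (hn : 0 < n) {F : ℍ → ℂ} (hF : IsModular r F)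
    {C v₀ : ℝ}
    (hlead : ∀ τ : ℍ, v₀ ≤ τ.im →
      ‖F τ - qPow (-(m : ℤ)) τ‖ ≤ C * Real.exp (2 * Real.pi * ((m : ℝ) - 1) * τ.im))
    {τ : ℍ} (hτ : ‖(τ : ℂ)‖ = 1) (h : v₀ ≤ n * τ.im) :
    ‖slashed r F (repMat n ⟨n, 0⟩) τ -
        (τ : ℂ) ^ r * qPow (-((m * n : ℕ) : ℤ)) (ModularGroup.S • τ)‖ ≤
      C * Real.exp (2 * Real.pi * ((m : ℝ) - 1) * (n * τ.im)) := by
  have hd : (repMat n ⟨n, 0⟩).det = n := det_repMat dvd_rfl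
  have hd0 : 0 < (repMat n ⟨n, 0⟩).det := by rw [hd]; exact_mod_cast hn
  rw [← slashed_SL_mul hF ModularGroup.S hd0]
  set A := (ModularGroup.S : Matrix (Fin 2) (Fin 2) ℤ) * repMat n ⟨n, 0⟩ with hA
  have hdet : A.det = n := by rw [hA, Matrix.det_mul, hd]; simp
  have hpos : 0 < A.det := by rw [hdet]; exact_mod_cast hn
  have hAe : A = !![0, -(n : ℤ); 1, 0] := by
    rw [hA]
    simp [ModularGroup.S, repMat, Nat.div_self hn]
  have hden : den A τ = τ := by simp [den, hAe]
  have him : (moeb A τ).im = n * τ.im := by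
    rw [im_moeb hpos, hdet, hden, Complex.normSq_eq_norm_sq, hτ]
    simp
  have hq : qPow (-(m : ℤ)) (moeb A τ) =
      qPow (-((m * n : ℕ) : ℤ)) (ModularGroup.S • τ) := by
    rw [qPow, qPow, coe_moeb hpos, hden, coe_S_smul]
    congr 1
    simp [hAe]
    ring
  have := norm_slashed_sub_le (r := r) hlead A τ (by rwa [him])
  rwa [hq, hden, him, hτ, one_pow, one_mul] at this

lemma norm_add_one_sq_mem {τ : ℍ} (hτ : τ ∈ arcA) :
    Complex.normSq ((τ : ℂ) + 1) = 2 + 2 * τ.re := by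
  have h := re_im_of_norm_one hτ.1
  rw [Complex.normSq_apply]
  simp
  linarith

/-- This is the class of `-n/(τ + 1)`, of height `n Im τ / |τ + 1|²`. At `ρ` one has `|τ + 1| = 1`,
so the term is as large as the two main ones and only an inequality with constant `1` is available.
Away from `ρ` the factor `|τ + 1|^r` has to be paid for by the loss of height. -/
lemma norm_slashed_repMat_one_le {r n m : ℕ} (hm : 1 ≤ m) (hn : 2 ≤ n) (hrn : r ≤ n) {F : ℍ → ℂ}
    (hF : IsModular r F) {C v₀ : ℝ} (hC : 0 < C)
    (hlead : ∀ τ : ℍ, v₀ ≤ τ.im →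
      ‖F τ - qPow (-(m : ℤ)) τ‖ ≤ C * Real.exp (2 * Real.pi * ((m : ℝ) - 1) * τ.im))
    {τ : ℍ} (hτ : τ ∈ arcA) (h : v₀ ≤ n * τ.im / 2) :
    ‖slashed r F (repMat n ⟨n, 1⟩) τ‖ ≤
      Real.exp (2 * Real.pi * m * (n * τ.im)) +
        2 ^ r * (C * Real.exp (2 * Real.pi * ((m : ℝ) - 1) * (n * τ.im))) := by
  have hd : (repMat n ⟨n, 1⟩).det = n := det_repMat dvd_rfl
  have hd0 : 0 < (repMat n ⟨n, 1⟩).det := by rw [hd]; exact_mod_cast (by omega)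
  rw [← slashed_SL_mul hF ModularGroup.S hd0]
  set A := (ModularGroup.S : Matrix (Fin 2) (Fin 2) ℤ) * repMat n ⟨n, 1⟩ with hA
  have hdet : A.det = n := by rw [hA, Matrix.det_mul, hd]; simp
  have hpos : 0 < A.det := by rw [hdet]; exact_mod_cast (by omega)
  have hAe : A = !![0, -(n : ℤ); 1, 1] := by
    rw [hA]
    simp [ModularGroup.S, repMat, Nat.div_self (show 0 < n by omega)]
  have hden : den A τ = τ + 1 := by simp [den, hAe]
  set x : ℝ := 2 + 2 * τ.re with hx
  have hx1 : 1 ≤ x := by linarith [hτ.2.1]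
  have hx2 : x ≤ 2 := by linarith [hτ.2.2]
  have him : (moeb A τ).im = n * τ.im / x := by
    rw [im_moeb hpos, hdet, hden, norm_add_one_sq_mem hτ, Int.cast_natCast]
  have hv := τ.im_pos
  have hv2 := half_le_im_of_mem_arcA hτ
  have hn0 : (0 : ℝ) < n := by exact_mod_cast (by omega)
  have hnx : ‖den A τ‖ ^ 2 = x := by
    rw [← Complex.normSq_eq_norm_sq, hden, norm_add_one_sq_mem hτ]
  have hn2 : ‖den A τ‖ ≤ 2 := by nlinarith [norm_nonneg (den A τ)]
  have hmain := norm_slashed_sub_le (r := r) hlead A τ (by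
    rw [him]
    exact h.trans (by gcongr))
  have hle : n * τ.im / x ≤ n * τ.im := div_le_self (by positivity) hx1
  have hpi := Real.pi_gt_three
  have hm' : (1 : ℝ) ≤ m := by exact_mod_cast hm
  have hm0 : (0 : ℝ) ≤ (m : ℝ) - 1 := by linarith
  have hq : ‖den A τ ^ r * qPow (-(m : ℤ)) (moeb A τ)‖ ≤
      Real.exp (2 * Real.pi * m * (n * τ.im)) := by
    rw [norm_mul, norm_pow, norm_qPow, him]
    -- `y` is the relative loss of height. From `x - 1 = xy ≤ 2y` follows `x ≤ e^{2y}`, so `|τ +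
    -- 1|^r ≤ e^{ry}`. The exponent falls by `2πmn Im τ · y`, and `2πmn Im τ ≥ n ≥ r`.
    set y : ℝ := 1 - 1 / x with hy
    have hy0 : 0 ≤ y := by
      rw [hy, sub_nonneg, div_le_one (by linarith)]
      exact hx1
    have hxy : x - 1 ≤ 2 * y := by
      have : x - 1 = x * y := by rw [hy]; field_simp
      rw [this]
      gcongr
    have hdy : ‖den A τ‖ ≤ Real.exp y := by
      have h1 : x ≤ Real.exp (2 * y) := by
        have := Real.add_one_le_exp (2 * y)
        linarith
      have h2 : Real.exp (2 * y) = Real.exp y ^ 2 := by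
        rw [← Real.exp_nat_mul]; norm_num
      rw [h2, ← hnx] at h1
      exact (sq_le_sq₀ (norm_nonneg _) (Real.exp_pos _).le).mp h1
    calc ‖den A τ‖ ^ r * Real.exp (-(2 * Real.pi * ((-(m : ℤ) : ℤ) : ℝ) * (n * τ.im / x)))
        ≤ Real.exp y ^ r * Real.exp (-(2 * Real.pi * ((-(m : ℤ) : ℤ) : ℝ) * (n * τ.im / x))) := by
          gcongr
      _ = Real.exp (r * y + 2 * Real.pi * m * (n * τ.im) * (1 - y)) := by
          rw [← Real.exp_nat_mul, ← Real.exp_add]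
          congr 1
          rw [hy]
          push_cast
          field_simp
          ring
      _ ≤ _ := by
          apply Real.exp_le_exp.mpr
          have h1 : (r : ℝ) ≤ n := by exact_mod_cast hrn
          have h2 : (n : ℝ) ≤ 2 * Real.pi * m * (n * τ.im) := by
            have : 1 ≤ 2 * Real.pi * m * τ.im := by
              have : (1 : ℝ) * 1 * (1 / 2) ≤ Real.pi * m * τ.im := by gcongr; linarith
              linarith
            nlinarith
          nlinarith
  have h2 : ‖den A τ‖ ^ r * (C * Real.exp (2 * Real.pi * ((m : ℝ) - 1) * (moeb A τ).im)) ≤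
      2 ^ r * (C * Real.exp (2 * Real.pi * ((m : ℝ) - 1) * (n * τ.im))) := by
    rw [him]
    gcongr
  calc ‖slashed r F A τ‖ = ‖den A τ ^ r * qPow (-(m : ℤ)) (moeb A τ) +
        (slashed r F A τ - den A τ ^ r * qPow (-(m : ℤ)) (moeb A τ))‖ := by congr 1; ring
    _ ≤ _ := norm_add_le _ _
    _ ≤ _ := add_le_add hq (hmain.trans h2)

/-- On the arc a Hecke sum is `q^{-mn}` plus its image under `τ ↦ -1/τ`, up to an error of size at
most `5/4` times the absolute value of `q^{-mn}`. -/
theorem heckeSum_arc {r m : ℕ} (hm : 1 ≤ m) {F : ℍ → ℂ} (hF : IsModular r F) (hc : Continuous F)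
    (hlead : HasLeadingTerm m F) :
    ∀ᶠ n : ℕ in atTop, ∀ τ ∈ arcA,
      ‖heckeSum r n F τ - (qPow (-((m * n : ℕ) : ℤ)) τ +
        (τ : ℂ) ^ r * qPow (-((m * n : ℕ) : ℤ)) (ModularGroup.S • τ))‖ ≤
      5 / 4 * Real.exp (2 * Real.pi * m * (n * τ.im)) := by
  obtain ⟨D, hD, hbd⟩ := hlead.bound_fd hc
  obtain ⟨C, v₀, hC, hv₀, hl⟩ := hlead
  -- Since `Im τ ≥ 1/2`, the condition `n ≥ 4v₀` puts all three special points in the range of the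
  -- leading term estimate. The constant collects `C` twice for the main terms, `2^r C` for the
  -- third, and `4 · 2^r D` for at most `(2n)²` remaining terms with factor `(2n)^r`. The bound
  -- `1/4` for this sum, added to `1` for the third term, gives `5/4`.
  filter_upwards [eventually_ge_atTop 2, eventually_ge_atTop r,
    eventually_ge_atTop ⌈4 * v₀⌉₊,
    eventually_mul_pow_mul_exp_neg_le (C * (2 + 2 ^ r) + D * 2 ^ r * 4) (r + 2)
      (show (0 : ℝ) < 1 / 4 by norm_num)] with n hn hrn hnv hsmall τ hτ
  have hnv' : 4 * v₀ ≤ n := (Nat.le_ceil _).trans (by exact_mod_cast hnv)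
  have hv := half_le_im_of_mem_arcA hτ
  have hpi := Real.pi_gt_three
  have hn1 : (1 : ℝ) ≤ n := by exact_mod_cast (by omega)
  have hn0 : (0 : ℝ) < n := by linarith
  have hm' : (1 : ℝ) ≤ m := by exact_mod_cast hm
  have hnv2 : v₀ ≤ n * τ.im / 2 := by nlinarith
  have hnv1 : v₀ ≤ n * τ.im := by nlinarith
  set e₀ := Real.exp (2 * Real.pi * m * (n * τ.im)) with he₀
  have he₀pos : 0 < e₀ := Real.exp_pos _
  have hlow : Real.exp (2 * Real.pi * ((m : ℝ) - 1) * (n * τ.im)) ≤ e₀ * Real.exp (-n) := by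
    rw [he₀, ← Real.exp_add]
    apply Real.exp_le_exp.mpr
    have : n * 1 ≤ n * (2 * Real.pi * τ.im) := by gcongr; nlinarith
    nlinarith
  have hmid : Real.exp (Real.pi * m * n * τ.im) ≤ e₀ * Real.exp (-n) := by
    rw [he₀, ← Real.exp_add]
    apply Real.exp_le_exp.mpr
    have h1 : (1 : ℝ) ≤ Real.pi * m * τ.im := by
      have : (2 : ℝ) * 1 * (1 / 2) ≤ Real.pi * m * τ.im := by gcongr; linarith
      linarith
    nlinarith
  have t1 := slashed_repMat_one_zero_sub (r := r) (n := n) (by omega) hl τ hnv1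
  have t2 := slashed_repMat_zero_sub (n := n) (by omega) hF hl hτ.1 hnv1
  have t3 := norm_slashed_repMat_one_le hm hn hrn hF hC hl hτ hnv2
  set I' : Finset ((_ : ℕ) × ℕ) := ((repIdx n).erase ⟨1, 0⟩ |>.erase ⟨n, 0⟩ |>.erase ⟨n, 1⟩)
    with hI'
  have hsum : heckeSum r n F τ = slashed r F (repMat n ⟨1, 0⟩) τ +
      slashed r F (repMat n ⟨n, 0⟩) τ + slashed r F (repMat n ⟨n, 1⟩) τ +
      ∑ s ∈ I', slashed r F (repMat n s) τ := by
    have m1 : (⟨1, 0⟩ : (_ : ℕ) × ℕ) ∈ repIdx n := by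
      rw [mem_repIdx (by omega)]; simp
    have m2 : (⟨n, 0⟩ : (_ : ℕ) × ℕ) ∈ (repIdx n).erase ⟨1, 0⟩ := by
      rw [Finset.mem_erase, mem_repIdx (by omega)]
      refine ⟨fun h ↦ ?_, dvd_rfl, by simp; omega⟩
      simp at h
      omega
    have m3 : (⟨n, 1⟩ : (_ : ℕ) × ℕ) ∈ ((repIdx n).erase ⟨1, 0⟩).erase ⟨n, 0⟩ := by
      rw [Finset.mem_erase, Finset.mem_erase, mem_repIdx (by omega)]
      exact ⟨by simp, by simp, dvd_rfl, by simp; omega⟩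
    rw [heckeSum_eq_sum_slashed, ← Finset.add_sum_erase _ _ m1, ← Finset.add_sum_erase _ _ m2,
      ← Finset.add_sum_erase _ _ m3]
    ring
  have hrest : ‖∑ s ∈ I', slashed r F (repMat n s) τ‖ ≤
      D * 2 ^ r * 4 * (n : ℝ) ^ (r + 2) * (e₀ * Real.exp (-n)) := by
    calc ‖∑ s ∈ I', slashed r F (repMat n s) τ‖
        ≤ ∑ s ∈ I', ‖slashed r F (repMat n s) τ‖ := norm_sum_le _ _
      _ ≤ ∑ s ∈ I', D * (2 * n) ^ r * Real.exp (Real.pi * m * n * τ.im) := by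
          refine Finset.sum_le_sum fun s hs ↦ ?_
          simp only [hI', Finset.mem_erase] at hs
          exact norm_slashed_le_of_not_special hn hF hD hbd hτ hs.2.2.2 hs.2.2.1 hs.2.1 hs.1
      _ = I'.card * (D * (2 * n) ^ r * Real.exp (Real.pi * m * n * τ.im)) := by
          rw [Finset.sum_const, nsmul_eq_mul]
      _ ≤ (2 * n) ^ 2 * (D * (2 * n) ^ r * (e₀ * Real.exp (-n))) := by
          gcongr
          have h1 : I'.card ≤ (n + 1) ^ 2 :=
            (Finset.card_le_card (by
              rw [hI']
              exact (Finset.erase_subset _ _).trans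
                ((Finset.erase_subset _ _).trans (Finset.erase_subset _ _)))).trans
              (card_repIdx_le n)
          have h2 : (I'.card : ℝ) ≤ ((n : ℝ) + 1) ^ 2 := by exact_mod_cast h1
          refine h2.trans ?_
          gcongr
          linarith
      _ = _ := by ring
  have hone : (1 : ℝ) ≤ (n : ℝ) ^ (r + 2) := one_le_pow₀ hn1
  have hfirst : C * Real.exp (2 * Real.pi * ((m : ℝ) - 1) * (n * τ.im)) ≤
      C * ((n : ℝ) ^ (r + 2) * (e₀ * Real.exp (-n))) := by
    gcongr
    calc _ ≤ 1 * (e₀ * Real.exp (-n)) := by rw [one_mul]; exact hlow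
      _ ≤ _ := by gcongr
  have h2r : (0 : ℝ) < 2 ^ r := by positivity
  rw [hsum]
  calc _ = ‖(slashed r F (repMat n ⟨1, 0⟩) τ - qPow (-((m * n : ℕ) : ℤ)) τ) +
        (slashed r F (repMat n ⟨n, 0⟩) τ -
          (τ : ℂ) ^ r * qPow (-((m * n : ℕ) : ℤ)) (ModularGroup.S • τ)) +
        slashed r F (repMat n ⟨n, 1⟩) τ + ∑ s ∈ I', slashed r F (repMat n s) τ‖ := by
        congr 1
        ring
    _ ≤ C * ((n : ℝ) ^ (r + 2) * (e₀ * Real.exp (-n))) +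
        C * ((n : ℝ) ^ (r + 2) * (e₀ * Real.exp (-n))) +
        (e₀ + 2 ^ r * (C * ((n : ℝ) ^ (r + 2) * (e₀ * Real.exp (-n))))) +
        D * 2 ^ r * 4 * (n : ℝ) ^ (r + 2) * (e₀ * Real.exp (-n)) := by
        refine (norm_add_le _ _).trans (add_le_add ((norm_add_le _ _).trans (add_le_add
          ((norm_add_le _ _).trans (add_le_add (t1.trans hfirst) (t2.trans hfirst)))
          (t3.trans ?_))) hrest)
        gcongr
    _ = e₀ + e₀ * ((C * (2 + 2 ^ r) + D * 2 ^ r * 4) * (n : ℝ) ^ (r + 2) * Real.exp (-n)) := by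
        ring
    _ ≤ e₀ + e₀ * (1 / 4) := by gcongr
    _ = _ := by ring

/-! ### Series in `q` -/

lemma qPow_add (l l' : ℤ) (τ : ℍ) : qPow (l + l') τ = qPow l τ * qPow l' τ := by
  rw [qPow, qPow, qPow, ← Complex.exp_add]
  congr 1
  push_cast
  ring

@[simp]
lemma qPow_zero (τ : ℍ) : qPow 0 τ = 1 := by simp [qPow]

lemma qPow_ne_zero (l : ℤ) (τ : ℍ) : qPow l τ ≠ 0 := Complex.exp_ne_zero _

lemma qPow_neg (l : ℤ) (τ : ℍ) : qPow (-l) τ = (qPow l τ)⁻¹ := by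
  exact eq_inv_of_mul_eq_one_left (by rw [← qPow_add, neg_add_cancel, qPow_zero])

lemma qParam_pow (τ : ℍ) (i : ℕ) : Function.Periodic.qParam 1 (τ : ℂ) ^ i = qPow i τ := by
  rw [qPow, Function.Periodic.qParam, ← Complex.exp_nat_mul]
  congr 1
  push_cast
  ring

lemma qPow_J_smul (l : ℤ) (τ : ℍ) : qPow l (J • τ) = (starRingEnd ℂ) (qPow l τ) := by
  rw [qPow, qPow, coe_J_smul, ← Complex.exp_conj]
  congr 1
  simp only [map_mul, Complex.conj_ofNat, Complex.conj_ofReal, Complex.conj_I, map_intCast]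
  ring

lemma J_smul_im (τ : ℍ) : (J • τ).im = τ.im := by
  rw [← coe_im, coe_J_smul]
  simp

/-- A `q`-series is approximated by its first term near the cusp. -/
lemma exists_norm_sub_le_of_hasSum {c : ℕ → ℂ} {m : ℤ} {f : ℍ → ℂ}
    (h : ∀ τ : ℍ, HasSum (fun i : ℕ ↦ c i * qPow ((i : ℤ) - m) τ) (f τ)) {v₀ : ℝ} (hv₀ : 0 < v₀) :
    ∃ C : ℝ, 0 < C ∧ ∀ τ : ℍ, v₀ ≤ τ.im →
      ‖f τ - c 0 * qPow (-m) τ‖ ≤ C * Real.exp (2 * Real.pi * ((m : ℝ) - 1) * τ.im) := by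
  -- Absolute convergence at the single point `iv₀` controls the tail at every greater height,
  -- because each later term decays at least as fast as the one with `i = 1`.
  let τ₀ : ℍ := ⟨v₀ * Complex.I, by simpa using hv₀⟩
  have hτ₀ : τ₀.im = v₀ := by
    rw [← coe_im]
    simp [τ₀]
  have hs := (h τ₀).summable.norm
  simp only [norm_mul, norm_qPow, hτ₀] at hs
  have hs1 := (summable_nat_add_iff 1).mpr hs
  set S := ∑' i : ℕ, ‖c (i + 1)‖ *
    Real.exp (-(2 * Real.pi * (((i + 1 : ℕ) : ℤ) - m : ℤ) * v₀)) with hS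
  have hS0 : 0 ≤ S := tsum_nonneg fun i ↦ by positivity
  refine ⟨S * Real.exp (2 * Real.pi * (1 - m) * v₀) + 1, by positivity, fun τ hτ ↦ ?_⟩
  have h1 := (hasSum_nat_add_iff' 1).mpr (h τ)
  simp only [Finset.range_one, Finset.sum_singleton, Nat.cast_zero, zero_sub] at h1
  have hpi := Real.pi_pos
  have hb (i : ℕ) : ‖c (i + 1) * qPow (((i + 1 : ℕ) : ℤ) - m) τ‖ ≤
      ‖c (i + 1)‖ * Real.exp (-(2 * Real.pi * (((i + 1 : ℕ) : ℤ) - m : ℤ) * v₀)) *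
        Real.exp (-(2 * Real.pi * (1 - m) * (τ.im - v₀))) := by
    rw [norm_mul, norm_qPow, mul_assoc ‖c (i + 1)‖, ← Real.exp_add]
    gcongr
    push_cast
    have : 0 ≤ (i : ℝ) * (2 * Real.pi * (τ.im - v₀)) := by
      have : 0 ≤ τ.im - v₀ := by linarith
      positivity
    nlinarith
  have h2 := tsum_of_norm_bounded ((hs1.hasSum).mul_right
    (Real.exp (-(2 * Real.pi * (1 - m) * (τ.im - v₀))))) hb
  rw [h1.tsum_eq] at h2
  refine h2.trans ?_
  rw [← hS, add_mul, mul_assoc S, ← Real.exp_add]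
  have : -(2 * Real.pi * (1 - (m : ℝ)) * (τ.im - v₀)) =
      2 * Real.pi * (1 - m) * v₀ + 2 * Real.pi * ((m : ℝ) - 1) * τ.im := by ring
  rw [this, one_mul]
  linarith [Real.exp_pos (2 * Real.pi * ((m : ℝ) - 1) * τ.im)]

/-- A `q`-series with real coefficients takes conjugate values at reflected points. -/
lemma apply_J_smul_of_hasSum {c : ℕ → ℝ} {l : ℕ → ℤ} {τ : ℍ} {w w' : ℂ}
    (h : HasSum (fun i : ℕ ↦ (c i : ℂ) * qPow (l i) τ) w)
    (h' : HasSum (fun i : ℕ ↦ (c i : ℂ) * qPow (l i) (J • τ)) w') :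
    w' = (starRingEnd ℂ) w := by
  refine h'.unique ?_
  have := (Complex.hasSum_conj').mpr h
  simpa [qPow_J_smul] using this

/-! ### The forms `E₄`, `E₆`, `Δ` and the invariant `j` -/

lemma hasSum_qPow_of_modularForm {k : ℤ} {F : Type*} [FunLike F ℍ ℂ] [ModularFormClass F 𝒮ℒ k]
    (f : F) (τ : ℍ) :
    HasSum (fun i : ℕ ↦ (qExpansion 1 f).coeff i * qPow i τ) (f τ) := by
  have := ModularForm.hasSum_qExpansion (h := 1) f one_pos one_mem_strictPeriods_SL τ
  simpa [qParam_pow] using this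

lemma exists_norm_E_sub_one_le {k : ℕ} (hk : 3 ≤ k) (hk2 : Even k) :
    ∃ C : ℝ, 0 < C ∧ ∀ τ : ℍ, 1 ≤ τ.im →
      ‖E hk τ - 1‖ ≤ C * Real.exp (-(2 * Real.pi * τ.im)) := by
  obtain ⟨C, hC, h⟩ := exists_norm_sub_le_of_hasSum (m := 0) (f := E hk)
    (c := fun i ↦ (qExpansion 1 (E hk)).coeff i)
    (fun τ ↦ by simpa only [sub_zero] using hasSum_qPow_of_modularForm (E hk) τ) one_pos
  refine ⟨C, hC, fun τ hτ ↦ ?_⟩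
  have := h τ hτ
  rw [EisensteinSeries.E_qExpansion_coeff_zero hk hk2] at this
  simpa using this

lemma exists_norm_discriminant_sub_le :
    ∃ C : ℝ, 0 < C ∧ ∀ τ : ℍ, 1 ≤ τ.im →
      ‖discriminant τ - qPow 1 τ‖ ≤ C * Real.exp (-(4 * Real.pi * τ.im)) := by
  have h0 : (qExpansion 1 CuspForm.discriminant).coeff 0 = 0 :=
    CuspFormClass.qExpansion_coeff_zero CuspForm.discriminant one_pos one_mem_strictPeriods_SL
  obtain ⟨C, hC, h⟩ := exists_norm_sub_le_of_hasSum (m := -1) (f := CuspForm.discriminant)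
    (c := fun i ↦ (qExpansion 1 CuspForm.discriminant).coeff (i + 1))
    (fun τ ↦ by
      have := (hasSum_nat_add_iff' 1).mpr (hasSum_qPow_of_modularForm CuspForm.discriminant τ)
      rw [Finset.sum_range_one, h0, zero_mul, sub_zero] at this
      simpa using this) one_pos
  refine ⟨C, hC, fun τ hτ ↦ ?_⟩
  have := h τ hτ
  simp only [zero_add, CuspForm.coe_discriminant, discriminant_qExpansion_coeff_one, one_mul,
    neg_neg] at this
  refine this.trans (le_of_eq ?_)
  congr 2
  push_cast
  ring

lemma E_J_smul {k : ℕ} (hk : 3 ≤ k) (hk2 : Even k) (τ : ℍ) :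
    E hk (J • τ) = (starRingEnd ℂ) (E hk τ) := by
  have hc (i : ℕ) : (qExpansion 1 (E hk)).coeff i =
      ((if i = 0 then 1 else -(2 * k / _root_.bernoulli k : ℝ) *
        (ArithmeticFunction.sigma (k - 1) i) : ℝ) : ℂ) := by
    rw [EisensteinSeries.E_qExpansion_coeff hk hk2]
    split_ifs <;> push_cast <;> rfl
  have h := fun τ : ℍ ↦ hasSum_qPow_of_modularForm (E hk) τ
  simp only [hc] at h
  exact apply_J_smul_of_hasSum (h τ) (h (J • τ))

lemma E₄_J_smul (τ : ℍ) : E₄ (J • τ) = (starRingEnd ℂ) (E₄ τ) := E_J_smul _ ⟨2, rfl⟩ τ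

lemma E₆_J_smul (τ : ℍ) : E₆ (J • τ) = (starRingEnd ℂ) (E₆ τ) := E_J_smul _ ⟨3, rfl⟩ τ

lemma discriminant_J_smul (τ : ℍ) :
    discriminant (J • τ) = (starRingEnd ℂ) (discriminant τ) := by
  simp [discriminant_eq_E₄_cube_sub_E₆_sq, E₄_J_smul, E₆_J_smul, Complex.conj_ofNat]

lemma jInv_J_smul (τ : ℍ) : jInv (J • τ) = (starRingEnd ℂ) (jInv τ) := by
  simp [jInv, discriminant_J_smul, E₄_J_smul]

lemma apply_SL_smul {k : ℤ} {F : Type*} [FunLike F ℍ ℂ] [SlashInvariantFormClass F 𝒮ℒ k]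
    (f : F) (γ : SL(2, ℤ)) (τ : ℍ) :
    f (γ • τ) = den (γ : Matrix (Fin 2) (Fin 2) ℤ) τ ^ k * f τ := by
  have h : (f : ℍ → ℂ) ∣[k] γ = f := SlashInvariantFormClass.slash_action_eq f _ ⟨γ, rfl⟩
  exact (slash_action_eq'_iff k f γ τ).mp (congrFun h τ)

lemma discriminant_SL_smul (γ : SL(2, ℤ)) (τ : ℍ) :
    discriminant (γ • τ) = den (γ : Matrix (Fin 2) (Fin 2) ℤ) τ ^ (12 : ℤ) * discriminant τ :=
  apply_SL_smul CuspForm.discriminant γ τ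

lemma jInv_SL_smul (γ : SL(2, ℤ)) (τ : ℍ) : jInv (γ • τ) = jInv τ := by
  rw [jInv, jInv, apply_SL_smul E₄, discriminant_SL_smul]
  have h := den_ne_zero (SL_det_pos γ) τ
  have h' := discriminant_ne_zero τ
  field_simp

lemma isModular_jInv : IsModular 0 jInv := fun γ τ ↦ by rw [pow_zero, one_mul, jInv_SL_smul]

lemma mdifferentiable_discriminant : MDiff discriminant := CuspForm.discriminant.holo'

lemma mdifferentiable_jInv : MDiff jInv := by
  have h : jInv = fun τ ↦ (E₄ τ * E₄ τ * E₄ τ) / discriminant τ := by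
    ext τ
    rw [jInv]
    ring
  rw [h]
  exact ((E₄.holo'.mul E₄.holo').mul E₄.holo').div mdifferentiable_discriminant
    discriminant_ne_zero

lemma exp_neg_tendsto_atImInfty {a : ℝ} (ha : 0 < a) :
    Tendsto (fun τ : ℍ ↦ Real.exp (-(a * τ.im))) atImInfty (𝓝 0) :=
  Real.tendsto_exp_atBot.comp (tendsto_neg_atTop_atBot.comp
    (tendsto_comap.const_mul_atTop ha))

lemma tendsto_E_atImInfty {k : ℕ} (hk : 3 ≤ k) (hk2 : Even k) :
    Tendsto (E hk) atImInfty (𝓝 1) := by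
  obtain ⟨C, hC, h⟩ := exists_norm_E_sub_one_le hk hk2
  rw [tendsto_iff_norm_sub_tendsto_zero]
  have h1 := (exp_neg_tendsto_atImInfty Real.two_pi_pos).const_mul C
  rw [mul_zero] at h1
  refine squeeze_zero' (Eventually.of_forall fun _ ↦ norm_nonneg _) ?_ h1
  rw [atImInfty_basis.eventually_iff]
  exact ⟨1, trivial, fun τ hτ ↦ h τ hτ⟩

lemma norm_discriminant_mul_qPow_sub_le :
    ∃ C : ℝ, 0 < C ∧ ∀ τ : ℍ, 1 ≤ τ.im →
      ‖discriminant τ * qPow (-1) τ - 1‖ ≤ C * Real.exp (-(2 * Real.pi * τ.im)) := by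
  obtain ⟨C, hC, h⟩ := exists_norm_discriminant_sub_le
  refine ⟨C, hC, fun τ hτ ↦ ?_⟩
  have h1 : discriminant τ * qPow (-1) τ - 1 = (discriminant τ - qPow 1 τ) * qPow (-1) τ := by
    rw [sub_mul, ← qPow_add]
    simp
  rw [h1, norm_mul, norm_qPow]
  calc _ ≤ C * Real.exp (-(4 * Real.pi * τ.im)) *
        Real.exp (-(2 * Real.pi * ((-1 : ℤ) : ℝ) * τ.im)) := by
        gcongr
        exact h τ hτ
    _ = _ := by
        rw [mul_assoc, ← Real.exp_add]
        congr 2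
        push_cast
        ring

lemma tendsto_discriminant_mul_qPow :
    Tendsto (fun τ ↦ discriminant τ * qPow (-1) τ) atImInfty (𝓝 1) := by
  obtain ⟨C, hC, h⟩ := norm_discriminant_mul_qPow_sub_le
  rw [tendsto_iff_norm_sub_tendsto_zero]
  have h1 := (exp_neg_tendsto_atImInfty Real.two_pi_pos).const_mul C
  rw [mul_zero] at h1
  refine squeeze_zero' (Eventually.of_forall fun _ ↦ norm_nonneg _) ?_ h1
  rw [atImInfty_basis.eventually_iff]
  exact ⟨1, trivial, fun τ hτ ↦ h τ hτ⟩

lemma tendsto_jInv_mul_qPow : Tendsto (fun τ ↦ jInv τ * qPow 1 τ) atImInfty (𝓝 1) := by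
  have h := ((tendsto_E_atImInfty (k := 4) (by norm_num) ⟨2, rfl⟩).pow 3).div
    tendsto_discriminant_mul_qPow one_ne_zero
  rw [one_pow, div_one] at h
  refine h.congr fun τ ↦ ?_
  have h1 := discriminant_ne_zero τ
  have h2 := qPow_ne_zero 1 τ
  simp only [jInv, qPow_neg, Pi.div_apply]
  field_simp

/-- With `E₄ = 1 + x` and `Δ = (1 + y) q`, where `x, y = O(e^{-2π Im τ})`, the difference `j - q⁻¹`
equals `((1 + x)³ - (1 + y)) / (1 + y) · q⁻¹`, which is bounded. This makes `heckeSum_arc`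
applicable to `j` itself. -/
lemma hasLeadingTerm_jInv : HasLeadingTerm 1 jInv := by
  obtain ⟨C, hC, h⟩ := exists_norm_E_sub_one_le (k := 4) (by norm_num) ⟨2, rfl⟩
  obtain ⟨D, hD, h'⟩ := norm_discriminant_mul_qPow_sub_le
  have ev1 := (exp_neg_tendsto_atImInfty Real.two_pi_pos).const_mul (C + D)
  rw [mul_zero] at ev1
  have ev := ev1.eventually_lt_const (show (0 : ℝ) < 1 / 2 by norm_num)
  rw [atImInfty_basis.eventually_iff] at ev
  obtain ⟨A, -, hA⟩ := ev
  refine ⟨2 * (7 * C + D), max A 1, by positivity, by positivity, fun τ hτ ↦ ?_⟩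
  have hτ1 : 1 ≤ τ.im := (le_max_right _ _).trans hτ
  have hs : (C + D) * Real.exp (-(2 * Real.pi * τ.im)) < 1 / 2 := hA ((le_max_left _ _).trans hτ)
  have hE := h τ hτ1
  have hd := h' τ hτ1
  set e := Real.exp (-(2 * Real.pi * τ.im)) with he
  have he0 : 0 < e := Real.exp_pos _
  set x := E (show 3 ≤ 4 by norm_num) τ - 1 with hx
  set y := discriminant τ * qPow (-1) τ - 1 with hy
  have hdn := discriminant_ne_zero τ
  have hqn := qPow_ne_zero 1 τ
  have hCe : 0 < C * e := by positivity
  have hDe : 0 < D * e := by positivity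
  have hyn : 1 / 2 ≤ ‖1 + y‖ := by
    have := norm_sub_norm_le (1 : ℂ) (-y)
    rw [norm_one, norm_neg, sub_neg_eq_add] at this
    nlinarith
  have hy0 : 1 + y ≠ 0 := by
    intro h0
    rw [h0, norm_zero] at hyn
    linarith
  have hE4 : E₄ τ = 1 + x := by rw [hx]; ring
  have hΔ : discriminant τ = (1 + y) * qPow 1 τ := by
    rw [hy, qPow_neg]
    field_simp
    ring
  have key : jInv τ - qPow (-((1 : ℕ) : ℤ)) τ =
      ((x ^ 3 + 3 * x ^ 2 + 3 * x - y) / (1 + y)) * qPow (-1) τ := by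
    rw [jInv, hE4, hΔ, Nat.cast_one, qPow_neg]
    field_simp
    ring
  have hq : ‖qPow (-1) τ‖ = e⁻¹ := by
    rw [norm_qPow, he, ← Real.exp_neg]
    congr 1
    push_cast
    ring
  have hx1 : ‖x‖ ≤ 1 := by nlinarith
  have hnum : ‖x ^ 3 + 3 * x ^ 2 + 3 * x - y‖ ≤ (7 * C + D) * e := by
    calc ‖x ^ 3 + 3 * x ^ 2 + 3 * x - y‖ ≤ ‖x‖ ^ 3 + 3 * ‖x‖ ^ 2 + 3 * ‖x‖ + ‖y‖ := by
          refine (norm_sub_le _ _).trans (add_le_add ((norm_add_le _ _).trans (add_le_add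
            ((norm_add_le _ _).trans (add_le_add ?_ ?_)) ?_)) le_rfl) <;> simp
      _ ≤ ‖x‖ + 3 * ‖x‖ + 3 * ‖x‖ + ‖y‖ := by
          have h0 := norm_nonneg x
          have h2 : ‖x‖ ^ 2 ≤ ‖x‖ := by nlinarith
          have h3 : ‖x‖ ^ 3 ≤ ‖x‖ := by nlinarith
          linarith
      _ ≤ _ := by nlinarith
  rw [key, norm_mul, norm_div, hq, Nat.cast_one, sub_self, mul_zero, zero_mul, Real.exp_zero,
    mul_one, ← div_eq_mul_inv, div_div, div_le_iff₀ (by positivity)]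
  calc _ ≤ (7 * C + D) * e := hnum
    _ = 2 * (7 * C + D) * (1 / 2 * e) := by ring
    _ ≤ _ := by gcongr

/-! ### Holomorphic modular functions are polynomials in `j` -/

lemma IsModular.comp_ofComplex_periodic {r : ℕ} {f : ℍ → ℂ} (hf : IsModular r f) :
    Function.Periodic (f ∘ ofComplex) (1 : ℝ) := by
  have hT (τ : ℍ) : f ((1 : ℝ) +ᵥ τ) = f τ := by
    have := hf ModularGroup.T τ
    rw [modular_T_smul] at this
    simpa [den, ModularGroup.T] using this
  intro w
  rcases le_or_gt w.im 0 with hw | hw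
  -- Outside the upper half-plane `ofComplex` takes a single default value, so periodicity is
  -- trivial there.
  · have hw' : (w + (1 : ℝ)).im ≤ 0 := by simpa using hw
    rw [Function.comp_apply, Function.comp_apply, ofComplex_apply_of_im_nonpos hw,
      ofComplex_apply_of_im_nonpos hw']
  · have hw' : 0 < (w + (1 : ℝ)).im := by simpa using hw
    simp only [Function.comp_apply, ofComplex_apply_of_im_pos hw, ofComplex_apply_of_im_pos hw']
    rw [← hT ⟨w, hw⟩]
    congr 1
    apply UpperHalfPlane.ext
    rw [coe_vadd, coe_mk, coe_mk, add_comm]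

/-- A holomorphic function, modular of weight `-r` and bounded at the cusp, as a modular form. -/
def modularFormOf {r : ℕ} {f : ℍ → ℂ} (hf : IsModular r f) (hol : MDiff f)
    (hb : IsBoundedAtImInfty f) : ModularForm 𝒮ℒ (-(r : ℤ)) where
  toFun := f
  slash_action_eq' A hA := by
    obtain ⟨A, rfl⟩ := hA
    exact isModular_iff.mp hf A
  holo' := hol
  bdd_at_cusps' hc := by
    rw [Subgroup.IsArithmetic.isCusp_iff_isCusp_SL2Z] at hc
    rw [OnePoint.isBoundedAt_iff_forall_SL2Z hc]
    intro γ _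
    rw [isModular_iff.mp hf γ]
    exact hb

lemma eq_zero_of_bounded {r : ℕ} (hr : 0 < r) {f : ℍ → ℂ} (hf : IsModular r f) (hol : MDiff f)
    (hb : IsBoundedAtImInfty f) : f = 0 :=
  ModularFormClass.levelOne_neg_weight_eq_zero (by omega) (modularFormOf hf hol hb)

lemma exists_eq_const_of_bounded {f : ℍ → ℂ} (hf : IsModular 0 f) (hol : MDiff f)
    (hb : IsBoundedAtImInfty f) : ∃ c, ∀ τ, f τ = c := by
  obtain ⟨c, hc⟩ := ModularFormClass.levelOne_weight_zero_const
    (ModularForm.mcast (by simp) (modularFormOf hf hol hb) : ModularForm 𝒮ℒ 0)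
  exact ⟨c, fun τ ↦ congrFun hc τ⟩

lemma MDiff_pow {f : ℍ → ℂ} (hf : MDiff f) (n : ℕ) : MDiff (fun τ ↦ f τ ^ n) := by
  rw [mdifferentiable_iff] at hf ⊢
  exact hf.pow n

/-- A holomorphic `SL₂(ℤ)`-invariant function with a pole of finite order at the cusp is a
polynomial in `j`. -/
theorem exists_polynomial_jInv (N : ℕ) : ∀ {f : ℍ → ℂ}, IsModular 0 f → MDiff f →
    (f =O[atImInfty] fun τ ↦ Real.exp (2 * Real.pi * N * τ.im)) →
    ∃ P : ℂ[X], ∀ τ, P.eval (jInv τ) = f τ := by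
  induction N with
  | zero =>
    intro f hf hol hO
    obtain ⟨c, hc⟩ := exists_eq_const_of_bounded hf hol (by
      have : (fun τ : ℍ ↦ Real.exp (2 * Real.pi * (0 : ℕ) * τ.im)) = fun _ ↦ (1 : ℝ) := by
        ext; simp
      rw [this] at hO
      exact hO)
    exact ⟨C c, fun τ ↦ by rw [eval_C, hc]⟩
  | succ N ih =>
    intro f hf hol hO
    -- `f Δ^{N+1}` is bounded and periodic, so it tends to a limit `c` with error `O(e^{-2π Im τ})`.
    -- That `c` is the leading coefficient to be removed from `f`.
    set g : ℍ → ℂ := fun τ ↦ f τ * discriminant τ ^ (N + 1) with hg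
    have hgd : MDiff g := hol.mul (MDiff_pow mdifferentiable_discriminant _)
    have hΔO : (fun τ ↦ discriminant τ ^ (N + 1)) =O[atImInfty]
        fun τ ↦ Real.exp (-(2 * Real.pi * (N + 1 : ℕ) * τ.im)) := by
      have h1 : discriminant =O[atImInfty] fun τ ↦ Real.exp (-(2 * Real.pi * τ.im)) := by
        have := CuspFormClass.exp_decay_atImInfty (h := 1) CuspForm.discriminant one_pos
          one_mem_strictPeriods_SL
        simpa using this
      refine (h1.pow (N + 1)).congr_right fun τ ↦ ?_
      rw [← Real.exp_nat_mul]
      congr 1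
      ring
    have hgb : IsBoundedAtImInfty g := by
      have := hO.mul hΔO
      refine this.congr_right fun τ ↦ ?_
      rw [← Real.exp_add]
      simp
    have hper : Function.Periodic (g ∘ ofComplex) (1 : ℝ) := by
      have h1 := hf.comp_ofComplex_periodic
      have h2 := SlashInvariantFormClass.periodic_comp_ofComplex CuspForm.discriminant
        one_mem_strictPeriods_SL
      intro w
      have e1 := h1 w
      have e2 := h2 w
      simp only [Function.comp_apply, hg, CuspForm.coe_discriminant] at e1 e2 ⊢
      rw [e1, e2]
    have hdecay := exp_decay_sub_atImInfty one_pos hper hgd hgb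
    set c := valueAtInfty g
    have hE : (fun τ ↦ E₄ τ ^ (3 * (N + 1)) - 1) =O[atImInfty]
        fun τ : ℍ ↦ Real.exp (-2 * Real.pi * τ.im / 1) := by
      obtain ⟨C, hC, h⟩ := exists_norm_E_sub_one_le (k := 4) (by norm_num) ⟨2, rfl⟩
      have h1 : (fun τ ↦ E₄ τ - 1) =O[atImInfty]
          fun τ : ℍ ↦ Real.exp (-2 * Real.pi * τ.im / 1) := by
        refine Asymptotics.IsBigO.of_bound C ?_
        rw [atImInfty_basis.eventually_iff]
        refine ⟨1, trivial, fun τ hτ ↦ ?_⟩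
        rw [Real.norm_of_nonneg (Real.exp_pos _).le]
        simpa using h τ hτ
      have h2 : (fun τ ↦ ∑ i ∈ Finset.range (3 * (N + 1)), E₄ τ ^ i) =O[atImInfty]
          fun _ : ℍ ↦ (1 : ℝ) := by
        have := tendsto_finsetSum (Finset.range (3 * (N + 1))) fun i _ ↦
          (tendsto_E_atImInfty (k := 4) (by norm_num) ⟨2, rfl⟩).pow i
        exact this.isBigO_one ℝ
      refine (h2.mul h1).congr (fun τ ↦ ?_) fun τ ↦ one_mul _
      exact geom_sum_mul _ _
    -- Both `f Δ^{N+1} - c` and `c (E₄^{3(N+1)} - 1)` are `O(e^{-2π Im τ})`. Division by `Δ^{N+1}`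
    -- then leaves a pole of order at most `N`.
    set f' : ℍ → ℂ := fun τ ↦ f τ - c * jInv τ ^ (N + 1) with hf'
    have hfac (τ : ℍ) : f' τ = ((g τ - c) - c * (E₄ τ ^ (3 * (N + 1)) - 1)) *
        (discriminant τ ^ (N + 1))⁻¹ := by
      have := discriminant_ne_zero τ
      simp only [hf', hg, jInv, div_pow]
      field_simp
      ring
    have hinvO : (fun τ ↦ (discriminant τ ^ (N + 1))⁻¹) =O[atImInfty]
        fun τ ↦ Real.exp (2 * Real.pi * (N + 1 : ℕ) * τ.im) := by
      have := (exp_isBigO_discriminant.pow (N + 1)).inv_rev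
        (Eventually.of_forall fun τ h ↦ absurd h (pow_ne_zero _ (Real.exp_ne_zero _)))
      refine this.congr_right fun τ ↦ ?_
      rw [← Real.exp_nat_mul, ← Real.exp_neg]
      congr 1
      ring
    obtain ⟨P, hP⟩ := ih (f := f') (by
        intro γ τ
        have h1 := hf γ τ
        rw [pow_zero, one_mul] at h1 ⊢
        simp only [hf', h1, jInv_SL_smul])
      (hol.sub (mdifferentiable_const.mul (MDiff_pow mdifferentiable_jInv _)))
      (by
        have h1 := ((hdecay.sub (hE.const_mul_left c)).mul hinvO)
        refine h1.congr (fun τ ↦ (hfac τ).symm) fun τ ↦ ?_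
        rw [← Real.exp_add]
        congr 1
        push_cast
        ring)
    refine ⟨P + C c * X ^ (N + 1), fun τ ↦ ?_⟩
    rw [eval_add, hP, eval_mul, eval_C, eval_pow, eval_X]
    simp [hf']

/-! ### Hecke sums near the cusp -/

lemma HasLeadingTerm.tendsto {m : ℕ} {F : ℍ → ℂ} (hF : HasLeadingTerm m F) :
    Tendsto (fun τ ↦ F τ * qPow m τ) atImInfty (𝓝 1) := by
  obtain ⟨C, v₀, hC, hv₀, h⟩ := hF
  rw [tendsto_iff_norm_sub_tendsto_zero]
  have h1 := (exp_neg_tendsto_atImInfty Real.two_pi_pos).const_mul C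
  rw [mul_zero] at h1
  refine squeeze_zero' (Eventually.of_forall fun _ ↦ norm_nonneg _) ?_ h1
  rw [atImInfty_basis.eventually_iff]
  refine ⟨v₀, trivial, fun τ hτ ↦ ?_⟩
  have h2 : F τ * qPow m τ - 1 = (F τ - qPow (-(m : ℤ)) τ) * qPow m τ := by
    rw [sub_mul, ← qPow_add, neg_add_cancel, qPow_zero]
  rw [h2, norm_mul, norm_qPow]
  calc _ ≤ C * Real.exp (2 * Real.pi * ((m : ℝ) - 1) * τ.im) *
        Real.exp (-(2 * Real.pi * ((m : ℤ) : ℝ) * τ.im)) := by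
        gcongr
        exact h τ hτ
    _ = _ := by
        rw [mul_assoc C, ← Real.exp_add]
        congr 2
        push_cast
        ring

lemma tendsto_heckePt {a d : ℕ} (ha : 0 < a) (hd : 0 < d) (b : ℕ) :
    Tendsto (heckePt a b d) atImInfty atImInfty := by
  rw [atImInfty, tendsto_comap_iff]
  have h : (UpperHalfPlane.im ∘ heckePt a b d) = fun τ ↦ (a / d : ℝ) * τ.im := by
    ext τ
    rw [Function.comp_apply, heckePt_im ha hd]
    ring
  rw [h]
  exact tendsto_comap.const_mul_atTop (by positivity)

/-- Only the term `d = 1`, which is `F(nτ)`, reaches order `q^{-mn}`. The others are evaluated at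
height `n Im τ / d²`. -/
lemma tendsto_heckeSum_mul_qPow {r m n : ℕ} (hm : 1 ≤ m) (hn : 0 < n) {F : ℍ → ℂ}
    (hF : HasLeadingTerm m F) :
    Tendsto (fun τ ↦ heckeSum r n F τ * qPow ((m * n : ℕ) : ℤ) τ) atImInfty (𝓝 1) := by
  -- The second alternative covers pairs that do not occur in the sum, where `b < d`.
  have hterm (d : ℕ) (hd : d ∈ n.divisors) (b : ℕ) :
      Tendsto (fun τ ↦ F (heckePt (n / d) b d τ) * qPow ((m * n : ℕ) : ℤ) τ) atImInfty
        (𝓝 (if d = 1 ∧ b = 0 then 1 else if d = 1 then 1 else 0)) ∨ d = 1 ∧ b ≠ 0 := by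
    by_cases hdb : d = 1 ∧ b ≠ 0
    · exact Or.inr hdb
    left
    have hdn := Nat.dvd_of_mem_divisors hd
    have hd0 : 0 < d := Nat.pos_of_dvd_of_pos hdn hn
    have ha0 : 0 < n / d := Nat.div_pos (Nat.le_of_dvd hn hdn) hd0
    have h1 := hF.tendsto.comp (tendsto_heckePt ha0 hd0 b)
    by_cases hd1 : d = 1
    · have hb : b = 0 := by
        by_contra hb
        exact hdb ⟨hd1, hb⟩
      subst hd1 hb
      simp only [and_self, if_true]
      refine h1.congr fun τ ↦ ?_
      simp only [Function.comp_apply]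
      congr 1
      rw [qPow, qPow, coe_heckePt ha0 hd0]
      congr 1
      push_cast
      simp
      ring
    · rw [if_neg (fun h ↦ hd1 h.1), if_neg hd1]
      have h2 : Tendsto (fun τ ↦ qPow (-(m : ℤ)) (heckePt (n / d) b d τ) *
          qPow ((m * n : ℕ) : ℤ) τ) atImInfty (𝓝 0) := by
        rw [tendsto_zero_iff_norm_tendsto_zero]
        have hlt : ((n / d : ℕ) : ℝ) / d < n := by
          have hd2 : (1 : ℝ) < d := by exact_mod_cast (by omega)
          have h3 : ((n / d : ℕ) : ℝ) ≤ n := by exact_mod_cast Nat.div_le_self n d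
          have hn0 : (0 : ℝ) < n := by exact_mod_cast hn
          rw [div_lt_iff₀ (by linarith)]
          nlinarith
        have hm0 : (0 : ℝ) < m := by exact_mod_cast hm
        have hpos : 0 < 2 * Real.pi * m * (n - ((n / d : ℕ) : ℝ) / d) := by
          have := Real.pi_pos
          have : 0 < n - ((n / d : ℕ) : ℝ) / d := by linarith
          positivity
        refine (exp_neg_tendsto_atImInfty hpos).congr fun τ ↦ ?_
        rw [norm_mul, norm_qPow, norm_qPow, heckePt_im ha0 hd0, ← Real.exp_add]
        congr 1
        push_cast
        ring
      have h3 := h1.mul h2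
      rw [mul_zero] at h3
      refine h3.congr fun τ ↦ ?_
      simp only [Function.comp_apply, qPow_neg]
      have := qPow_ne_zero m (heckePt (n / d) b d τ)
      field_simp
  have hsum : Tendsto (fun τ ↦ ∑ d ∈ n.divisors, (d : ℂ) ^ r * ∑ b ∈ Finset.range d,
      (F (heckePt (n / d) b d τ) * qPow ((m * n : ℕ) : ℤ) τ)) atImInfty
      (𝓝 (∑ d ∈ n.divisors, (d : ℂ) ^ r * ∑ b ∈ Finset.range d, if d = 1 then 1 else 0)) := by
    refine tendsto_finsetSum _ fun d hd ↦ (tendsto_finsetSum _ fun b hb ↦ ?_).const_mul _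
    rcases hterm d hd b with h | h
    · by_cases h1 : d = 1
      · simpa [h1] using h
      · simpa [h1] using h
    · rw [Finset.mem_range] at hb
      omega
  have hval : (∑ d ∈ n.divisors, (d : ℂ) ^ r * ∑ b ∈ Finset.range d,
      (if d = 1 then (1 : ℂ) else 0)) = 1 := by
    rw [Finset.sum_eq_single 1]
    · simp
    · intro d _ hd
      simp [hd]
    · intro h
      exact absurd (Nat.one_mem_divisors.mpr hn.ne') h
  rw [hval] at hsum
  refine hsum.congr fun τ ↦ ?_
  rw [heckeSum, Finset.sum_mul]
  refine Finset.sum_congr rfl fun d _ ↦ ?_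
  rw [mul_assoc, Finset.sum_mul]

lemma isBigO_of_tendsto_mul_qPow {f : ℍ → ℂ} {N : ℕ} {c : ℂ}
    (h : Tendsto (fun τ ↦ f τ * qPow N τ) atImInfty (𝓝 c)) :
    f =O[atImInfty] fun τ ↦ Real.exp (2 * Real.pi * N * τ.im) := by
  have h1 := h.isBigO_one ℝ
  have h2 : (fun τ ↦ qPow (-(N : ℤ)) τ) =O[atImInfty]
      fun τ ↦ Real.exp (2 * Real.pi * N * τ.im) := by
    refine Asymptotics.isBigO_of_le _ fun τ ↦ le_of_eq ?_
    rw [norm_qPow, Real.norm_of_nonneg (Real.exp_pos _).le]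
    congr 1
    push_cast
    ring
  refine (h1.mul h2).congr (fun τ ↦ ?_) fun τ ↦ one_mul _
  rw [mul_assoc, ← qPow_add, add_neg_cancel, qPow_zero, mul_one]

lemma mdifferentiable_heckeSum {F : ℍ → ℂ} (hF : MDiff F) (r : ℕ) {n : ℕ} (hn : 0 < n) :
    MDiff (heckeSum r n F) := by
  rw [mdifferentiable_iff] at hF ⊢
  have h : (heckeSum r n F ∘ ofComplex) = fun z ↦ ∑ d ∈ n.divisors, (d : ℂ) ^ r *
      ∑ b ∈ Finset.range d, (fun z ↦ F (heckePt (n / d) b d (ofComplex z))) z := rfl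
  rw [h]
  refine DifferentiableOn.fun_sum fun d hd ↦ (DifferentiableOn.fun_sum fun b _ ↦ ?_).const_mul _
  have hdn := Nat.dvd_of_mem_divisors hd
  have hd0 : 0 < d := Nat.pos_of_dvd_of_pos hdn hn
  have ha0 : 0 < n / d := Nat.div_pos (Nat.le_of_dvd hn hdn) hd0
  have hmaps (z : ℂ) (hz : 0 < z.im) :
      0 < ((((n / d : ℕ) : ℂ) * z + (b : ℂ)) / (d : ℂ)).im := by
    have := heckePt_aux (n / d) b d ⟨z, hz⟩
    rw [coe_mk] at this
    rw [this]
    have : 0 < UpperHalfPlane.im ⟨z, hz⟩ := hz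
    positivity
  have hcomp : DifferentiableOn ℂ
      ((F ∘ ofComplex) ∘ fun z ↦ (((n / d : ℕ) : ℂ) * z + (b : ℂ)) / (d : ℂ)) {z | 0 < z.im} :=
    hF.comp (by fun_prop) fun z hz ↦ hmaps z hz
  refine hcomp.congr fun z hz ↦ ?_
  simp only [Function.comp_apply, heckePt]
  rw [ofComplex_apply_of_im_pos (z := z) hz]

/-! ### The invariant `j` on the arc -/

/-- On the unit circle `-1/τ = -τ̄`. Modularity under `S` together with real Fourier coefficients
therefore becomes a reality statement on the arc. -/
lemma S_smul_eq_J_smul {τ : ℍ} (hτ : ‖(τ : ℂ)‖ = 1) : ModularGroup.S • τ = J • τ := by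
  apply UpperHalfPlane.ext
  rw [coe_S_smul, coe_J_smul, neg_div, one_div, Complex.inv_def, Complex.normSq_eq_norm_sq, hτ]
  simp

lemma continuous_jInv : Continuous jInv := mdifferentiable_jInv.continuous

/-- Dirichlet approximation of `Mx` with denominators up to `9` gives `kMx` within `1/10` of an
integer. As `π² ≤ 10`, the cosine is at least `1 - (2π/10)²/2 ≥ 4/5`. Approximating `Mx` rather than
`x` ensures `n = kM ≥ M`. -/
lemma exists_large_cos (x : ℝ) (M : ℕ) :
    ∃ n : ℕ, M ≤ n ∧ 3 / 4 ≤ Real.cos (2 * Real.pi * n * x) := by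
  obtain ⟨k, hk, -, h⟩ := Real.exists_nat_abs_mul_sub_round_le (M * x) (show 0 < 9 by norm_num)
  refine ⟨k * M, Nat.le_mul_of_pos_left M hk, ?_⟩
  set y : ℝ := k * (M * x) - round ((k : ℝ) * (M * x)) with hy
  have hy1 : |y| ≤ 1 / 10 := by norm_num at h ⊢; exact h
  have e : 2 * Real.pi * ((k * M : ℕ) : ℝ) * x =
      2 * Real.pi * y + (round ((k : ℝ) * (M * x)) : ℤ) * (2 * Real.pi) := by
    rw [hy]
    push_cast
    ring
  rw [e, Real.cos_add_int_mul_two_pi]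
  have h1 := Real.one_sub_sq_div_two_le_cos (x := 2 * Real.pi * y)
  have h2 : y ^ 2 ≤ 1 / 100 := by
    have := sq_abs y
    have := abs_nonneg y
    nlinarith
  have h3 : Real.pi ^ 2 ≤ 10 := by nlinarith [Real.pi_lt_d2, Real.pi_pos]
  nlinarith [sq_nonneg y]

lemma qPow_neg_re (N : ℕ) (τ : ℍ) :
    (qPow (-(N : ℤ)) τ).re =
      Real.exp (2 * Real.pi * N * τ.im) * Real.cos (2 * Real.pi * N * τ.re) := by
  have h : 2 * (Real.pi : ℂ) * Complex.I * ((-(N : ℤ) : ℤ) : ℂ) * (τ : ℂ) =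
      ((2 * Real.pi * N * τ.im : ℝ) : ℂ) + ((-(2 * Real.pi * N * τ.re) : ℝ) : ℂ) * Complex.I := by
    conv_lhs => rw [← Complex.re_add_im (τ : ℂ), coe_re, coe_im]
    push_cast
    linear_combination -(2 * (Real.pi : ℂ) * N * τ.im) * Complex.I_sq
  rw [qPow, h, Complex.exp_re]
  simp only [Complex.add_re, Complex.ofReal_re, Complex.re_ofReal_mul, Complex.I_re, mul_zero,
    add_zero, Complex.add_im, Complex.ofReal_im, Complex.im_ofReal_mul, Complex.I_im, mul_one,
    zero_add, Real.cos_neg]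

lemma exists_polynomial_heckeSum_jInv {n : ℕ} (hn : 0 < n) :
    ∃ P : ℂ[X], ∀ τ, P.eval (jInv τ) = heckeSum 0 n jInv τ :=
  exists_polynomial_jInv (1 * n) (isModular_jInv.heckeSum hn)
    (mdifferentiable_heckeSum mdifferentiable_jInv 0 hn)
    (isBigO_of_tendsto_mul_qPow (tendsto_heckeSum_mul_qPow le_rfl hn hasLeadingTerm_jInv))

/-- The Hecke sums of `j` are polynomials in `j`, so they agree at `τ₁` and `τ₂` for every `n`. By
`heckeSum_arc` they are `O(e^{2πn Im τ₁})`, while for suitable arbitrarily large `n` they are at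
least a constant times `e^{2πn Im τ₂}`. A strictly larger `Im τ₂` is impossible. -/
lemma im_le_im_of_jInv_eq {τ₁ τ₂ : ℍ} (h₁ : τ₁ ∈ arcA) (h₂ : τ₂ ∈ arcA)
    (h : jInv τ₁ = jInv τ₂) : τ₂.im ≤ τ₁.im := by
  by_contra hlt
  push Not at hlt
  obtain ⟨N, hN⟩ := eventually_atTop.mp
    (heckeSum_arc le_rfl isModular_jInv continuous_jInv hasLeadingTerm_jInv)
  set δ := 2 * Real.pi * (τ₂.im - τ₁.im) with hδ
  have hδ0 : 0 < δ := by
    have := Real.pi_pos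
    have : 0 < τ₂.im - τ₁.im := by linarith
    positivity
  -- The common value `U` satisfies `(2 · 3/4 - 5/4) x₂ ≤ |U| ≤ (2 + 5/4) x₁`, that is `x₂ ≤ 13 x₁`.
  -- The choice `n ≥ 13/δ` makes `x₂/x₁ = e^{nδ} > 13`.
  obtain ⟨n, hn, hcos⟩ := exists_large_cos τ₂.re (N + ⌈13 / δ⌉₊ + 1)
  have e₁ := hN n (by omega) τ₁ h₁
  have e₂ := hN n (by omega) τ₂ h₂
  obtain ⟨P, hP⟩ := exists_polynomial_heckeSum_jInv (n := n) (by omega)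
  rw [← hP, h, hP] at e₁
  simp only [pow_zero, one_mul, S_smul_eq_J_smul h₁.1, S_smul_eq_J_smul h₂.1, qPow_J_smul,
    Complex.add_conj, qPow_neg_re, Nat.cast_one, mul_one] at e₁ e₂
  set U := heckeSum 0 n jInv τ₂
  set x₁ := Real.exp (2 * Real.pi * n * τ₁.im) with hx₁
  set x₂ := Real.exp (2 * Real.pi * n * τ₂.im) with hx₂
  rw [← mul_assoc (2 * Real.pi), ← hx₁] at e₁
  rw [← mul_assoc (2 * Real.pi), ← hx₂] at e₂
  have hx₁0 : 0 < x₁ := Real.exp_pos _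
  have hx₂0 : 0 < x₂ := Real.exp_pos _
  have f₁ : ‖U‖ ≤ 13 / 4 * x₁ := by
    have := norm_sub_norm_le U ((2 * (x₁ * Real.cos (2 * Real.pi * n * τ₁.re)) : ℝ) : ℂ)
    rw [Complex.norm_real, Real.norm_eq_abs, abs_mul, abs_two, abs_mul, abs_of_pos hx₁0] at this
    have hc := Real.abs_cos_le_one (2 * Real.pi * n * τ₁.re)
    nlinarith
  have f₂ : 1 / 4 * x₂ ≤ ‖U‖ := by
    have := norm_sub_norm_le ((2 * (x₂ * Real.cos (2 * Real.pi * n * τ₂.re)) : ℝ) : ℂ) U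
    rw [norm_sub_rev, Complex.norm_real, Real.norm_eq_abs, abs_of_nonneg (by
      have : 0 ≤ Real.cos (2 * Real.pi * n * τ₂.re) := by linarith
      positivity)] at this
    nlinarith
  have hx : x₂ = x₁ * Real.exp (n * δ) := by
    rw [hx₁, hx₂, ← Real.exp_add]
    congr 1
    rw [hδ]
    ring
  have hbig : 13 < Real.exp (n * δ) := by
    have h1 : 13 / δ ≤ n := (Nat.le_ceil _).trans (by exact_mod_cast (by omega))
    rw [div_le_iff₀ hδ0] at h1
    have := Real.add_one_le_exp (n * δ)
    linarith
  nlinarith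

/-- `j` is injective on the arc. -/
theorem jInv_injOn_arcA : Set.InjOn jInv arcA := by
  intro τ₁ h₁ τ₂ h₂ h
  have him := le_antisymm (im_le_im_of_jInv_eq h₂ h₁ h.symm) (im_le_im_of_jInv_eq h₁ h₂ h)
  have n₁ := re_im_of_norm_one h₁.1
  have n₂ := re_im_of_norm_one h₂.1
  rw [him] at n₁
  have hre : τ₁.re = τ₂.re := by
    have h1 : τ₁.re ^ 2 = τ₂.re ^ 2 := by linarith
    have := h₁.2.2
    have := h₂.2.2
    nlinarith [sq_nonneg (τ₁.re - τ₂.re), sq_nonneg (τ₁.re + τ₂.re)]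
  exact UpperHalfPlane.ext (Complex.ext (by simpa using hre) (by simpa using him))

lemma jInv_im_of_norm_one {τ : ℍ} (hτ : ‖(τ : ℂ)‖ = 1) : ((jInv τ).re : ℂ) = jInv τ := by
  rw [← Complex.conj_eq_iff_re, ← jInv_J_smul, ← S_smul_eq_J_smul hτ, jInv_SL_smul]

/-! ### Values at the elliptic points -/

lemma E₆_I : E₆ I = 0 := by
  have h := apply_SL_smul E₆ ModularGroup.S I
  have hS : ModularGroup.S • I = I := by
    apply UpperHalfPlane.ext
    rw [coe_S_smul, coe_I]
    simp
  rw [hS] at h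
  have hd : den (ModularGroup.S : Matrix (Fin 2) (Fin 2) ℤ) I ^ (6 : ℤ) = -1 := by
    have : den (ModularGroup.S : Matrix (Fin 2) (Fin 2) ℤ) I = Complex.I := by
      simp [den, ModularGroup.S]
    rw [this, show (6 : ℤ) = ((4 + 2 : ℕ) : ℤ) by norm_num, zpow_natCast, pow_add,
      Complex.I_pow_four, Complex.I_sq]
    ring
  replace h := h.trans (congrArg (· * E₆ I) hd)
  have h2 : (2 : ℂ) * E₆ I = 0 := by linear_combination h
  simpa using h2

/-- `S` and `T` agree at `ρ`, because `-1/ρ = ρ + 1`. Their weight `4` factors are `ρ⁴ = ρ` and `1`,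
so `(ρ - 1) E₄(ρ) = 0`. -/
lemma E₄_ρ : E₄ ρ = 0 := by
  have h := apply_SL_smul E₄ ModularGroup.S ρ
  have hT := apply_SL_smul E₄ ModularGroup.T ρ
  have hS : ModularGroup.S • ρ = ModularGroup.T • ρ := by
    apply UpperHalfPlane.ext
    have hne := ρ.ne_zero
    have h1 := ModularGroup.coe_T_zpow_smul_eq ρ (n := 1)
    rw [zpow_one] at h1
    rw [h1, coe_S_smul]
    field_simp
    push_cast
    linear_combination -ρ_sq
  have hdT : den (ModularGroup.T : Matrix (Fin 2) (Fin 2) ℤ) ρ ^ (4 : ℤ) = 1 := by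
    have : den (ModularGroup.T : Matrix (Fin 2) (Fin 2) ℤ) ρ = 1 := by
      simp [den, ModularGroup.T]
    rw [this, one_zpow]
  have hd : den (ModularGroup.S : Matrix (Fin 2) (Fin 2) ℤ) ρ ^ (4 : ℤ) = ρ := by
    have : den (ModularGroup.S : Matrix (Fin 2) (Fin 2) ℤ) ρ = ρ := by
      simp [den, ModularGroup.S]
    rw [this, show (4 : ℤ) = ((4 : ℕ) : ℤ) by norm_num, zpow_natCast]
    linear_combination ((ρ : ℂ) ^ 2 - ρ) * ρ_sq
  rw [hS] at h
  have h1 := (h.trans (congrArg (· * E₄ ρ) hd)).symm.trans (hT.trans (congrArg (· * E₄ ρ) hdT))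
  have h2 : ((ρ : ℂ) - 1) * E₄ ρ = 0 := by linear_combination h1
  rcases mul_eq_zero.mp h2 with h3 | h3
  · exfalso
    have := congrArg Complex.im h3
    simp only [Complex.sub_im, coe_im, Complex.one_im, sub_zero, Complex.zero_im] at this
    exact ρ.im_pos.ne' this
  · exact h3

lemma jInv_ρ : jInv ρ = 0 := by simp [jInv, E₄_ρ]

lemma jInv_I : jInv I = 1728 := by
  have h := discriminant_ne_zero I
  have h1 := discriminant_eq_E₄_cube_sub_E₆_sq I
  rw [E₆_I] at h1
  rw [jInv, div_eq_iff h]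
  rw [h1]
  ring

/-! ### The Fourier expansion of a harmonic Maass form -/

lemma upperGamma_nonneg {s x : ℝ} (hx : 0 ≤ x) : 0 ≤ upperGamma s x := by
  refine MeasureTheory.setIntegral_nonneg measurableSet_Ioi fun t ht ↦ ?_
  have : 0 < t := hx.trans_lt ht
  positivity

/-- Shift the variable of integration by `δ`: for `t > x ≥ 4(s - 1)` the power grows by at most `(1
+ δ/t)^{s-1} ≤ e^{δ/4}`. A rate above `1/2` is what matters, since `Γ(s, 4πnv)` has to beat
`|q^{-n}| = e^{2πnv}`. -/
lemma upperGamma_add_le {s x δ : ℝ} (hs : 1 ≤ s) (hx : 4 * (s - 1) ≤ x) (hx0 : 0 < x)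
    (hδ : 0 ≤ δ) : upperGamma s (x + δ) ≤ Real.exp (-(3 / 4 * δ)) * upperGamma s x := by
  have h1 := (MeasureTheory.measurePreserving_add_right
    MeasureTheory.volume δ).setIntegral_preimage_emb
    (measurableEmbedding_addRight δ) (fun t ↦ Real.exp (-t) * t ^ (s - 1)) (Set.Ioi (x + δ))
  rw [Set.preimage_add_const_Ioi, add_sub_cancel_right] at h1
  rw [upperGamma, upperGamma, ← h1, ← MeasureTheory.integral_const_mul]
  refine MeasureTheory.integral_mono_of_nonneg ?_ ?_ ?_
  · refine (MeasureTheory.ae_restrict_iff' measurableSet_Ioi).mpr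
      (Eventually.of_forall fun t ht ↦ ?_)
    have : 0 < t := hx0.trans ht
    simp only [Pi.zero_apply]
    positivity
  · exact ((Real.GammaIntegral_convergent (by linarith)).mono_set
      (Set.Ioi_subset_Ioi hx0.le)).const_mul _
  · refine (MeasureTheory.ae_restrict_iff' measurableSet_Ioi).mpr
      (Eventually.of_forall fun t ht ↦ ?_)
    have ht' : x < t := ht
    have ht0 : 0 < t := hx0.trans ht
    have h2 : (t + δ) ^ (s - 1) ≤ Real.exp (δ / 4) * t ^ (s - 1) := by
      have e : t + δ = t * (1 + δ / t) := by field_simp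
      have h3 : 1 + δ / t ≤ Real.exp (δ / t) := by
        rw [add_comm]
        exact Real.add_one_le_exp _
      rw [e, Real.mul_rpow ht0.le (by positivity), mul_comm]
      gcongr
      calc (1 + δ / t) ^ (s - 1) ≤ Real.exp (δ / t) ^ (s - 1) :=
            Real.rpow_le_rpow (by positivity) h3 (by linarith)
        _ = Real.exp (δ / t * (s - 1)) := (Real.exp_mul _ _).symm
        _ ≤ Real.exp (δ / 4) := by
            rw [Real.exp_le_exp, div_mul_eq_mul_div, div_le_div_iff₀ ht0 (by norm_num)]
            nlinarith
    simp only
    calc Real.exp (-(t + δ)) * (t + δ) ^ (s - 1)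
        ≤ Real.exp (-(t + δ)) * (Real.exp (δ / 4) * t ^ (s - 1)) := by gcongr
      _ = Real.exp (-(3 / 4 * δ)) * (Real.exp (-t) * t ^ (s - 1)) := by
          rw [← mul_assoc, ← mul_assoc, ← Real.exp_add, ← Real.exp_add]
          congr 2
          ring

/-- Exponential decay of the non-holomorphic part of a Fourier expansion. -/
lemma exists_norm_le_of_hasSum_upperGamma {s : ℝ} (hs : 1 ≤ s) {c : ℕ → ℂ} {f : ℍ → ℂ}
    (h : ∀ τ : ℍ, HasSum (fun i : ℕ ↦ c i *
      (upperGamma s (4 * Real.pi * ((i : ℝ) + 1) * τ.im) : ℂ) * qPow (-((i : ℤ) + 1)) τ) (f τ)) :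
    ∃ C : ℝ, 0 < C ∧ ∀ τ : ℍ, s ≤ τ.im → ‖f τ‖ ≤ C * Real.exp (-(Real.pi * τ.im)) := by
  have hs0 : 0 < s := by linarith
  have hpi := Real.pi_pos
  have hpi3 := Real.pi_gt_three
  let τ₀ : ℍ := ⟨s * Complex.I, by simpa using hs0⟩
  have hτ₀ : τ₀.im = s := by
    rw [← coe_im]
    simp [τ₀]
  have hsum := (h τ₀).summable.norm
  set M := ∑' i : ℕ, ‖c i * (upperGamma s (4 * Real.pi * ((i : ℝ) + 1) * τ₀.im) : ℂ) *
    qPow (-((i : ℤ) + 1)) τ₀‖ with hM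
  have hM0 : 0 ≤ M := tsum_nonneg fun _ ↦ norm_nonneg _
  refine ⟨(M + 1) * Real.exp (Real.pi * s), by positivity, fun τ hτ ↦ ?_⟩
  have hterm (i : ℕ) : ‖c i * (upperGamma s (4 * Real.pi * ((i : ℝ) + 1) * τ.im) : ℂ) *
      qPow (-((i : ℤ) + 1)) τ‖ ≤ Real.exp (-(Real.pi * (τ.im - s))) *
      ‖c i * (upperGamma s (4 * Real.pi * ((i : ℝ) + 1) * τ₀.im) : ℂ) *
        qPow (-((i : ℤ) + 1)) τ₀‖ := by
    have hi : (0 : ℝ) ≤ i := i.cast_nonneg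
    have hd : 0 ≤ τ.im - s := by linarith
    have hx : 4 * (s - 1) ≤ 4 * Real.pi * ((i : ℝ) + 1) * s := by
      have h1 : 1 ≤ Real.pi * ((i : ℝ) + 1) := by nlinarith
      nlinarith
    -- The gain `e^{-3π(i+1)(v-s)}` against the growth `e^{2π(i+1)(v-s)}` of `q^{-(i+1)}` leaves at
    -- most `e^{-π(v-s)}`, uniformly in `i`.
    have hg := upperGamma_add_le (δ := 4 * Real.pi * ((i : ℝ) + 1) * (τ.im - s)) hs hx
      (by positivity) (by positivity)
    have e : 4 * Real.pi * ((i : ℝ) + 1) * s + 4 * Real.pi * ((i : ℝ) + 1) * (τ.im - s) =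
      4 * Real.pi * ((i : ℝ) + 1) * τ.im := by ring
    rw [e] at hg
    have hg0 : 0 ≤ upperGamma s (4 * Real.pi * ((i : ℝ) + 1) * s) :=
      upperGamma_nonneg (by positivity)
    have hg1 : 0 ≤ upperGamma s (4 * Real.pi * ((i : ℝ) + 1) * τ.im) :=
      upperGamma_nonneg (by have := τ.im_pos; positivity)
    rw [norm_mul, norm_mul, norm_mul, norm_mul, norm_qPow, norm_qPow, hτ₀, Complex.norm_real,
      Complex.norm_real, Real.norm_of_nonneg hg0, Real.norm_of_nonneg hg1]
    calc _ ≤ ‖c i‖ * (Real.exp (-(3 / 4 * (4 * Real.pi * ((i : ℝ) + 1) * (τ.im - s)))) *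
          upperGamma s (4 * Real.pi * ((i : ℝ) + 1) * s)) *
          Real.exp (-(2 * Real.pi * ((-((i : ℤ) + 1) : ℤ) : ℝ) * τ.im)) := by gcongr
      _ = ‖c i‖ * upperGamma s (4 * Real.pi * ((i : ℝ) + 1) * s) *
          (Real.exp (-(3 / 4 * (4 * Real.pi * ((i : ℝ) + 1) * (τ.im - s)))) *
          Real.exp (-(2 * Real.pi * ((-((i : ℤ) + 1) : ℤ) : ℝ) * τ.im))) := by ring
      _ ≤ ‖c i‖ * upperGamma s (4 * Real.pi * ((i : ℝ) + 1) * s) *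
          (Real.exp (-(Real.pi * (τ.im - s))) *
          Real.exp (-(2 * Real.pi * ((-((i : ℤ) + 1) : ℤ) : ℝ) * s))) := by
          gcongr ?_ * ?_
          rw [← Real.exp_add, ← Real.exp_add, Real.exp_le_exp]
          push_cast
          have : 0 ≤ Real.pi * i * (τ.im - s) := by positivity
          nlinarith
      _ = _ := by ring
  have h1 := (h τ).tsum_eq
  rw [← h1]
  calc _ ≤ ∑' i : ℕ, Real.exp (-(Real.pi * (τ.im - s))) *
      ‖c i * (upperGamma s (4 * Real.pi * ((i : ℝ) + 1) * τ₀.im) : ℂ) *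
        qPow (-((i : ℤ) + 1)) τ₀‖ := tsum_of_norm_bounded (hsum.mul_left _).hasSum hterm
    _ = Real.exp (-(Real.pi * (τ.im - s))) * M := by rw [tsum_mul_left]
    _ ≤ Real.exp (-(Real.pi * (τ.im - s))) * (M + 1) := by gcongr; linarith
    _ = _ := by
      rw [mul_comm, mul_assoc, ← Real.exp_add]
      congr 2
      ring

namespace HasFourierExpansion

variable {k : ℤ} {m : ℕ} {F : ℍ → ℂ} {cPlus cMinus : ℤ → ℝ}

lemma exists_norm_sub_le (hk : 2 ≤ k)
    (hexp : HasFourierExpansion k m F (fun l ↦ (cPlus l : ℂ)) (fun l ↦ (cMinus l : ℂ)))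
    (hlead : cPlus (-(m : ℤ)) = 1) : ∃ C v₀ : ℝ, 0 < C ∧ 0 < v₀ ∧ ∀ τ : ℍ, v₀ ≤ τ.im →
      ‖F τ - qPow (-(m : ℤ)) τ‖ ≤ C * Real.exp (2 * Real.pi * ((m : ℝ) - 1) * τ.im) +
        C * Real.exp (-(Real.pi * τ.im)) := by
  choose Fp Fm hp hm hF using hexp
  have hk' : (1 : ℝ) ≤ (k : ℝ) - 1 := by
    have : (2 : ℝ) ≤ k := by exact_mod_cast hk
    linarith
  obtain ⟨C₁, hC₁, h₁⟩ := exists_norm_sub_le_of_hasSum (m := (m : ℤ)) hp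
    (show (0 : ℝ) < (k : ℝ) - 1 by linarith)
  obtain ⟨C₂, hC₂, h₂⟩ := exists_norm_le_of_hasSum_upperGamma hk' hm
  refine ⟨C₁ + C₂, (k : ℝ) - 1, by positivity, by linarith, fun τ hτ ↦ ?_⟩
  have e₁ := h₁ τ hτ
  have e₂ := h₂ τ hτ
  simp only [Nat.cast_zero, zero_sub, hlead, Complex.ofReal_one, one_mul, Int.cast_natCast] at e₁
  rw [hF, show Fp τ + Fm τ - qPow (-(m : ℤ)) τ = (Fp τ - qPow (-(m : ℤ)) τ) + Fm τ by ring]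
  refine (norm_add_le _ _).trans (add_le_add (e₁.trans ?_) (e₂.trans ?_))
  · gcongr
    linarith
  · gcongr
    linarith

lemma hasLeadingTerm (hk : 2 ≤ k) (hm : 1 ≤ m)
    (hexp : HasFourierExpansion k m F (fun l ↦ (cPlus l : ℂ)) (fun l ↦ (cMinus l : ℂ)))
    (hlead : cPlus (-(m : ℤ)) = 1) : HasLeadingTerm m F := by
  obtain ⟨C, v₀, hC, hv₀, h⟩ := hexp.exists_norm_sub_le hk hlead
  refine ⟨C + C, v₀, by positivity, hv₀, fun τ hτ ↦ (h τ hτ).trans ?_⟩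
  rw [add_mul]
  gcongr
  have hm' : (1 : ℝ) ≤ m := by exact_mod_cast hm
  have h1 : 0 ≤ Real.pi * τ.im := by
    have := τ.im_pos
    have := Real.pi_pos
    positivity
  have h2 : 0 ≤ 2 * Real.pi * ((m : ℝ) - 1) * τ.im := by
    have := τ.im_pos
    have := Real.pi_pos
    have : 0 ≤ (m : ℝ) - 1 := by linarith
    positivity
  linarith

/-- For `m = 0` the bound `O(e^{-πv})` on the non-holomorphic part is weaker than the error
`O(e^{-2πv})` demanded by `HasLeadingTerm 0`. The limit alone suffices to rule this case out. -/
lemma tendsto_one (hk : 2 ≤ k)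
    (hexp : HasFourierExpansion k 0 F (fun l ↦ (cPlus l : ℂ)) (fun l ↦ (cMinus l : ℂ)))
    (hlead : cPlus 0 = 1) : Tendsto F atImInfty (𝓝 1) := by
  obtain ⟨C, v₀, hC, hv₀, h⟩ := hexp.exists_norm_sub_le hk (by simpa using hlead)
  rw [tendsto_iff_norm_sub_tendsto_zero]
  have h1 := ((exp_neg_tendsto_atImInfty Real.two_pi_pos).const_mul C).add
    ((exp_neg_tendsto_atImInfty Real.pi_pos).const_mul C)
  rw [mul_zero, add_zero] at h1
  refine squeeze_zero' (Eventually.of_forall fun _ ↦ norm_nonneg _) ?_ h1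
  rw [atImInfty_basis.eventually_iff]
  refine ⟨v₀, trivial, fun τ hτ ↦ ?_⟩
  have := h τ hτ
  simpa [qPow_zero] using this

lemma apply_J_smul
    (hexp : HasFourierExpansion k m F (fun l ↦ (cPlus l : ℂ)) (fun l ↦ (cMinus l : ℂ))) (τ : ℍ) :
    F (J • τ) = (starRingEnd ℂ) (F τ) := by
  obtain ⟨a, b, ha, hb, h⟩ := hexp τ
  obtain ⟨a', b', ha', hb', h'⟩ := hexp (J • τ)
  rw [J_smul_im] at hb'
  simp only [← Complex.ofReal_mul] at hb hb'
  rw [h, h', map_add, apply_J_smul_of_hasSum ha ha', apply_J_smul_of_hasSum hb hb']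

end HasFourierExpansion

lemma IsHarmonicMaassForm.continuous {κ : ℤ} {F : ℍ → ℂ} (hF : IsHarmonicMaassForm κ F) :
    Continuous F := by
  have h := hF.smooth.continuousOn
  have h2 : F = fun τ : ℍ ↦ lift F (τ : ℂ) := by
    ext τ
    rw [lift, ofComplex_apply]
  rw [h2]
  exact h.comp_continuous continuous_coe fun τ ↦ τ.im_pos

/-! ### Hecke eigenvalues of cusp forms -/

/-- A geometric sum in the `d`-th root of unity `ζ ^ i`. Averaging over `b` keeps the exponents
divisible by `d`. -/
lemma sum_qPow_heckePt {d : ℕ} (hd : 0 < d) (i : ℕ) (σ : ℍ) :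
    ∑ b ∈ Finset.range d, qPow i (heckePt 1 b d σ) =
      if d ∣ i then d * qPow ((i / d : ℕ) : ℤ) σ else 0 := by
  have hd0 : (d : ℂ) ≠ 0 := by exact_mod_cast hd.ne'
  set ζ : ℂ := Complex.exp (2 * Real.pi * Complex.I / d) with hζ
  have hprim : IsPrimitiveRoot ζ d := Complex.isPrimitiveRoot_exp d hd.ne'
  have h (b : ℕ) : qPow i (heckePt 1 b d σ) =
      Complex.exp (2 * Real.pi * Complex.I * i * σ / d) * (ζ ^ i) ^ b := by
    rw [qPow, coe_heckePt one_pos hd, hζ, ← Complex.exp_nat_mul, ← Complex.exp_nat_mul,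
      ← Complex.exp_add]
    congr 1
    push_cast
    field_simp
  rw [Finset.sum_congr rfl fun b _ ↦ h b, ← Finset.mul_sum]
  split_ifs with hdi
  · rw [(hprim.pow_eq_one_iff_dvd i).mpr hdi]
    obtain ⟨l, rfl⟩ := hdi
    rw [Nat.mul_div_cancel_left _ hd]
    simp only [one_pow, Finset.sum_const, Finset.card_range, nsmul_eq_mul, mul_one]
    rw [mul_comm, qPow]
    congr 2
    push_cast
    field_simp
  · have h1 : ζ ^ i ≠ 1 := fun h ↦ hdi ((hprim.pow_eq_one_iff_dvd i).mp h)
    have h2 := mul_geom_sum (ζ ^ i) d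
    rw [← pow_mul, mul_comm i d, pow_mul, hprim.pow_eq_one, one_pow, sub_self] at h2
    rw [(mul_eq_zero.mp h2).resolve_left (sub_ne_zero.mpr h1), mul_zero]

lemma hasSum_sum_heckePt {k : ℤ} (G : CuspForm 𝒮ℒ k) {d : ℕ} (hd : 0 < d) (σ : ℍ) :
    HasSum (fun l : ℕ ↦ d * cuspCoeff G (d * l) * qPow l σ)
      (∑ b ∈ Finset.range d, G (heckePt 1 b d σ)) := by
  have h := hasSum_sum (s := Finset.range d) fun b _ ↦
    hasSum_qPow_of_modularForm G (heckePt 1 b d σ)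
  simp only [← Finset.mul_sum, sum_qPow_heckePt hd] at h
  rw [← (mul_right_injective₀ hd.ne').hasSum_iff] at h
  · refine h.congr_fun fun l ↦ ?_
    simp only [Function.comp_apply, dvd_mul_right, if_true, Nat.mul_div_cancel_left _ hd, cuspCoeff]
    ring
  · intro i hi
    rw [if_neg, mul_zero]
    rintro ⟨l, rfl⟩
    exact hi ⟨l, rfl⟩

lemma cuspCoeff_zero {k : ℤ} (G : CuspForm 𝒮ℒ k) : cuspCoeff G 0 = 0 := by
  rw [cuspCoeff]
  exact CuspFormClass.qExpansion_coeff_zero G one_pos one_mem_strictPeriods_SL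

lemma tendsto_sum_heckePt {k : ℤ} (G : CuspForm 𝒮ℒ k) {d : ℕ} (hd : 0 < d) :
    Tendsto (fun σ ↦ (∑ b ∈ Finset.range d, G (heckePt 1 b d σ)) * qPow (-1) σ) atImInfty
      (𝓝 (d * cuspCoeff G d)) := by
  have h (σ : ℍ) : HasSum (fun l : ℕ ↦ (d * cuspCoeff G (d * (l + 1))) *
      qPow ((l : ℤ) - (-1 : ℤ)) σ) (∑ b ∈ Finset.range d, G (heckePt 1 b d σ)) := by
    have := (hasSum_nat_add_iff' 1).mpr (hasSum_sum_heckePt G hd σ)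
    simpa [cuspCoeff_zero] using this
  obtain ⟨C, hC, hb⟩ := exists_norm_sub_le_of_hasSum h one_pos
  rw [tendsto_iff_norm_sub_tendsto_zero]
  have h1 := (exp_neg_tendsto_atImInfty Real.two_pi_pos).const_mul C
  rw [mul_zero] at h1
  refine squeeze_zero' (Eventually.of_forall fun _ ↦ norm_nonneg _) ?_ h1
  rw [atImInfty_basis.eventually_iff]
  refine ⟨1, trivial, fun σ hσ ↦ ?_⟩
  have h2 := hb σ hσ
  simp only [zero_add, mul_one, neg_neg] at h2
  set w := ∑ b ∈ Finset.range d, G (heckePt 1 b d σ)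
  have h3 : w * qPow (-1) σ - d * cuspCoeff G d =
      (w - d * cuspCoeff G d * qPow 1 σ) * qPow (-1) σ := by
    rw [sub_mul, mul_assoc _ (qPow 1 σ), ← qPow_add, add_neg_cancel, qPow_zero, mul_one]
  rw [h3, norm_mul, norm_qPow]
  calc _ ≤ C * Real.exp (2 * Real.pi * (((-1 : ℤ) : ℝ) - 1) * σ.im) *
        Real.exp (-(2 * Real.pi * ((-1 : ℤ) : ℝ) * σ.im)) := by gcongr
    _ = _ := by
        rw [mul_assoc C, ← Real.exp_add]
        congr 2
        push_cast
        ring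

lemma heckePt_heckePt {a d : ℕ} (ha : 0 < a) (hd : 0 < d) (b : ℕ) (τ : ℍ) :
    heckePt 1 b d (heckePt a 0 1 τ) = heckePt a b d τ := by
  apply UpperHalfPlane.ext
  rw [coe_heckePt one_pos hd, coe_heckePt ha one_pos, coe_heckePt ha hd]
  simp

lemma qPow_heckePt_scale {a : ℕ} (ha : 0 < a) (l : ℤ) (τ : ℍ) :
    qPow l (heckePt a 0 1 τ) = qPow (a * l) τ := by
  rw [qPow, qPow, coe_heckePt ha one_pos]
  congr 1
  push_cast
  ring

lemma tendsto_qPow_zero {l : ℤ} (hl : 0 < l) : Tendsto (qPow l) atImInfty (𝓝 0) := by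
  rw [tendsto_zero_iff_norm_tendsto_zero]
  have hl' : (0 : ℝ) < l := by exact_mod_cast hl
  have hpos : 0 < 2 * Real.pi * l := by
    have := Real.pi_pos
    positivity
  exact (exp_neg_tendsto_atImInfty hpos).congr fun τ ↦ (norm_qPow l τ).symm

/-- This reads off the coefficient of `q`. Only `d = n` contributes, since the other terms start at
`q^{n/d}` with `n/d ≥ 2`. -/
lemma tendsto_heckeOp_mul_qPow {k : ℤ} (G : CuspForm 𝒮ℒ k) {n : ℕ} (hn : 0 < n) :
    Tendsto (fun τ ↦ heckeOp k n G τ * qPow (-1) τ) atImInfty (𝓝 (cuspCoeff G n)) := by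
  have hn0 : (n : ℂ) ≠ 0 := by exact_mod_cast hn.ne'
  have hterm (d : ℕ) (hd : d ∈ n.divisors) :
      Tendsto (fun τ ↦ (∑ b ∈ Finset.range d, G (heckePt (n / d) b d τ)) * qPow (-1) τ) atImInfty
        (𝓝 (if d = n then n * cuspCoeff G n else 0)) := by
    have hdn := Nat.dvd_of_mem_divisors hd
    have hd0 : 0 < d := Nat.pos_of_dvd_of_pos hdn hn
    have ha0 : 0 < n / d := Nat.div_pos (Nat.le_of_dvd hn hdn) hd0
    have h1 := (tendsto_sum_heckePt G hd0).comp (tendsto_heckePt ha0 one_pos 0)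
    have h2 : Tendsto (qPow (((n / d : ℕ) : ℤ) - 1)) atImInfty (𝓝 (if d = n then 1 else 0)) := by
      split_ifs with h
      · rw [h, Nat.div_self hn, Nat.cast_one, sub_self]
        exact tendsto_const_nhds.congr fun τ ↦ (qPow_zero τ).symm
      · refine tendsto_qPow_zero ?_
        obtain ⟨e, rfl⟩ := hdn
        rw [Nat.mul_div_cancel_left _ hd0] at ha0 ⊢
        have : e ≠ 1 := by
          rintro rfl
          simp at h
        omega
    have h3 := h1.mul h2
    have e : (d : ℂ) * cuspCoeff G d * (if d = n then 1 else 0) =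
        if d = n then n * cuspCoeff G n else 0 := by
      split_ifs with h
      · rw [h, mul_one]
      · rw [mul_zero]
    rw [e] at h3
    refine h3.congr fun τ ↦ ?_
    simp only [Function.comp_apply, heckePt_heckePt ha0 hd0, qPow_heckePt_scale ha0]
    rw [mul_assoc, ← qPow_add]
    congr 2
    ring
  have hsum := ((tendsto_finsetSum n.divisors fun d hd ↦
    (hterm d hd).const_mul ((d : ℂ) ^ (-k))).const_mul ((n : ℂ) ^ (k - 1)))
  have hval : (n : ℂ) ^ (k - 1) * ∑ d ∈ n.divisors, (d : ℂ) ^ (-k) *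
      (if d = n then n * cuspCoeff G n else 0) = cuspCoeff G n := by
    rw [Finset.sum_eq_single n (fun d _ h ↦ by rw [if_neg h, mul_zero])
      (fun h ↦ absurd (Nat.mem_divisors_self n hn.ne') h), if_pos rfl, ← mul_assoc, ← mul_assoc,
      ← zpow_add₀ hn0, ← zpow_add_one₀ hn0, show k - 1 + -k + 1 = 0 by ring, zpow_zero, one_mul]
  rw [hval] at hsum
  refine hsum.congr fun τ ↦ ?_
  rw [heckeOp, mul_assoc, Finset.sum_mul]
  simp only [← mul_assoc]
  rfl

/-- The Hecke eigenvalues of a normalized eigenform are its Fourier coefficients. -/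
theorem IsNormalizedEigenform.heckeOp_eq {k : ℤ} {G : CuspForm 𝒮ℒ k}
    (hG : IsNormalizedEigenform G) {n : ℕ} (hn : 1 ≤ n) (τ : ℍ) :
    heckeOp k n G τ = cuspCoeff G n * G τ := by
  obtain ⟨c, hc⟩ := hG.eigen n hn
  have h1 := tendsto_heckeOp_mul_qPow G hn
  have h2 := (tendsto_sum_heckePt G one_pos).const_mul c
  have h3 : (fun τ ↦ heckeOp k n G τ * qPow (-1) τ) =
      fun σ ↦ c * ((∑ b ∈ Finset.range 1, G (heckePt 1 b 1 σ)) * qPow (-1) σ) := by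
    ext σ
    have : heckePt 1 0 1 σ = σ := by
      apply UpperHalfPlane.ext
      rw [coe_heckePt one_pos one_pos]
      simp
    rw [hc, Finset.sum_range_one, this]
    ring
  rw [h3] at h1
  have h4 := tendsto_nhds_unique h1 h2
  rw [hG.coeff_one, Nat.cast_one, mul_one, mul_one] at h4
  rw [hc, h4]

lemma IsNormalizedEigenform.ne_zero {k : ℤ} {G : CuspForm 𝒮ℒ k}
    (hG : IsNormalizedEigenform G) : ∃ τ, G τ ≠ 0 := by
  by_contra! h
  have h1 := tendsto_sum_heckePt G one_pos
  simp only [h, Finset.sum_const_zero, zero_mul, hG.coeff_one, Nat.cast_one, mul_one] at h1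
  exact zero_ne_one (tendsto_nhds_unique tendsto_const_nhds h1)

lemma IsNormalizedEigenform.twelve_le {k : ℤ} {G : CuspForm 𝒮ℒ k}
    (hG : IsNormalizedEigenform G) : 12 ≤ k := by
  by_contra! h
  obtain ⟨τ, hτ⟩ := hG.ne_zero
  have := rank_zero_iff_forall_zero.mp (CuspForm.rank_eq_zero_of_weight_lt_twelve h) G
  rw [this] at hτ
  exact hτ rfl

/-- A weak form of Hecke's bound for the Fourier coefficients of a cusp form. -/
lemma exists_norm_cuspCoeff_le {r : ℕ} (hr : 2 ≤ r) (G : CuspForm 𝒮ℒ ((r : ℤ) + 2)) :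
    ∃ C : ℝ, 0 < C ∧ ∀ᶠ n : ℕ in atTop, ‖cuspCoeff G n‖ ≤ C * (n : ℝ) ^ r := by
  have h := CuspFormClass.qExpansion_isBigO G
  rw [Subgroup.strictWidthInfty_SL2Z] at h
  obtain ⟨C, hC, hb⟩ := h.exists_pos
  refine ⟨C, hC, ?_⟩
  filter_upwards [hb.bound, eventually_ge_atTop 1] with n hn h1
  refine hn.trans ?_
  have h1' : (1 : ℝ) ≤ n := by exact_mod_cast h1
  rw [Real.norm_of_nonneg (by positivity), ← Real.rpow_natCast (n : ℝ) r]
  gcongr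
  -- The exponent `(r + 2)/2` in Hecke's bound is at most `r` because `r ≥ 2`.
  · push_cast
    have : (2 : ℝ) ≤ r := by exact_mod_cast hr
    linarith

/-! ### The `∂/∂τ̄`-derivative of Hecke sums -/

/-- Twice the derivative `∂F/∂τ̄`. -/
def dbar (F : ℍ → ℂ) (τ : ℍ) : ℂ := dU (lift F) τ + Complex.I * dV (lift F) τ

lemma IsHarmonicMaassForm.differentiableAt {κ : ℤ} {F : ℍ → ℂ} (hF : IsHarmonicMaassForm κ F)
    (τ : ℍ) : DifferentiableAt ℝ (lift F) τ :=
  (hF.smooth.differentiableOn (by simp)).differentiableAt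
    (isOpen_upperHalfPlaneSet.mem_nhds τ.im_pos)

lemma mdifferentiable_of_dbar {F : ℍ → ℂ} (hd : ∀ τ : ℍ, DifferentiableAt ℝ (lift F) τ)
    (h : ∀ τ, dbar F τ = 0) : MDiff F := by
  rw [mdifferentiable_iff]
  intro z hz
  refine (differentiableAt_complex_iff_differentiableAt_real.mpr
    ⟨hd ⟨z, hz⟩, ?_⟩).differentiableWithinAt
  have h1 := h ⟨z, hz⟩
  simp only [dbar, dU, dV] at h1
  change fderiv ℝ (lift F) z Complex.I = Complex.I • fderiv ℝ (lift F) z 1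
  rw [smul_eq_mul]
  linear_combination -Complex.I * h1 + fderiv ℝ (lift F) z Complex.I * Complex.I_sq

lemma dbar_eq_zero {F : ℍ → ℂ} (hF : MDiff F) (τ : ℍ) : dbar F τ = 0 := by
  rw [mdifferentiable_iff] at hF
  have h1 : DifferentiableAt ℂ (lift F) τ :=
    hF.differentiableAt (isOpen_upperHalfPlaneSet.mem_nhds τ.im_pos)
  have h2 := (differentiableAt_complex_iff_differentiableAt_real.mp h1).2
  rw [dbar, dU, dV, h2, smul_eq_mul]
  linear_combination fderiv ℝ (lift F) τ 1 * Complex.I_sq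

lemma hasFDerivAt_lift_heckePt {F : ℍ → ℂ} (hF : ∀ τ : ℍ, DifferentiableAt ℝ (lift F) τ)
    {a d : ℕ} (ha : 0 < a) (hd : 0 < d) (b : ℕ) (τ : ℍ) :
    HasFDerivAt (lift fun τ ↦ F (heckePt a b d τ))
      (((a : ℝ) / d) • fderiv ℝ (lift F) (heckePt a b d τ)) (τ : ℂ) := by
  have hA : HasFDerivAt (fun z : ℂ ↦ ((a : ℂ) * z + b) / d)
      (((a : ℝ) / d) • ContinuousLinearMap.id ℝ ℂ) (τ : ℂ) := by
    have h1 := (((hasFDerivAt_id (𝕜 := ℝ) (τ : ℂ)).const_smul ((a : ℝ) / d))).add_const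
      ((b : ℂ) / d)
    refine h1.congr_of_eventuallyEq (Eventually.of_forall fun z ↦ ?_)
    simp only [Pi.smul_apply, id_eq, Complex.real_smul]
    push_cast
    ring
  have h2 := (hF (heckePt a b d τ)).hasFDerivAt
  rw [coe_heckePt ha hd] at h2
  have h3 := h2.comp (τ : ℂ) hA
  rw [ContinuousLinearMap.comp_smul, ContinuousLinearMap.comp_id, ← coe_heckePt ha hd] at h3
  refine h3.congr_of_eventuallyEq ?_
  filter_upwards [isOpen_upperHalfPlaneSet.mem_nhds τ.im_pos] with z hz
  simp only [lift, Function.comp_apply, heckePt]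
  rw [ofComplex_apply_of_im_pos (z := z) hz]

lemma hasFDerivAt_lift_heckeSum {F : ℍ → ℂ} (hF : ∀ τ : ℍ, DifferentiableAt ℝ (lift F) τ)
    (r : ℕ) {n : ℕ} (hn : 0 < n) (τ : ℍ) :
    HasFDerivAt (lift (heckeSum r n F)) (∑ d ∈ n.divisors, ((d : ℂ) ^ r) • ∑ b ∈ Finset.range d,
      (((n / d : ℕ) : ℝ) / d) • fderiv ℝ (lift F) (heckePt (n / d) b d τ)) (τ : ℂ) := by
  have : lift (heckeSum r n F) = fun z ↦ ∑ d ∈ n.divisors, (d : ℂ) ^ r •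
      ∑ b ∈ Finset.range d, lift (fun τ ↦ F (heckePt (n / d) b d τ)) z := rfl
  rw [this]
  refine HasFDerivAt.fun_sum fun d hd ↦ (HasFDerivAt.fun_sum fun b _ ↦ ?_).fun_const_smul _
  have hdn := Nat.dvd_of_mem_divisors hd
  have hd0 : 0 < d := Nat.pos_of_dvd_of_pos hdn hn
  exact hasFDerivAt_lift_heckePt hF (Nat.div_pos (Nat.le_of_dvd hn hdn) hd0) hd0 b τ

lemma dbar_heckeSum {F : ℍ → ℂ} (hF : ∀ τ : ℍ, DifferentiableAt ℝ (lift F) τ)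
    (r : ℕ) {n : ℕ} (hn : 0 < n) (τ : ℍ) :
    dbar (heckeSum r n F) τ = ∑ d ∈ n.divisors, (d : ℂ) ^ r * ∑ b ∈ Finset.range d,
      ((n / d : ℕ) : ℂ) / d * dbar F (heckePt (n / d) b d τ) := by
  rw [dbar, dU, dV, (hasFDerivAt_lift_heckeSum hF r hn τ).fderiv]
  simp only [_root_.sum_apply, _root_.smul_apply, smul_eq_mul,
    Complex.real_smul, Finset.mul_sum, ← Finset.sum_add_distrib, dbar, dU, dV]
  refine Finset.sum_congr rfl fun d _ ↦ Finset.sum_congr rfl fun b _ ↦ ?_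
  push_cast
  ring

/-- At `σ = (aτ + b)/d` the chain rule gives `a/d` and `(Im σ)^r` gives `(a Im τ/d)^r`. With the
weight `d^r` and `a = n/d` the factor is `n^{r+1} d^{-(r+2)} (Im τ)^r`, the normalisation of the
Hecke operator of weight `r + 2`. -/
lemma dbar_heckeSum_of_dbar {F : ℍ → ℂ} (hF : ∀ τ : ℍ, DifferentiableAt ℝ (lift F) τ)
    {r : ℕ} {g : ℍ → ℂ} {w : ℂ} (hw : ∀ τ, dbar F τ = w * τ.im ^ r * (starRingEnd ℂ) (g τ))
    {n : ℕ} (hn : 0 < n) (τ : ℍ) :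
    dbar (heckeSum r n F) τ =
      w * τ.im ^ r * (starRingEnd ℂ) (heckeOp ((r : ℤ) + 2) n g τ) := by
  have hn0 : (n : ℂ) ≠ 0 := by exact_mod_cast hn.ne'
  rw [dbar_heckeSum hF r hn, heckeOp, map_mul, map_sum, Finset.mul_sum, Finset.mul_sum]
  refine Finset.sum_congr rfl fun d hd ↦ ?_
  have hdn := Nat.dvd_of_mem_divisors hd
  have hd0 : 0 < d := Nat.pos_of_dvd_of_pos hdn hn
  have ha0 : 0 < n / d := Nat.div_pos (Nat.le_of_dvd hn hdn) hd0
  have hd0' : (d : ℂ) ≠ 0 := by exact_mod_cast hd0.ne'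
  rw [map_mul, map_sum, Finset.mul_sum, Finset.mul_sum, Finset.mul_sum, Finset.mul_sum]
  refine Finset.sum_congr rfl fun b _ ↦ ?_
  rw [hw, heckePt_im ha0 hd0]
  simp only [map_zpow₀, Complex.conj_natCast]
  have e1 : ((n / d : ℕ) : ℂ) = n / d := Nat.cast_div hdn hd0'
  have e2 : (n : ℂ) ^ ((r : ℤ) + 2 - 1) = (n : ℂ) ^ (r + 1) := by
    rw [← zpow_natCast]
    congr 1
    push_cast
    ring
  have e3 : (d : ℂ) ^ (-((r : ℤ) + 2)) = ((d : ℂ) ^ (r + 2))⁻¹ := by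
    rw [zpow_neg, ← zpow_natCast]
    congr 2
  rw [e2, e3]
  change _ = w * (τ.im : ℂ) ^ r * ((n : ℂ) ^ (r + 1) * (((d : ℂ) ^ (r + 2))⁻¹ *
    (starRingEnd ℂ) (g (heckePt (n / d) b d τ))))
  push_cast
  rw [e1]
  have e4 : (n : ℂ) / d * τ.im / d = n * τ.im / d ^ 2 := by field_simp
  rw [e4, div_pow, mul_pow]
  field_simp
  ring

/-- Under the hypotheses of `dbar_heckeSum_of_dbar`, a Hecke eigenfunction `g` yields a holomorphic
combination of `F` and its Hecke sum. -/
lemma mdifferentiable_heckeSum_sub {F : ℍ → ℂ} (hF : ∀ τ : ℍ, DifferentiableAt ℝ (lift F) τ)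
    {r : ℕ} {g : ℍ → ℂ} {w : ℂ} (hw : ∀ τ, dbar F τ = w * τ.im ^ r * (starRingEnd ℂ) (g τ))
    {n : ℕ} (hn : 0 < n) {c : ℂ} (hg : ∀ τ, heckeOp ((r : ℤ) + 2) n g τ = c * g τ) :
    MDiff fun τ ↦ heckeSum r n F τ - (starRingEnd ℂ) c * F τ := by
  have h1 (τ : ℍ) := hasFDerivAt_lift_heckeSum hF r hn τ
  have h2 (τ : ℍ) : HasFDerivAt (lift fun τ ↦ heckeSum r n F τ - (starRingEnd ℂ) c * F τ)
      (fderiv ℝ (lift (heckeSum r n F)) τ - (starRingEnd ℂ) c • fderiv ℝ (lift F) τ) (τ : ℂ) :=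
    (h1 τ).differentiableAt.hasFDerivAt.sub ((hF τ).hasFDerivAt.fun_const_smul ((starRingEnd ℂ) c))
  refine mdifferentiable_of_dbar (fun τ ↦ (h2 τ).differentiableAt) fun τ ↦ ?_
  have h3 := dbar_heckeSum_of_dbar hF hw hn τ
  have h4 := hw τ
  rw [hg, map_mul] at h3
  rw [dbar, dU, dV, (h2 τ).fderiv]
  simp only [dbar, dU, dV, _root_.sub_apply, _root_.smul_apply,
    smul_eq_mul] at h3 h4 ⊢
  linear_combination h3 - (starRingEnd ℂ) c * h4

/-! ### Reflection in the imaginary axis -/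

/-- Reflection turns `(aτ + b)/d` into `(a(-τ̄) - b)/d`. As `F` has period `1`, the sum over `b`
modulo `d` is unchanged by `b ↦ -b`. -/
lemma heckeSum_J_smul {r : ℕ} {F : ℍ → ℂ} (hF : IsModular r F)
    (hJ : ∀ τ, F (J • τ) = (starRingEnd ℂ) (F τ)) {n : ℕ} (hn : 0 < n) (τ : ℍ) :
    heckeSum r n F (J • τ) = (starRingEnd ℂ) (heckeSum r n F τ) := by
  rw [heckeSum, heckeSum, map_sum]
  refine Finset.sum_congr rfl fun d hd ↦ ?_
  have hdn := Nat.dvd_of_mem_divisors hd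
  have hd0 : 0 < d := Nat.pos_of_dvd_of_pos hdn hn
  have ha0 : 0 < n / d := Nat.div_pos (Nat.le_of_dvd hn hdn) hd0
  have hd0' : (d : ℂ) ≠ 0 := by exact_mod_cast hd0.ne'
  rw [map_mul, map_sum, map_pow, Complex.conj_natCast]
  congr 1
  have hT (σ : ℍ) : F (ModularGroup.T • σ) = F σ := by
    have := hF ModularGroup.T σ
    simpa [den, ModularGroup.T] using this
  have hper (σ : ℍ) : F (heckePt (n / d) d d σ) = F (heckePt (n / d) 0 d σ) := by
    rw [← hT (heckePt (n / d) 0 d σ)]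
    congr 1
    apply UpperHalfPlane.ext
    have h1 := ModularGroup.coe_T_zpow_smul_eq (heckePt (n / d) 0 d σ) (n := 1)
    rw [zpow_one] at h1
    rw [h1, coe_heckePt ha0 hd0, coe_heckePt ha0 hd0]
    field_simp
    push_cast
    ring
  have hrefl (b : ℕ) (hb : b ≤ d) : F (heckePt (n / d) (d - b) d (J • τ)) =
      (starRingEnd ℂ) (F (heckePt (n / d) b d τ)) := by
    rw [← hJ, ← hT (J • heckePt (n / d) b d τ)]
    congr 1
    apply UpperHalfPlane.ext
    have h1 := ModularGroup.coe_T_zpow_smul_eq (J • heckePt (n / d) b d τ) (n := 1)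
    rw [zpow_one] at h1
    rw [h1, coe_heckePt ha0 hd0, coe_J_smul, coe_J_smul, coe_heckePt ha0 hd0, map_div₀, map_add,
      map_mul, Complex.conj_natCast, Complex.conj_natCast, Complex.conj_natCast, Nat.cast_sub hb]
    field_simp
    push_cast
    ring
  obtain ⟨e, rfl⟩ : ∃ e, d = e + 1 := ⟨d - 1, by omega⟩
  -- The range `0, …, d - 1` is first shifted to `1, …, d`, so that `b ↦ d - b` maps it to `0, …, d
  -- - 1` without wrap-around.
  have h1 : ∑ b ∈ Finset.range (e + 1), F (heckePt (n / (e + 1)) b (e + 1) (J • τ)) =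
      ∑ b ∈ Finset.range (e + 1), F (heckePt (n / (e + 1)) (b + 1) (e + 1) (J • τ)) := by
    rw [Finset.sum_range_succ', Finset.sum_range_succ (fun b ↦ F (heckePt _ (b + 1) _ _)), hper]
  rw [h1, ← Finset.sum_range_reflect]
  refine Finset.sum_congr rfl fun b hb ↦ ?_
  rw [Finset.mem_range] at hb
  rw [← hrefl b hb.le]
  congr 2
  omega

lemma MDiff_conj_J {f : ℍ → ℂ} (hf : MDiff f) :
    MDiff fun τ ↦ (starRingEnd ℂ) (f (J • τ)) := by
  rw [mdifferentiable_iff] at hf ⊢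
  intro z hz
  have hz' : 0 < z.im := hz
  have hz1 : 0 < (-(starRingEnd ℂ) z).im := by simpa using hz'
  have h1 : DifferentiableAt ℂ (f ∘ ofComplex) (-(starRingEnd ℂ) z) :=
    hf.differentiableAt (isOpen_upperHalfPlaneSet.mem_nhds hz1)
  have h2 : DifferentiableAt ℂ (fun w ↦ (f ∘ ofComplex) (-w)) ((starRingEnd ℂ) z) :=
    DifferentiableAt.comp _ (g := f ∘ ofComplex) h1 differentiableAt_id.neg
  have h3 := h2.conj_conj
  rw [Complex.conj_conj] at h3
  refine (h3.congr_of_eventuallyEq ?_).differentiableWithinAt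
  filter_upwards [isOpen_upperHalfPlaneSet.mem_nhds hz'] with w hw
  have hw' : 0 < w.im := hw
  simp only [Function.comp_apply]
  congr 2
  apply UpperHalfPlane.ext
  have hw1 : 0 < (-(starRingEnd ℂ) w).im := by simpa using hw'
  rw [coe_J_smul, ofComplex_apply_of_im_pos hw', ofComplex_apply_of_im_pos hw1]

/-! ### Weak Hecke eigenforms -/

/-- The properties of a weak Hecke eigenform `F` of weight `-r` with real Fourier coefficients,
leading term `q^{-m}`, and real Hecke eigenvalues `α n`. -/
structure IsWeakEigenform (r m : ℕ) (F : ℍ → ℂ) (α : ℕ → ℝ) : Prop where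
  modular : IsModular r F
  continuous : Continuous F
  apply_J : ∀ τ, F (J • τ) = (starRingEnd ℂ) (F τ)
  one_le : 1 ≤ m
  lead : HasLeadingTerm m F
  mdiff : ∀ n : ℕ, 1 ≤ n → MDiff fun τ ↦ heckeSum r n F τ - α n * F τ
  bound : ∃ C : ℝ, 0 < C ∧ ∀ᶠ n : ℕ in atTop, |α n| ≤ C * (n : ℝ) ^ r

lemma dbar_of_xi {r : ℕ} {F g : ℍ → ℂ} {c : ℂ}
    (h : ∀ τ : ℍ, xi (2 - ((r : ℤ) + 2)) F τ = c * g τ) (τ : ℍ) :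
    dbar F τ = Complex.I * (starRingEnd ℂ) c * τ.im ^ r * (starRingEnd ℂ) (g τ) := by
  have h1 := congrArg (starRingEnd ℂ) (h τ)
  have hv : (τ.im : ℂ) ≠ 0 := by exact_mod_cast τ.im_ne_zero
  rw [xi, show 2 - ((r : ℤ) + 2) = -(r : ℤ) by ring, zpow_neg, zpow_natCast] at h1
  simp only [map_mul, map_inv₀, map_pow, Complex.conj_ofReal, Complex.conj_conj, Complex.conj_I,
    map_ofNat] at h1
  have h2 : dbar F τ = dU (lift F) τ + Complex.I * dV (lift F) τ := rfl
  rw [← h2] at h1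
  field_simp at h1
  linear_combination Complex.I * h1 + dbar F τ * Complex.I_sq

/-- Reflecting and conjugating shows that the combination with `c̄` in place of `c` is holomorphic
too. The difference of the two is `(c̄ - c) F`, so `c̄ ≠ c` would make `F` holomorphic. -/
lemma conj_eq_self_of_mdifferentiable {r : ℕ} {F : ℍ → ℂ} (hmod : IsModular r F)
    (hJ : ∀ τ, F (J • τ) = (starRingEnd ℂ) (F τ)) (hF : ¬ MDiff F) {n : ℕ} (hn : 0 < n) {c : ℂ}
    (h : MDiff fun τ ↦ heckeSum r n F τ - c * F τ) : (starRingEnd ℂ) c = c := by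
  by_contra hc
  have hc' : (starRingEnd ℂ) c - c ≠ 0 := sub_ne_zero.mpr hc
  apply hF
  have h1 := (h.sub (MDiff_conj_J h)).const_smul ((starRingEnd ℂ) c - c)⁻¹
  convert h1 using 1
  ext τ
  simp only [Pi.smul_apply, Pi.sub_apply, smul_eq_mul, map_sub, map_mul,
    heckeSum_J_smul hmod hJ hn, hJ, Complex.conj_conj]
  field_simp
  ring

lemma tendsto_heckeSum_of_tendsto {F : ℍ → ℂ} (h : Tendsto F atImInfty (𝓝 1)) (r : ℕ) {n : ℕ}
    (hn : 0 < n) : Tendsto (heckeSum r n F) atImInfty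
      (𝓝 ((∑ d ∈ n.divisors, d ^ (r + 1) : ℕ) : ℂ)) := by
  have h1 : Tendsto (heckeSum r n F) atImInfty
      (𝓝 (∑ d ∈ n.divisors, (d : ℂ) ^ r * ∑ b ∈ Finset.range d, 1)) := by
    refine tendsto_finsetSum _ fun d hd ↦ (tendsto_finsetSum _ fun b hb ↦ ?_).const_mul _
    have hdn := Nat.dvd_of_mem_divisors hd
    have hd0 : 0 < d := Nat.pos_of_dvd_of_pos hdn hn
    exact h.comp (tendsto_heckePt (Nat.div_pos (Nat.le_of_dvd hn hdn) hd0) hd0 b)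
  convert h1 using 2
  push_cast
  refine Finset.sum_congr rfl fun d _ ↦ ?_
  simp [pow_succ]

/-- No weak Hecke eigenform is bounded at the cusp. -/
lemma not_tendsto_one {r : ℕ} (hr : 0 < r) {F : ℍ → ℂ} {α : ℕ → ℝ} (hmod : IsModular r F)
    (hmdiff : ∀ n : ℕ, 1 ≤ n → MDiff fun τ ↦ heckeSum r n F τ - α n * F τ)
    (hbound : ∃ C : ℝ, 0 < C ∧ ∀ᶠ n : ℕ in atTop, |α n| ≤ C * (n : ℝ) ^ r)
    (h : Tendsto F atImInfty (𝓝 1)) : False := by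
  -- The combination is holomorphic, bounded at the cusp and of negative weight, hence zero.
  -- Comparing limits at the cusp gives `α n = σ_{r+1}(n) ≥ n^{r+1}`, against the assumed bound `C
  -- n^r`.
  have hα (n : ℕ) (hn : 1 ≤ n) : α n = (∑ d ∈ n.divisors, d ^ (r + 1) : ℕ) := by
    have h1 := (tendsto_heckeSum_of_tendsto h r hn).sub (h.const_mul (α n : ℂ))
    have h2 : IsModular r fun τ ↦ heckeSum r n F τ - α n * F τ := fun γ τ ↦ by
      have e₁ := hmod.heckeSum hn γ τ
      have e₂ := hmod γ τ
      linear_combination e₁ - α n * e₂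
    have h3 := eq_zero_of_bounded hr h2 (hmdiff n hn) (h1.isBigO_one ℝ)
    have h4 : (fun τ ↦ heckeSum r n F τ - α n * F τ) = fun _ ↦ 0 := h3
    rw [h4, mul_one] at h1
    have h5 := tendsto_nhds_unique h1 tendsto_const_nhds
    have h6 := sub_eq_zero.mp h5
    exact_mod_cast h6.symm
  obtain ⟨C, hC, hb⟩ := hbound
  obtain ⟨N, hN⟩ := eventually_atTop.mp hb
  have h1 := hN (N + ⌈C⌉₊ + 1) (by omega)
  set n := N + ⌈C⌉₊ + 1 with hn
  have hn1 : 1 ≤ n := by omega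
  rw [hα n hn1, abs_of_nonneg (by positivity)] at h1
  have h2 : n ^ (r + 1) ≤ ∑ d ∈ n.divisors, d ^ (r + 1) :=
    Finset.single_le_sum (f := fun d ↦ d ^ (r + 1)) (fun _ _ ↦ Nat.zero_le _)
      (Nat.mem_divisors_self n (by omega))
  have h3 : (n : ℝ) ^ (r + 1) ≤ C * (n : ℝ) ^ r := le_trans (by exact_mod_cast h2) h1
  have h4 : (0 : ℝ) < (n : ℝ) ^ r := by positivity
  rw [pow_succ, mul_comm] at h3
  have h5 := le_of_mul_le_mul_right h3 h4
  have h6 : C + 1 ≤ n := by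
    rw [hn]
    push_cast
    have := Nat.le_ceil C
    have : (0 : ℝ) ≤ N := N.cast_nonneg
    linarith
  linarith

/-- All later arguments use the harmonic Maass form only through `IsWeakEigenform`. The shadow
enters here: it makes the Hecke combinations holomorphic, it makes the eigenvalues real since `F`
itself is not holomorphic, and the growth of its coefficients excludes `m = 0`. -/
theorem exists_isWeakEigenform {r m : ℕ} (hr : 2 ≤ r) {F : ℍ → ℂ}
    (hF : IsHarmonicMaassForm (2 - ((r : ℤ) + 2)) F) {cPlus cMinus : ℤ → ℝ}
    (hexp : HasFourierExpansion ((r : ℤ) + 2) m F (fun l ↦ (cPlus l : ℂ)) (fun l ↦ (cMinus l : ℂ)))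
    (hlead : cPlus (-(m : ℤ)) = 1) {G : CuspForm 𝒮ℒ ((r : ℤ) + 2)} (hG : IsNormalizedEigenform G)
    (hshadow : ∃ c : ℂ, c ≠ 0 ∧ ∀ τ : ℍ, xi (2 - ((r : ℤ) + 2)) F τ = c * G τ) :
    ∃ α : ℕ → ℝ, (∀ n, 1 ≤ n → cuspCoeff G n = α n) ∧ IsWeakEigenform r m F α := by
  obtain ⟨c, hc, hxi⟩ := hshadow
  have hdb := dbar_of_xi hxi
  have hmod : IsModular r F := isModular_iff.mpr fun γ ↦ by
    have := hF.modular γ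
    rwa [show 2 - ((r : ℤ) + 2) = -(r : ℤ) by ring] at this
  have hJ := hexp.apply_J_smul
  have hnot : ¬ MDiff F := fun h ↦ by
    obtain ⟨τ, hτ⟩ := hG.ne_zero
    have h1 := dbar_eq_zero h τ
    rw [hdb] at h1
    have hv : (τ.im : ℂ) ≠ 0 := by exact_mod_cast τ.im_ne_zero
    simp [hc, hτ, hv] at h1
  have hhol (n : ℕ) (hn : 1 ≤ n) := mdifferentiable_heckeSum_sub hF.differentiableAt hdb hn
    (hG.heckeOp_eq hn)
  have hreal (n : ℕ) (hn : 1 ≤ n) : cuspCoeff G n = ((cuspCoeff G n).re : ℝ) := by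
    have h1 := conj_eq_self_of_mdifferentiable hmod hJ hnot hn (hhol n hn)
    rw [Complex.conj_conj] at h1
    exact (Complex.conj_eq_iff_re.mp h1.symm).symm
  have hmdiff (n : ℕ) (hn : 1 ≤ n) :
      MDiff fun τ ↦ heckeSum r n F τ - ((cuspCoeff G n).re : ℝ) * F τ := by
    have h1 := hhol n hn
    rw [hreal n hn, Complex.conj_ofReal] at h1
    exact h1
  have hbound : ∃ C : ℝ, 0 < C ∧ ∀ᶠ n : ℕ in atTop, |(cuspCoeff G n).re| ≤ C * (n : ℝ) ^ r := by
    obtain ⟨C, hC, hb⟩ := exists_norm_cuspCoeff_le hr G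
    exact ⟨C, hC, hb.mono fun n hn ↦ (Complex.abs_re_le_norm _).trans hn⟩
  have hm : 1 ≤ m := by
    by_contra hm
    obtain rfl : m = 0 := by omega
    exact not_tendsto_one (by omega) hmod hmdiff hbound
      (hexp.tendsto_one (by omega) (by simpa using hlead))
  exact ⟨fun n ↦ (cuspCoeff G n).re, hreal, hmod, hF.continuous, hJ, hm,
    hexp.hasLeadingTerm (by omega) hm hlead, hmdiff, hbound⟩

/-! ### Polynomials in `j` -/

lemma tendsto_eval_jInv_mul_qPow (Q : ℂ[X]) :
    Tendsto (fun τ ↦ Q.eval (jInv τ) * qPow Q.natDegree τ) atImInfty (𝓝 Q.leadingCoeff) := by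
  have h : Tendsto (fun τ ↦ ∑ i ∈ Finset.range (Q.natDegree + 1),
      Q.coeff i * ((jInv τ * qPow 1 τ) ^ i * qPow ((Q.natDegree : ℤ) - i) τ)) atImInfty
      (𝓝 (∑ i ∈ Finset.range (Q.natDegree + 1),
        Q.coeff i * (1 ^ i * if i = Q.natDegree then 1 else 0))) := by
    refine tendsto_finsetSum _ fun i hi ↦ ((tendsto_jInv_mul_qPow.pow i).mul ?_).const_mul _
    rw [Finset.mem_range] at hi
    split_ifs with h
    · rw [h, sub_self]
      exact tendsto_const_nhds.congr fun τ ↦ (qPow_zero τ).symm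
    · exact tendsto_qPow_zero (by omega)
  have hval : (∑ i ∈ Finset.range (Q.natDegree + 1),
      Q.coeff i * (1 ^ i * if i = Q.natDegree then (1 : ℂ) else 0)) = Q.leadingCoeff := by
    simp
  rw [hval] at h
  refine h.congr fun τ ↦ ?_
  rw [Polynomial.eval_eq_sum_range, Finset.sum_mul]
  refine Finset.sum_congr rfl fun i _ ↦ ?_
  have e : qPow 1 τ ^ i = qPow i τ := by
    rw [qPow, qPow, ← Complex.exp_nat_mul]
    congr 1
    push_cast
    ring
  rw [mul_pow, e, mul_assoc (jInv τ ^ i), ← qPow_add, mul_assoc]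
  congr 4
  ring

lemma eq_zero_of_eval_jInv {Q : ℂ[X]} (h : ∀ τ, Q.eval (jInv τ) = 0) : Q = 0 := by
  have h1 := tendsto_eval_jInv_mul_qPow Q
  simp only [h, zero_mul] at h1
  exact Polynomial.leadingCoeff_eq_zero.mp (tendsto_nhds_unique h1 tendsto_const_nhds)

/-- `Q(j)` has a pole of exact order `natDegree Q` in `q` with leading coefficient that of `Q`, and
the order of a pole is unique. -/
lemma monic_of_tendsto {Q : ℂ[X]} {N : ℤ}
    (h : Tendsto (fun τ ↦ Q.eval (jInv τ) * qPow N τ) atImInfty (𝓝 1)) :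
    Q.Monic ∧ (Q.natDegree : ℤ) = N := by
  have h1 := tendsto_eval_jInv_mul_qPow Q
  have hN : (Q.natDegree : ℤ) = N := by
    rcases lt_trichotomy (Q.natDegree : ℤ) N with hlt | heq | hlt
    · exfalso
      have h2 := h1.mul (tendsto_qPow_zero (l := N - Q.natDegree) (by omega))
      rw [mul_zero] at h2
      refine zero_ne_one (tendsto_nhds_unique (h2.congr fun τ ↦ ?_) h)
      rw [mul_assoc, ← qPow_add, add_sub_cancel]
    · exact heq
    · exfalso
      have h2 := h.mul (tendsto_qPow_zero (l := Q.natDegree - N) (by omega))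
      rw [mul_zero] at h2
      have h3 : Q.leadingCoeff = 0 := by
        refine tendsto_nhds_unique h1 (h2.congr fun τ ↦ ?_)
        rw [mul_assoc, ← qPow_add, add_sub_cancel]
      rw [Polynomial.leadingCoeff_eq_zero] at h3
      simp only [h3, Polynomial.eval_zero, zero_mul] at h
      exact zero_ne_one (tendsto_nhds_unique tendsto_const_nhds h)
  refine ⟨?_, hN⟩
  rw [← hN] at h
  exact tendsto_nhds_unique h1 h

/-- The coefficientwise conjugate of `Q` takes the same values at `j(τ)` for all `τ`, and a
polynomial vanishing on the values of `j` is zero. -/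
lemma exists_real_polynomial {Q : ℂ[X]}
    (h : ∀ τ, Q.eval (jInv (J • τ)) = (starRingEnd ℂ) (Q.eval (jInv τ))) :
    ∃ P : ℝ[X], P.map (algebraMap ℝ ℂ) = Q := by
  have h1 : Q.map (starRingEnd ℂ) = Q := by
    refine sub_eq_zero.mp (eq_zero_of_eval_jInv fun τ ↦ ?_)
    have h2 := h (J • τ)
    have hJJ : J • J • τ = τ := by
      apply UpperHalfPlane.ext
      rw [coe_J_smul, coe_J_smul]
      simp
    rw [hJJ] at h2
    rw [Polynomial.eval_sub, h2, ← Polynomial.eval_map_apply, jInv_J_smul, Complex.conj_conj,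
      sub_self]
  have h2 : Q ∈ Polynomial.lifts (algebraMap ℝ ℂ) := by
    rw [Polynomial.lifts_iff_coeff_lifts]
    intro i
    have h3 := congrArg (fun R : ℂ[X] ↦ R.coeff i) h1
    simp only [Polynomial.coeff_map] at h3
    exact ⟨(Q.coeff i).re, Complex.conj_eq_iff_re.mp h3⟩
  rw [Polynomial.mem_lifts] at h2
  exact h2

/-! ### The functions `Δ^b Ẽ` -/

/-- At `r = 2` the value is `-1`. Nonnegativity allows `Δ^b` to be treated as a natural power. -/
lemma bExp_nonneg {r : ℕ} (hr : r ≠ 2) : 0 ≤ bExp r := by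
  rw [bExp]
  split_ifs <;> omega

lemma mod_twelve_cases {r : ℕ} (hr : Even r) : (r : ℤ) % 12 = 0 ∨ (r : ℤ) % 12 = 2 ∨
    (r : ℤ) % 12 = 4 ∨ (r : ℤ) % 12 = 6 ∨ (r : ℤ) % 12 = 8 ∨ (r : ℤ) % 12 = 10 := by
  obtain ⟨s, rfl⟩ := hr
  omega

/-- The exponent is the weight of `Ẽ_r`, one of `0, 14, 4, 6, 8, 10`. So `Δ^b Ẽ_r` has weight
exactly `r` and cancels the weight of `F`. -/
lemma Etilde_SL_smul {r : ℕ} (hr : Even r) (γ : SL(2, ℤ)) (τ : ℍ) :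
    Etilde r (γ • τ) = den (γ : Matrix (Fin 2) (Fin 2) ℤ) τ ^ ((r : ℤ) - 12 * bExp r) *
      Etilde r τ := by
  have hd := den_ne_zero (SL_det_pos γ) τ
  have h4 : E₄ (γ • τ) = den (γ : Matrix (Fin 2) (Fin 2) ℤ) τ ^ (4 : ℤ) * E₄ τ :=
    apply_SL_smul E₄ γ τ
  have h6 : E₆ (γ • τ) = den (γ : Matrix (Fin 2) (Fin 2) ℤ) τ ^ (6 : ℤ) * E₆ τ :=
    apply_SL_smul E₆ γ τ
  rcases mod_twelve_cases hr with h | h | h | h | h | h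
  · have e : (r : ℤ) - 12 * bExp r = 0 := by rw [bExp, if_neg (by omega)]; omega
    simp [Etilde, h, e]
  · have e : (r : ℤ) - 12 * bExp r = 14 := by rw [bExp, if_pos h]; omega
    simp only [Etilde, h, e, if_true, h4, h6]
    norm_cast
    ring
  · have e : (r : ℤ) - 12 * bExp r = 4 := by rw [bExp, if_neg (by omega)]; omega
    simpa [Etilde, h, e] using h4
  · have e : (r : ℤ) - 12 * bExp r = 6 := by rw [bExp, if_neg (by omega)]; omega
    simpa [Etilde, h, e] using h6
  · have e : (r : ℤ) - 12 * bExp r = 8 := by rw [bExp, if_neg (by omega)]; omega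
    simp only [Etilde, h, e, h4]
    norm_num
    ring
  · have e : (r : ℤ) - 12 * bExp r = 10 := by rw [bExp, if_neg (by omega)]; omega
    simp only [Etilde, h, e, h4, h6]
    norm_num
    ring

lemma Etilde_J_smul (k : ℤ) (τ : ℍ) : Etilde k (J • τ) = (starRingEnd ℂ) (Etilde k τ) := by
  unfold Etilde
  split_ifs <;> simp [E₄_J_smul, E₆_J_smul]

lemma mdifferentiable_E₄ : MDiff E₄ := E₄.holo'

lemma mdifferentiable_E₆ : MDiff E₆ := E₆.holo'

lemma mdifferentiable_Etilde (k : ℤ) : MDiff (Etilde k) := by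
  unfold Etilde
  split_ifs
  · exact (MDiff_pow mdifferentiable_E₄ 2).mul mdifferentiable_E₆
  · exact mdifferentiable_E₄
  · exact mdifferentiable_E₆
  · exact MDiff_pow mdifferentiable_E₄ 2
  · exact mdifferentiable_E₄.mul mdifferentiable_E₆
  · exact mdifferentiable_const

lemma tendsto_Etilde (k : ℤ) : Tendsto (Etilde k) atImInfty (𝓝 1) := by
  have h4 : Tendsto E₄ atImInfty (𝓝 1) := tendsto_E_atImInfty (by norm_num) ⟨2, rfl⟩
  have h6 : Tendsto E₆ atImInfty (𝓝 1) := tendsto_E_atImInfty (by norm_num) ⟨3, rfl⟩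
  unfold Etilde
  split_ifs
  · simpa using (h4.pow 2).mul h6
  · exact h4
  · exact h6
  · simpa using h4.pow 2
  · simpa using h4.mul h6
  · exact tendsto_const_nhds

/-- The even classes modulo `12` not divisible by `3` are those in which `Ẽ_r` contains `E₄`. In the
same way, those not divisible by `4` contain `E₆`, which vanishes at `i`. -/
lemma Etilde_ρ {r : ℕ} (hr : Even r) (h : ¬ 3 ∣ r) : Etilde r ρ = 0 := by
  rcases mod_twelve_cases hr with h1 | h1 | h1 | h1 | h1 | h1
  · omega
  · simp [Etilde, h1, E₄_ρ]
  · simp [Etilde, h1, E₄_ρ]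
  · omega
  · simp [Etilde, h1, E₄_ρ]
  · simp [Etilde, h1, E₄_ρ]

lemma Etilde_I {r : ℕ} (hr : Even r) (h : ¬ 4 ∣ r) : Etilde r I = 0 := by
  rcases mod_twelve_cases hr with h1 | h1 | h1 | h1 | h1 | h1
  · omega
  · simp [Etilde, h1, E₆_I]
  · omega
  · simp [Etilde, h1, E₆_I]
  · omega
  · simp [Etilde, h1, E₆_I]

namespace IsWeakEigenform

variable {r m : ℕ} {F : ℍ → ℂ} {α : ℕ → ℝ}

/-- The function `Δ^b Ẽ (n^{k-1} F | T_{2-k}(n) - a(n) F)`. -/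
def heckeProd (r : ℕ) (F : ℍ → ℂ) (α : ℕ → ℝ) (n : ℕ) (τ : ℍ) : ℂ :=
  discriminant τ ^ (bExp r).toNat * Etilde r τ * (heckeSum r n F τ - α n * F τ)

lemma isModular_heckeProd (hF : IsWeakEigenform r m F α) (hr : Even r) (hr2 : r ≠ 2) {n : ℕ}
    (hn : 1 ≤ n) : IsModular 0 (heckeProd r F α n) := by
  intro γ τ
  have hd := den_ne_zero (SL_det_pos γ) τ
  have hb := bExp_nonneg hr2
  have e₁ := hF.modular.heckeSum hn γ τ
  have e₂ := hF.modular γ τ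
  have e₃ := discriminant_SL_smul γ τ
  have e₄ := Etilde_SL_smul hr γ τ
  have e₅ : den (γ : Matrix (Fin 2) (Fin 2) ℤ) τ ^ r * (heckeSum r n F (γ • τ) - α n * F (γ • τ)) =
      heckeSum r n F τ - α n * F τ := by linear_combination e₁ - α n * e₂
  have e₆ : den (γ : Matrix (Fin 2) (Fin 2) ℤ) τ ^ (12 * (bExp r).toNat) *
      den (γ : Matrix (Fin 2) (Fin 2) ℤ) τ ^ ((r : ℤ) - 12 * bExp r) =
      den (γ : Matrix (Fin 2) (Fin 2) ℤ) τ ^ r := by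
    rw [← zpow_natCast, ← zpow_natCast, ← zpow_add₀ hd]
    congr 1
    push_cast
    rw [Int.toNat_of_nonneg hb]
    ring
  rw [pow_zero, one_mul, heckeProd, heckeProd, ← e₅, e₃, e₄, mul_pow]
  set D := den (γ : Matrix (Fin 2) (Fin 2) ℤ) τ
  have e₇ : (D ^ (12 : ℤ)) ^ (bExp r).toNat = D ^ (12 * (bExp r).toNat) := by
    rw [pow_mul]
    norm_cast
  rw [← e₆, ← e₇]
  ring

lemma mdifferentiable_heckeProd (hF : IsWeakEigenform r m F α) {n : ℕ} (hn : 1 ≤ n) :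
    MDiff (heckeProd r F α n) :=
  ((MDiff_pow mdifferentiable_discriminant _).mul (mdifferentiable_Etilde r)).mul (hF.mdiff n hn)

lemma heckeProd_J_smul (hF : IsWeakEigenform r m F α) {n : ℕ} (hn : 1 ≤ n) (τ : ℍ) :
    heckeProd r F α n (J • τ) = (starRingEnd ℂ) (heckeProd r F α n τ) := by
  simp only [heckeProd, map_mul, map_sub, map_pow, discriminant_J_smul, Etilde_J_smul,
    heckeSum_J_smul hF.modular hF.apply_J hn, hF.apply_J, Complex.conj_ofReal]

/-- For `n ≥ 2` and `m ≥ 1` the term `α n F`, of order `q^{-m}`, is of lower order than the leading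
`q^{-mn}` of the Hecke sum. -/
lemma tendsto_heckeProd (hF : IsWeakEigenform r m F α) {n : ℕ} (hn : 2 ≤ n) (hr2 : r ≠ 2) :
    Tendsto (fun τ ↦ heckeProd r F α n τ * qPow ((m * n : ℕ) - bExp r) τ) atImInfty (𝓝 1) := by
  have hb := bExp_nonneg hr2
  have hm := hF.one_le
  have h1 := tendsto_discriminant_mul_qPow.pow (bExp r).toNat
  have h2 := tendsto_heckeSum_mul_qPow (r := r) hm (by omega : 0 < n) hF.lead
  have h3 : Tendsto (fun τ ↦ F τ * qPow m τ * qPow ((m * n : ℕ) - m : ℤ) τ) atImInfty (𝓝 0) := by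
    have := hF.lead.tendsto.mul (tendsto_qPow_zero (l := ((m * n : ℕ) - m : ℤ)) (by
      push_cast
      nlinarith))
    simpa using this
  have h4 := (h1.mul (tendsto_Etilde r)).mul (h2.sub (h3.const_mul (α n : ℂ)))
  simp only [one_pow, mul_zero, sub_zero, mul_one] at h4
  refine h4.congr fun τ ↦ ?_
  have e₁ : qPow (-1) τ ^ (bExp r).toNat = qPow (-bExp r) τ := by
    rw [qPow, qPow, ← Complex.exp_nat_mul]
    congr 1
    have : (((bExp r).toNat : ℤ) : ℂ) = bExp r := by rw [Int.toNat_of_nonneg hb]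
    push_cast at this ⊢
    rw [this]
    ring
  have e₂ : qPow m τ * qPow ((m * n : ℕ) - m : ℤ) τ = qPow ((m * n : ℕ) : ℤ) τ := by
    rw [← qPow_add, add_sub_cancel]
  have e₃ : qPow ((m * n : ℕ) - bExp r) τ = qPow ((m * n : ℕ) : ℤ) τ * qPow (-bExp r) τ := by
    rw [← qPow_add, sub_eq_add_neg]
  rw [mul_pow, e₁, mul_assoc (F τ), e₂, e₃, heckeProd]
  ring

/-- The function `heckeProd` is a real monic polynomial in `j`. -/
theorem exists_polynomial (hF : IsWeakEigenform r m F α) (hr : Even r) (hr2 : r ≠ 2) {n : ℕ}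
    (hn : 2 ≤ n) : ∃ P : ℝ[X], P.Monic ∧ (P.natDegree : ℤ) = m * n - bExp r ∧
      ∀ τ, aeval (jInv τ) P = heckeProd r F α n τ := by
  have hb := bExp_nonneg hr2
  have h1 := hF.tendsto_heckeProd hn hr2
  have h2 : Tendsto (fun τ ↦ heckeProd r F α n τ * qPow ((m * n : ℕ) : ℤ) τ) atImInfty
      (𝓝 (1 * if bExp r = 0 then 1 else 0)) := by
    have h3 : Tendsto (qPow (bExp r)) atImInfty (𝓝 (if bExp r = 0 then 1 else 0)) := by
      split_ifs with h
      · rw [h]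
        exact tendsto_const_nhds.congr fun τ ↦ (qPow_zero τ).symm
      · exact tendsto_qPow_zero (by omega)
    refine (h1.mul h3).congr fun τ ↦ ?_
    rw [mul_assoc, ← qPow_add, sub_add_cancel]
  obtain ⟨Q, hQ⟩ := exists_polynomial_jInv (m * n) (hF.isModular_heckeProd hr hr2 (by omega))
    (hF.mdifferentiable_heckeProd (by omega)) (isBigO_of_tendsto_mul_qPow h2)
  obtain ⟨P, rfl⟩ := exists_real_polynomial (Q := Q) fun τ ↦ by
    rw [hQ, hQ, hF.heckeProd_J_smul (by omega)]
  simp only [← hQ] at h1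
  obtain ⟨h3, h4⟩ := monic_of_tendsto h1
  refine ⟨P, (Polynomial.monic_map_iff).mp h3, ?_, fun τ ↦ ?_⟩
  · rw [Polynomial.natDegree_map] at h4
    rw [h4]
    push_cast
    rfl
  · rw [← hQ, Polynomial.aeval_def, Polynomial.eval₂_eq_eval_map]

end IsWeakEigenform

/-! ### The arc, parametrised by the real part -/

/-- For `t ∈ [-1/2, 0]`, the point of the arc with real part `t`. -/
def arcPt (t : ℝ) : ℍ :=
  ⟨⟨t, √(max (1 - t ^ 2) (1 / 4))⟩, Real.sqrt_pos.mpr (lt_max_of_lt_right (by norm_num))⟩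

lemma continuous_arcPt : Continuous arcPt := by
  refine Continuous.upperHalfPlaneMk ?_ _
  have : (fun t : ℝ ↦ (⟨t, √(max (1 - t ^ 2) (1 / 4))⟩ : ℂ)) =
      fun t : ℝ ↦ (t : ℂ) + (√(max (1 - t ^ 2) (1 / 4)) : ℝ) * Complex.I := by
    ext t
    exact Complex.mk_eq_add_mul_I _ _
  rw [this]
  fun_prop

lemma arcPt_re (t : ℝ) : (arcPt t).re = t := rfl

section

variable {t : ℝ} (ht : t ∈ Set.Icc (-(1 / 2) : ℝ) 0)

include ht

lemma three_quarters_le : 3 / 4 ≤ 1 - t ^ 2 := by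
  obtain ⟨h1, h2⟩ := ht
  nlinarith

lemma arcPt_im : (arcPt t).im = √(1 - t ^ 2) := by
  change √(max (1 - t ^ 2) (1 / 4)) = _
  -- The cutoff `1/4` only serves to make `arcPt` total and continuous on `ℝ`. On `[-1/2, 0]` one
  -- has `1 - t² ≥ 3/4`.
  rw [max_eq_left (by linarith [three_quarters_le ht])]

lemma coe_arcPt : (arcPt t : ℂ) = Complex.exp (Real.arccos t * Complex.I) := by
  have h1 := arcPt_im ht
  have h2 := arcPt_re t
  obtain ⟨h3, h4⟩ := ht
  rw [Complex.exp_mul_I, ← Complex.ofReal_cos, ← Complex.ofReal_sin,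
    Real.cos_arccos (by linarith) (by linarith), Real.sin_arccos, ← h1,
    ← Complex.mk_eq_add_mul_I]
  exact Complex.ext rfl rfl

lemma norm_arcPt : ‖(arcPt t : ℂ)‖ = 1 := by
  rw [coe_arcPt ht, Complex.norm_exp_ofReal_mul_I]

lemma arcPt_mem : arcPt t ∈ arcA := ⟨norm_arcPt ht, by rw [arcPt_re]; exact ht.1,
  by rw [arcPt_re]; exact ht.2⟩

lemma half_le_arcPt_im : 1 / 2 ≤ (arcPt t).im := half_le_im_of_mem_arcA (arcPt_mem ht)

end

lemma eq_arcPt {τ : ℍ} (hτ : τ ∈ arcA) : τ = arcPt τ.re := by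
  have h1 : τ.re ∈ Set.Icc (-(1 / 2) : ℝ) 0 := hτ.2
  have h2 := re_im_of_norm_one hτ.1
  refine UpperHalfPlane.ext (Complex.ext rfl ?_)
  rw [coe_im, coe_im, arcPt_im h1, ← h2, add_sub_cancel_left, Real.sqrt_sq τ.im_pos.le]

lemma mem_fd_of_mem_arcA {τ : ℍ} (hτ : τ ∈ arcA) : τ ∈ ModularGroup.fd := by
  refine ⟨?_, ?_⟩
  · rw [Complex.normSq_eq_norm_sq, hτ.1]
    norm_num
  · rw [abs_le]
    exact ⟨hτ.2.1, by linarith [hτ.2.2]⟩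

lemma arcPt_zero : arcPt 0 = I := by
  refine UpperHalfPlane.ext (Complex.ext rfl ?_)
  rw [coe_im, arcPt_im ⟨by norm_num, le_rfl⟩]
  simp

lemma arcPt_neg_half : arcPt (-(1 / 2)) = ρ := by
  refine UpperHalfPlane.ext (Complex.ext ?_ ?_)
  · change -(1 / 2) = (-1 / 2 : ℝ)
    norm_num
  · rw [coe_im, arcPt_im ⟨le_rfl, by norm_num⟩]
    change _ = √3 / 2
    rw [show (1 : ℝ) - (-(1 / 2)) ^ 2 = 3 / 2 ^ 2 by norm_num, Real.sqrt_div (by norm_num),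
      Real.sqrt_sq (by norm_num)]

/-- The real function `t ↦ j(arcPt t)`. -/
def jArc (t : ℝ) : ℝ := (jInv (arcPt t)).re

lemma coe_jArc {t : ℝ} (ht : t ∈ Set.Icc (-(1 / 2) : ℝ) 0) : (jArc t : ℂ) = jInv (arcPt t) :=
  jInv_im_of_norm_one (norm_arcPt ht)

lemma continuous_jArc : Continuous jArc :=
  Complex.continuous_re.comp (continuous_jInv.comp continuous_arcPt)

lemma jArc_neg_half : jArc (-(1 / 2)) = 0 := by rw [jArc, arcPt_neg_half, jInv_ρ, Complex.zero_re]

lemma jArc_zero : jArc 0 = 1728 := by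
  rw [jArc, arcPt_zero, jInv_I]
  rfl

lemma jArc_injOn : Set.InjOn jArc (Set.Icc (-(1 / 2)) 0) := by
  intro s hs t ht h
  have h1 : jInv (arcPt s) = jInv (arcPt t) := by rw [← coe_jArc hs, ← coe_jArc ht, h]
  have h2 := jInv_injOn_arcA (arcPt_mem hs) (arcPt_mem ht) h1
  rw [← arcPt_re s, h2, arcPt_re]

/-- A continuous injective function on an interval is strictly monotone, and the end values `0` and
`1728` fix the direction. No derivative of `j` is needed. -/
lemma jArc_strictMonoOn : StrictMonoOn jArc (Set.Icc (-(1 / 2)) 0) := by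
  refine continuous_jArc.continuousOn.strictMonoOn_of_injOn_Icc (by norm_num) ?_ jArc_injOn
  rw [jArc_neg_half, jArc_zero]
  norm_num

lemma jArc_mem {t : ℝ} (ht : t ∈ Set.Icc (-(1 / 2) : ℝ) 0) : jArc t ∈ Set.Icc (0 : ℝ) 1728 := by
  rw [← jArc_neg_half, ← jArc_zero]
  exact ⟨jArc_strictMonoOn.monotoneOn ⟨le_rfl, by norm_num⟩ ht ht.1,
    jArc_strictMonoOn.monotoneOn ht ⟨by norm_num, le_rfl⟩ ht.2⟩

lemma exists_jArc_eq {x : ℝ} (hx : x ∈ Set.Icc (0 : ℝ) 1728) :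
    ∃ t ∈ Set.Icc (-(1 / 2) : ℝ) 0, jArc t = x := by
  have h := intermediate_value_Icc (show (-(1 / 2) : ℝ) ≤ 0 by norm_num)
    continuous_jArc.continuousOn
  rw [jArc_neg_half, jArc_zero] at h
  exact h hx

lemma arcProjection_eq {a b : ℝ} (ha : a ∈ Set.Icc (-(1 / 2) : ℝ) 0)
    (hb : b ∈ Set.Icc (-(1 / 2) : ℝ) 0) : arcProjection (jArc a) (jArc b) = Set.Icc a b := by
  ext t
  constructor
  · rintro ⟨τ, hτ, rfl, x, hx, hj⟩
    have h1 : τ.re ∈ Set.Icc (-(1 / 2) : ℝ) 0 := hτ.2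
    rw [eq_arcPt hτ, ← coe_jArc h1] at hj
    rw [← Complex.ofReal_inj.mp hj] at hx
    exact ⟨(jArc_strictMonoOn.le_iff_le ha h1).mp hx.1, (jArc_strictMonoOn.le_iff_le h1 hb).mp hx.2⟩
  · intro h
    have ht : t ∈ Set.Icc (-(1 / 2) : ℝ) 0 := ⟨ha.1.trans h.1, h.2.trans hb.2⟩
    exact ⟨arcPt t, arcPt_mem ht, rfl, jArc t, ⟨jArc_strictMonoOn.monotoneOn ha ht h.1,
      jArc_strictMonoOn.monotoneOn ht hb h.2⟩, (coe_jArc ht).symm⟩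

/-! ### The phase of the main term -/

/-- The phase `2πNt + (r/2) arccos t` of the main term at the point `arcPt t`. -/
def phase (r N : ℕ) (t : ℝ) : ℝ := 2 * Real.pi * N * t + r / 2 * Real.arccos t

lemma continuous_phase (r N : ℕ) : Continuous (phase r N) := by
  unfold phase
  fun_prop

/-- The derivative is `2πN - r / (2√(1 - t²))`, at least `2πN - r` on the arc. -/
lemma phase_strictMonoOn {r N : ℕ} (h : r < N) :
    StrictMonoOn (phase r N) (Set.Icc (-(1 / 2)) 0) := by
  refine strictMonoOn_of_deriv_pos (convex_Icc _ _) (continuous_phase r N).continuousOn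
    fun t ht ↦ ?_
  rw [interior_Icc] at ht
  have ht' : t ∈ Set.Icc (-(1 / 2) : ℝ) 0 := Set.Ioo_subset_Icc_self ht
  have h1 : HasDerivAt (phase r N)
      (2 * Real.pi * N * 1 + r / 2 * -(1 / √(1 - t ^ 2))) t :=
    ((hasDerivAt_id t).const_mul _).add ((Real.hasDerivAt_arccos (by linarith [ht.1])
      (by linarith [ht.2])).const_mul _)
  rw [h1.deriv]
  have h2 : 1 / 2 ≤ √(1 - t ^ 2) := by
    rw [← arcPt_im ht']
    exact half_le_arcPt_im ht'
  have h3 : 1 / √(1 - t ^ 2) ≤ 2 := by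
    rw [div_le_iff₀ (by linarith)]
    linarith
  have h4 : (r : ℝ) < N := by exact_mod_cast h
  have h5 := Real.pi_gt_three
  have h6 : (0 : ℝ) ≤ r := r.cast_nonneg
  nlinarith

lemma phase_zero (r N : ℕ) : phase r N 0 = Real.pi * (r / 4) := by
  rw [phase, Real.arccos_zero]
  ring

lemma phase_neg_half (r N : ℕ) : phase r N (-(1 / 2)) = Real.pi * (-N + r / 3) := by
  have h : Real.arccos (-(1 / 2)) = 2 * Real.pi / 3 := by
    have h1 : -(1 / 2) = Real.cos (2 * Real.pi / 3) := by
      rw [show 2 * Real.pi / 3 = Real.pi - Real.pi / 3 by ring, Real.cos_pi_sub,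
        Real.cos_pi_div_three]
    rw [h1, Real.arccos_cos (by positivity) (by linarith [Real.pi_pos])]
  rw [phase, h]
  ring

/-- Location of the points at which the phase is an integral multiple of `π`. -/
lemma abs_sub_le_of_phase_eq {r N : ℕ} {t : ℝ} {h : ℤ} (hp : phase r N t = h * Real.pi) :
    h - r / 2 ≤ 2 * N * t ∧ 2 * N * t ≤ h := by
  have h1 := Real.arccos_nonneg t
  have h2 := Real.arccos_le_pi t
  have h3 := Real.pi_pos
  have h4 : (0 : ℝ) ≤ r := r.cast_nonneg
  rw [phase] at hp
  constructor
  · refine le_of_mul_le_mul_right ?_ h3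
    nlinarith
  · refine le_of_mul_le_mul_right ?_ h3
    nlinarith

namespace IsWeakEigenform

variable {r m : ℕ} {F : ℍ → ℂ} {α : ℕ → ℝ}

/-- The function `e^{-irθ/2} (n^{k-1} F | T_{2-k}(n) - a(n) F)` on the arc, `τ = e^{iθ}`. -/
def arcFun (r : ℕ) (F : ℍ → ℂ) (α : ℕ → ℝ) (n : ℕ) (t : ℝ) : ℂ :=
  Complex.exp (-(r / 2 * Real.arccos t * Complex.I)) *
    (heckeSum r n F (arcPt t) - α n * F (arcPt t))

lemma continuous_arcFun (hF : IsWeakEigenform r m F α) {n : ℕ} (hn : 1 ≤ n) :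
    Continuous (arcFun r F α n) := by
  have h1 : Continuous fun τ ↦ heckeSum r n F τ - α n * F τ := (hF.mdiff n hn).continuous
  have h2 := h1.comp continuous_arcPt
  have h3 : Continuous fun t : ℝ ↦ Complex.exp (-(r / 2 * Real.arccos t * Complex.I)) := by
    fun_prop
  exact h3.mul h2

lemma arcPt_pow {t : ℝ} (ht : t ∈ Set.Icc (-(1 / 2) : ℝ) 0) (r : ℕ) :
    (arcPt t : ℂ) ^ r = Complex.exp (r / 2 * Real.arccos t * Complex.I) *
      Complex.exp (r / 2 * Real.arccos t * Complex.I) := by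
  rw [coe_arcPt ht, ← Complex.exp_nat_mul, ← Complex.exp_add]
  congr 1
  ring

lemma conj_exp_aux (r : ℕ) (θ : ℝ) : (starRingEnd ℂ) (Complex.exp (-(r / 2 * θ * Complex.I))) =
    Complex.exp (r / 2 * θ * Complex.I) := by
  rw [← Complex.exp_conj]
  congr 1
  simp only [map_neg, map_mul, map_div₀, Complex.conj_natCast, map_ofNat, Complex.conj_ofReal,
    Complex.conj_I]
  ring

/-- For `f` the holomorphic Hecke combination, `τ^r f(-1/τ) = f(τ)` and `f(-τ̄) = conj f(τ)`. On the
arc these give `f = e^{irθ} conj f`, so `e^{-irθ/2} f` is real. -/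
lemma conj_arcFun (hF : IsWeakEigenform r m F α) {n : ℕ} (hn : 1 ≤ n) {t : ℝ}
    (ht : t ∈ Set.Icc (-(1 / 2) : ℝ) 0) :
    (starRingEnd ℂ) (arcFun r F α n t) = arcFun r F α n t := by
  have e₁ := hF.modular.heckeSum hn ModularGroup.S (arcPt t)
  have e₂ := hF.modular ModularGroup.S (arcPt t)
  have hd : den (ModularGroup.S : Matrix (Fin 2) (Fin 2) ℤ) (arcPt t) = arcPt t := by
    simp [den, ModularGroup.S]
  rw [hd, S_smul_eq_J_smul (norm_arcPt ht), arcPt_pow ht] at e₁ e₂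
  rw [heckeSum_J_smul hF.modular hF.apply_J hn] at e₁
  rw [hF.apply_J] at e₂
  have h := Complex.exp_ne_zero (r / 2 * Real.arccos t * Complex.I)
  rw [arcFun, map_mul, conj_exp_aux, map_sub, map_mul, Complex.conj_ofReal,
    Complex.exp_neg, eq_inv_mul_iff_mul_eq₀ h]
  linear_combination e₁ - α n * e₂

/-- After the twist the two main terms are complex conjugates of each other, and `e^{-irθ/2} q^{-N}`
has argument `-phase r N t`. -/
lemma main_term_eq (N : ℕ) {t : ℝ} (ht : t ∈ Set.Icc (-(1 / 2) : ℝ) 0) :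
    Complex.exp (-(r / 2 * Real.arccos t * Complex.I)) * (qPow (-(N : ℤ)) (arcPt t) +
      (arcPt t : ℂ) ^ r * qPow (-(N : ℤ)) (ModularGroup.S • arcPt t)) =
    (2 * Real.exp (2 * Real.pi * N * (arcPt t).im) * Real.cos (phase r N t) : ℝ) := by
  rw [S_smul_eq_J_smul (norm_arcPt ht), qPow_J_smul, arcPt_pow ht]
  set u := Complex.exp (-(r / 2 * Real.arccos t * Complex.I)) with hu
  set w := qPow (-(N : ℤ)) (arcPt t) with hw
  have h1 : u * Complex.exp (r / 2 * Real.arccos t * Complex.I) = 1 := by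
    rw [hu, ← Complex.exp_add, neg_add_cancel, Complex.exp_zero]
  have h2 : u * (w + Complex.exp (r / 2 * Real.arccos t * Complex.I) *
      Complex.exp (r / 2 * Real.arccos t * Complex.I) * (starRingEnd ℂ) w) =
      u * w + (starRingEnd ℂ) (u * w) := by
    rw [map_mul, hu, conj_exp_aux, ← hu]
    linear_combination (Complex.exp (r / 2 * Real.arccos t * Complex.I) * (starRingEnd ℂ) w) * h1
  have h3 : u * w = ((Real.exp (2 * Real.pi * N * (arcPt t).im) : ℝ) : ℂ) *
      Complex.exp (((-phase r N t : ℝ) : ℂ) * Complex.I) := by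
    rw [hu, hw, qPow, ← Complex.exp_add, Complex.ofReal_exp, ← Complex.exp_add]
    congr 1
    conv_lhs => rw [← Complex.re_add_im (arcPt t : ℂ), coe_re, coe_im, arcPt_re]
    rw [phase]
    push_cast
    linear_combination -(2 * (Real.pi : ℂ) * N * (arcPt t).im) * Complex.I_sq
  rw [h2, Complex.add_conj, h3, Complex.re_ofReal_mul, Complex.exp_ofReal_mul_I_re, Real.cos_neg]
  congr 1
  ring

/-- The error `5/4` of the Hecke sum plus `1/4` for the term `α n F`. The total `3/2` stays below
the amplitude `2`, which is all the sign changes require. -/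
theorem eventually_abs_arcFun_sub_le (hF : IsWeakEigenform r m F α) :
    ∀ᶠ n : ℕ in atTop, ∀ t ∈ Set.Icc (-(1 / 2) : ℝ) 0,
      |(arcFun r F α n t).re -
        2 * Real.exp (2 * Real.pi * (m * n : ℕ) * (arcPt t).im) * Real.cos (phase r (m * n) t)| ≤
      3 / 2 * Real.exp (2 * Real.pi * (m * n : ℕ) * (arcPt t).im) := by
  have hm := hF.one_le
  obtain ⟨D, hD, hfd⟩ := hF.lead.bound_fd hF.continuous
  obtain ⟨C, hC, hα⟩ := hF.bound
  -- The factor `e` comes from `e^{2πmv} ≤ e^{1-n} e^{2πmnv}`, valid because `2πmv ≥ 1` on the arc.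
  have hsmall := eventually_mul_pow_mul_exp_neg_le (C * D * Real.exp 1) r
    (show (0 : ℝ) < 1 / 4 by norm_num)
  filter_upwards [heckeSum_arc hm hF.modular hF.continuous hF.lead, hα, hsmall,
    eventually_ge_atTop 1] with n h1 h2 h3 hn t ht
  have e₁ := h1 (arcPt t) (arcPt_mem ht)
  have e₂ := hfd (arcPt t) (mem_fd_of_mem_arcA (arcPt_mem ht))
  have hv := half_le_arcPt_im ht
  set v := (arcPt t).im
  set τ := arcPt t
  set A := Real.exp (2 * Real.pi * (m * n : ℕ) * v) with hA
  have hA0 : 0 < A := Real.exp_pos _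
  have e₃ : ‖(α n : ℂ) * F τ‖ ≤ 1 / 4 * A := by
    rw [norm_mul, Complex.norm_real, Real.norm_eq_abs]
    calc |α n| * ‖F τ‖ ≤ (C * (n : ℝ) ^ r) * (D * Real.exp (2 * Real.pi * m * v)) := by gcongr
      _ = C * D * (n : ℝ) ^ r * Real.exp (2 * Real.pi * m * v) := by ring
      _ ≤ C * D * (n : ℝ) ^ r * (Real.exp 1 * Real.exp (-n) * A) := by
          gcongr
          rw [hA, ← Real.exp_add, ← Real.exp_add, Real.exp_le_exp]
          have hm' : (1 : ℝ) ≤ m := by exact_mod_cast hm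
          have hn' : (0 : ℝ) ≤ (n : ℝ) - 1 := by
            have : (1 : ℝ) ≤ n := by exact_mod_cast hn
            linarith
          have h5 := Real.pi_gt_three
          have h6 : 1 ≤ 2 * Real.pi * m * v := by
            have : 3 ≤ Real.pi * m := by nlinarith
            nlinarith
          push_cast
          nlinarith
      _ = C * D * Real.exp 1 * (n : ℝ) ^ r * Real.exp (-n) * A := by ring
      _ ≤ 1 / 4 * A := by gcongr
  have e₄ := main_term_eq (r := r) (m * n) ht
  have e₅ : arcFun r F α n t - ((2 * A * Real.cos (phase r (m * n) t) : ℝ) : ℂ) =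
      Complex.exp (-(r / 2 * Real.arccos t * Complex.I)) *
      ((heckeSum r n F τ - (qPow (-((m * n : ℕ) : ℤ)) τ +
        (τ : ℂ) ^ r * qPow (-((m * n : ℕ) : ℤ)) (ModularGroup.S • τ))) - α n * F τ) := by
    rw [← e₄, arcFun]
    ring
  have hu : ‖Complex.exp (-(r / 2 * Real.arccos t * Complex.I))‖ = 1 := by
    rw [show -((r : ℂ) / 2 * Real.arccos t * Complex.I) =
      ((-(r / 2 * Real.arccos t) : ℝ) : ℂ) * Complex.I by push_cast; ring,
      Complex.norm_exp_ofReal_mul_I]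
  have e₆ : (arcFun r F α n t).re - 2 * A * Real.cos (phase r (m * n) t) =
      (arcFun r F α n t - ((2 * A * Real.cos (phase r (m * n) t) : ℝ) : ℂ)).re := by
    rw [Complex.sub_re, Complex.ofReal_re]
  rw [e₆]
  refine (Complex.abs_re_le_norm _).trans ?_
  rw [e₅, norm_mul, hu, one_mul]
  refine (norm_sub_le _ _).trans ?_
  have e₇ : 2 * Real.pi * m * (n * v) = 2 * Real.pi * (m * n : ℕ) * v := by
    push_cast
    ring
  rw [e₇, ← hA] at e₁
  linarith

end IsWeakEigenform

/-! ### Zeros on the arc -/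

/-- A sign-change argument: a real function close to `A cos φ` has a zero between consecutive points
at which `φ` is an integral multiple of `π`. -/
lemma exists_zero_of_phase {g A φ : ℝ → ℝ} {s t : ℝ} {h : ℤ} (hst : s ≤ t) (hg : Continuous g)
    (hA : ∀ x, 0 < A x)
    (hb : ∀ x ∈ Set.Icc s t, |g x - 2 * A x * Real.cos (φ x)| ≤ 3 / 2 * A x)
    (hs : φ s = h * Real.pi) (ht : φ t = (h + 1 : ℤ) * Real.pi) : ∃ x ∈ Set.Ioo s t, g x = 0 := by
  have h1 := abs_le.mp (hb s ⟨le_rfl, hst⟩)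
  have h2 := abs_le.mp (hb t ⟨hst, le_rfl⟩)
  have hs0 := hA s
  have ht0 := hA t
  rw [hs, Real.cos_int_mul_pi] at h1
  rw [ht, Real.cos_int_mul_pi] at h2
  rcases Int.even_or_odd h with he | ho
  · rw [he.neg_one_zpow] at h1
    rw [(he.add_one).neg_one_zpow] at h2
    exact intermediate_value_Ioo' hst hg.continuousOn ⟨by linarith, by linarith⟩
  · rw [ho.neg_one_zpow] at h1
    rw [(ho.add_one).neg_one_zpow] at h2
    exact intermediate_value_Ioo hst hg.continuousOn ⟨by linarith, by linarith⟩

namespace IsWeakEigenform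

variable {r m : ℕ} {F : ℍ → ℂ} {α : ℕ → ℝ}

lemma heckeProd_eq_zero_of_arcFun (hF : IsWeakEigenform r m F α) {n : ℕ} (hn : 1 ≤ n) {t : ℝ}
    (ht : t ∈ Set.Icc (-(1 / 2) : ℝ) 0) (h : (arcFun r F α n t).re = 0) :
    heckeProd r F α n (arcPt t) = 0 := by
  have h1 := Complex.conj_eq_iff_re.mp (hF.conj_arcFun hn ht)
  rw [h, Complex.ofReal_zero, arcFun, eq_comm,
    mul_eq_zero_iff_left (Complex.exp_ne_zero _)] at h1
  rw [heckeProd, h1, mul_zero]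

/-- The zeros in the interior of the arc, one for each pair of consecutive multiples of `π` among
the values of the phase. -/
lemma eventually_exists_interior_zeros (hF : IsWeakEigenform r m F α) :
    ∀ᶠ n : ℕ in atTop, ∃ ζ : ℤ → ℝ,
      ∀ h ∈ Set.Ico (-(m * n : ℕ) + ((r : ℤ) + 2) / 3) ((r : ℤ) / 4),
        (ζ h ∈ Set.Ioo (-(1 / 2) : ℝ) 0 ∧ heckeProd r F α n (arcPt (ζ h)) = 0 ∧
          (h : ℝ) - r / 2 < 2 * (m * n : ℕ) * ζ h ∧ 2 * (m * n : ℕ) * ζ h < h + 1) ∧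
        ∀ h' ∈ Set.Ico (-(m * n : ℕ) + ((r : ℤ) + 2) / 3) ((r : ℤ) / 4), h < h' → ζ h < ζ h' := by
  have hm := hF.one_le
  filter_upwards [hF.eventually_abs_arcFun_sub_le, eventually_gt_atTop r] with n hb hn
  have hN : r < m * n := by nlinarith
  set N := m * n with hNdef
  have hmono := phase_strictMonoOn hN
  have hN0 : (0 : ℝ) < N := by exact_mod_cast (by omega)
  have hpi := Real.pi_pos
  have hpt (h : ℤ) : ∃ t, h ∈ Set.Icc (-(N : ℤ) + ((r : ℤ) + 2) / 3) ((r : ℤ) / 4) →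
      t ∈ Set.Icc (-(1 / 2) : ℝ) 0 ∧ phase r N t = h * Real.pi := by
    by_cases hh : h ∈ Set.Icc (-(N : ℤ) + ((r : ℤ) + 2) / 3) ((r : ℤ) / 4)
    · have h1 := intermediate_value_Icc (show (-(1 / 2) : ℝ) ≤ 0 by norm_num)
        (continuous_phase r N).continuousOn
      rw [phase_neg_half, phase_zero] at h1
      obtain ⟨hl, hu⟩ := hh
      have hl' : -3 * (N : ℤ) + r ≤ 3 * h := by omega
      have hu' : 4 * h ≤ r := by omega
      have hl'' : -3 * (N : ℝ) + r ≤ 3 * h := by exact_mod_cast hl'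
      have hu'' : 4 * (h : ℝ) ≤ r := by exact_mod_cast hu'
      obtain ⟨t, ht, he⟩ := h1 (show (h : ℝ) * Real.pi ∈ _ from ⟨by nlinarith, by nlinarith⟩)
      exact ⟨t, fun _ ↦ ⟨ht, he⟩⟩
    · exact ⟨0, fun h1 ↦ absurd h1 hh⟩
  choose t ht using hpt
  have hzero (h : ℤ) : ∃ x, h ∈ Set.Ico (-(N : ℤ) + ((r : ℤ) + 2) / 3) ((r : ℤ) / 4) →
      x ∈ Set.Ioo (t h) (t (h + 1)) ∧ (arcFun r F α n x).re = 0 := by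
    by_cases hh : h ∈ Set.Ico (-(N : ℤ) + ((r : ℤ) + 2) / 3) ((r : ℤ) / 4)
    · obtain ⟨h1, h2⟩ := ht h ⟨hh.1, hh.2.le⟩
      obtain ⟨h3, h4⟩ := ht (h + 1) ⟨by have := hh.1; omega, by have := hh.2; omega⟩
      have hle : t h ≤ t (h + 1) := by
        rw [← hmono.le_iff_le h1 h3, h2, h4]
        push_cast
        nlinarith
      obtain ⟨x, hx, he⟩ := exists_zero_of_phase (A := fun x ↦
        Real.exp (2 * Real.pi * N * (arcPt x).im)) hle
        (Complex.continuous_re.comp (hF.continuous_arcFun (by omega))) (fun _ ↦ Real.exp_pos _)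
        (fun x hx ↦ hb x ⟨h1.1.trans hx.1, hx.2.trans h3.2⟩) h2 h4
      exact ⟨x, fun _ ↦ ⟨hx, he⟩⟩
    · exact ⟨0, fun h1 ↦ absurd h1 hh⟩
  choose ζ hζ using hzero
  refine ⟨ζ, fun h hh ↦ ⟨?_, fun h' hh' hlt ↦ ?_⟩⟩
  · obtain ⟨h1, h2⟩ := ht h ⟨hh.1, hh.2.le⟩
    obtain ⟨h3, h4⟩ := ht (h + 1) ⟨by have := hh.1; omega, by have := hh.2; omega⟩
    obtain ⟨h5, h6⟩ := hζ h hh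
    have h7 : ζ h ∈ Set.Ioo (-(1 / 2) : ℝ) 0 :=
      ⟨h1.1.trans_lt h5.1, h5.2.trans_le h3.2⟩
    refine ⟨h7, hF.heckeProd_eq_zero_of_arcFun (by omega) (Set.Ioo_subset_Icc_self h7) h6, ?_, ?_⟩
    · refine (abs_sub_le_of_phase_eq h2).1.trans_lt ?_
      have := h5.1
      gcongr
    · have h8 := (abs_sub_le_of_phase_eq h4).2
      push_cast at h8
      refine lt_of_lt_of_le ?_ h8
      have := h5.2
      gcongr
  · obtain ⟨h1, h2⟩ := ht (h + 1) ⟨by have := hh.1; omega, by have := hh.2; omega⟩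
    obtain ⟨h3, h4⟩ := ht h' ⟨hh'.1, hh'.2.le⟩
    have hle : t (h + 1) ≤ t h' := by
      rw [← hmono.le_iff_le h1 h3, h2, h4]
      have : ((h + 1 : ℤ) : ℝ) ≤ h' := by exact_mod_cast hlt
      nlinarith
    exact (hζ h hh).1.2.trans_le (hle.trans (hζ h' hh').1.1.le)

lemma heckeProd_neg_half (hr : Even r) (h : ¬ 3 ∣ r) (n : ℕ) :
    heckeProd r F α n (arcPt (-(1 / 2))) = 0 := by
  rw [arcPt_neg_half, heckeProd, Etilde_ρ hr h, mul_zero, zero_mul]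

lemma heckeProd_zero (hr : Even r) (h : ¬ 4 ∣ r) (n : ℕ) :
    heckeProd r F α n (arcPt 0) = 0 := by
  rw [arcPt_zero, heckeProd, Etilde_I hr h, mul_zero, zero_mul]

/-- There are `⌊r/4⌋ - (-N + ⌈r/3⌉)` gaps between consecutive multiples of `π`. The two indicator
terms count the zeros of `Ẽ_r` at `ρ` and `i`. The agreement with the degree is checked by residues
modulo `12`. -/
lemma card_zeros_eq (hr : Even r) (N : ℤ) :
    (r : ℤ) / 4 - (-N + ((r : ℤ) + 2) / 3) + (if 3 ∣ r then 0 else 1) + (if 4 ∣ r then 0 else 1) =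
      N - bExp r := by
  obtain ⟨q, hq⟩ : ∃ q : ℕ, r = 12 * q + r % 12 := ⟨r / 12, by omega⟩
  rw [bExp]
  rcases mod_twelve_cases hr with h | h | h | h | h | h <;> split_ifs <;> omega

/-- For large `n`, the arc carries as many zeros as the degree, and these are equidistributed with
respect to the real part, with bounded discrepancy. -/
theorem eventually_exists_zeros (hF : IsWeakEigenform r m F α) (hr : Even r) (hr4 : 4 ≤ r) :
    ∀ᶠ n : ℕ in atTop, ∃ T : Finset ℝ, (∀ t ∈ T, t ∈ Set.Icc (-(1 / 2) : ℝ) 0) ∧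
      (T.card : ℤ) = m * n - bExp r ∧ (∀ t ∈ T, heckeProd r F α n (arcPt t) = 0) ∧
      ∀ a b : ℝ, -(1 / 2) ≤ a → a ≤ b → b ≤ 0 →
        |((T.filter fun t ↦ t ∈ Set.Icc a b).card : ℝ) - 2 * m * n * (b - a)| ≤ r + 10 := by
  have hm := hF.one_le
  filter_upwards [hF.eventually_exists_interior_zeros, eventually_gt_atTop r] with n ⟨ζ, hζ⟩ hn
  have hN : r < m * n := by nlinarith
  have hNr : (2 : ℝ) * m * n = 2 * (m * n : ℕ) := by push_cast; ring
  simp only [hNr]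
  have hNi : (m : ℤ) * n = (m * n : ℕ) := by push_cast; ring
  rw [hNi]
  set N := m * n with hNdef
  set h₀ : ℤ := -(N : ℤ) + ((r : ℤ) + 2) / 3 with hh₀
  set h₁ : ℤ := (r : ℤ) / 4 with hh₁
  have hinj : Set.InjOn ζ (Finset.Ico h₀ h₁ : Finset ℤ) := by
    intro x hx y hy hxy
    rw [Finset.coe_Ico] at hx hy
    rcases lt_trichotomy x y with h | h | h
    · exact absurd hxy ((hζ x hx).2 y hy h).ne
    · exact h
    · exact absurd hxy ((hζ y hy).2 x hx h).ne'
  -- `T₀` collects the zeros from sign changes, `T₁` the zero forced at `ρ`, `T₂` the one forced at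
  -- `i`.
  set T₀ : Finset ℝ := (Finset.Ico h₀ h₁).image ζ with hT₀
  set T₁ : Finset ℝ := if 3 ∣ r then ∅ else {-(1 / 2)} with hT₁
  set T₂ : Finset ℝ := if 4 ∣ r then ∅ else {0} with hT₂
  have m₀ (t : ℝ) (h : t ∈ T₀) : t ∈ Set.Ioo (-(1 / 2) : ℝ) 0 := by
    obtain ⟨x, hx, rfl⟩ := Finset.mem_image.mp h
    exact (hζ x (Finset.mem_Ico.mp hx)).1.1
  have m₁ (t : ℝ) (h : t ∈ T₁) : t = -(1 / 2) ∧ ¬ 3 ∣ r := by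
    rw [hT₁] at h
    split_ifs at h with h3
    · simp at h
    · exact ⟨by simpa using h, h3⟩
  have m₂ (t : ℝ) (h : t ∈ T₂) : t = 0 ∧ ¬ 4 ∣ r := by
    rw [hT₂] at h
    split_ifs at h with h3
    · simp at h
    · exact ⟨by simpa using h, h3⟩
  have d₁ : Disjoint T₀ T₁ := Finset.disjoint_left.mpr fun t h h' ↦
    (m₀ t h).1.ne' (m₁ t h').1
  have d₂ : Disjoint (T₀ ∪ T₁) T₂ := Finset.disjoint_left.mpr fun t h h' ↦ by
    have e := (m₂ t h').1
    rcases Finset.mem_union.mp h with h | h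
    · exact (m₀ t h).2.ne e
    · have := (m₁ t h).1
      norm_num [e] at this
  have c₁ : (T₁.card : ℤ) = if 3 ∣ r then 0 else 1 := by
    rw [hT₁]
    split_ifs <;> simp
  have c₂ : (T₂.card : ℤ) = if 4 ∣ r then 0 else 1 := by
    rw [hT₂]
    split_ifs <;> simp
  have c₁' : T₁.card ≤ 1 := by
    rw [hT₁]
    split_ifs <;> simp
  have c₂' : T₂.card ≤ 1 := by
    rw [hT₂]
    split_ifs <;> simp
  refine ⟨T₀ ∪ T₁ ∪ T₂, fun t h ↦ ?_, ?_, fun t h ↦ ?_, fun a b ha hab hb ↦ ?_⟩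
  · rcases Finset.mem_union.mp h with h | h
    · rcases Finset.mem_union.mp h with h | h
      · exact Set.Ioo_subset_Icc_self (m₀ t h)
      · rw [(m₁ t h).1]
        norm_num
    · rw [(m₂ t h).1]
      norm_num
  · rw [Finset.card_union_of_disjoint d₂, Finset.card_union_of_disjoint d₁, hT₀,
      Finset.card_image_of_injOn hinj, Int.card_Ico, ← card_zeros_eq hr, ← c₁, ← c₂]
    push_cast
    rw [Int.toNat_of_nonneg (by omega)]
  · rcases Finset.mem_union.mp h with h | h
    · rcases Finset.mem_union.mp h with h | h
      · obtain ⟨x, hx, rfl⟩ := Finset.mem_image.mp h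
        exact (hζ x (Finset.mem_Ico.mp hx)).1.2.1
      · rw [(m₁ t h).1]
        exact heckeProd_neg_half hr (m₁ t h).2 n
    · rw [(m₂ t h).1]
      exact heckeProd_zero hr (m₂ t h).2 n
  · have hN0 : (0 : ℝ) < N := by exact_mod_cast (by omega)
    have hr0 : (0 : ℝ) ≤ r := r.cast_nonneg
    have hab' : 2 * (N : ℝ) * a ≤ 2 * N * b := by gcongr
    -- The localisation `x - r/2 < 2N ζ x < x + 1` turns `ζ x ∈ [a, b]` into `2Na - 1 < x < 2Nb +
    -- r/2`. The two forced zeros add at most one each.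
    have hupper : ((T₀ ∪ T₁ ∪ T₂).filter fun t ↦ t ∈ Set.Icc a b).card ≤
        (Finset.Icc ⌊2 * (N : ℝ) * a - 1⌋ ⌈2 * (N : ℝ) * b + r / 2⌉).card + 1 + 1 := by
      rw [Finset.filter_union, Finset.filter_union]
      refine (Finset.card_union_le _ _).trans (add_le_add ((Finset.card_union_le _ _).trans
        (add_le_add ?_ ((Finset.card_filter_le _ _).trans c₁')))
        ((Finset.card_filter_le _ _).trans c₂'))
      have hsub : (T₀.filter fun t ↦ t ∈ Set.Icc a b) ⊆
          (Finset.Icc ⌊2 * (N : ℝ) * a - 1⌋ ⌈2 * (N : ℝ) * b + r / 2⌉).image ζ := by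
        intro t ht
        obtain ⟨h1, h2⟩ := Finset.mem_filter.mp ht
        obtain ⟨x, hx, rfl⟩ := Finset.mem_image.mp h1
        obtain ⟨-, -, h3, h4⟩ := (hζ x (Finset.mem_Ico.mp hx)).1
        refine Finset.mem_image_of_mem _ (Finset.mem_Icc.mpr ⟨?_, ?_⟩)
        · have h5 : 2 * (N : ℝ) * a ≤ 2 * N * ζ x := by gcongr; exact h2.1
          have h6 := Int.floor_le (2 * (N : ℝ) * a - 1)
          have h7 : ((⌊2 * (N : ℝ) * a - 1⌋ : ℤ) : ℝ) < x := by linarith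
          exact (by exact_mod_cast h7 : ⌊2 * (N : ℝ) * a - 1⌋ < x).le
        · have h5 : 2 * (N : ℝ) * ζ x ≤ 2 * N * b := by gcongr; exact h2.2
          have h6 := Int.le_ceil (2 * (N : ℝ) * b + r / 2)
          have h7 : (x : ℝ) < (⌈2 * (N : ℝ) * b + r / 2⌉ : ℤ) := by linarith
          exact (by exact_mod_cast h7 : x < ⌈2 * (N : ℝ) * b + r / 2⌉).le
      exact (Finset.card_le_card hsub).trans Finset.card_image_le
    -- Conversely `2Na + r/2 ≤ x ≤ 2Nb - 1` forces `ζ x ∈ [a, b]`. Such an `x` is a valid index,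
    -- since `a ≥ -1/2` gives `x ≥ -N + r/2` and `b ≤ 0` gives `x ≤ -1`.
    have hlower : (Finset.Icc ⌈2 * (N : ℝ) * a + r / 2⌉ ⌊2 * (N : ℝ) * b - 1⌋).card ≤
        ((T₀ ∪ T₁ ∪ T₂).filter fun t ↦ t ∈ Set.Icc a b).card := by
      have hmem (x : ℤ) (hx : x ∈ Finset.Icc ⌈2 * (N : ℝ) * a + r / 2⌉ ⌊2 * (N : ℝ) * b - 1⌋) :
          x ∈ Finset.Ico h₀ h₁ ∧ 2 * (N : ℝ) * a + r / 2 ≤ x ∧ (x : ℝ) ≤ 2 * N * b - 1 := by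
        obtain ⟨h1, h2⟩ := Finset.mem_Icc.mp hx
        have h3 := Int.ceil_le.mp h1
        have h4 := Int.le_floor.mp h2
        refine ⟨Finset.mem_Ico.mpr ⟨?_, ?_⟩, h3, h4⟩
        · have h5 : -(2 * (N : ℝ)) + r ≤ 2 * x := by nlinarith
          have h6 : -(2 * (N : ℤ)) + r ≤ 2 * x := by exact_mod_cast h5
          omega
        · have h5 : (x : ℝ) ≤ -1 := by nlinarith
          have h6 : x ≤ -1 := by exact_mod_cast h5
          omega
      rw [← Finset.card_image_of_injOn (hinj.mono fun x hx ↦ (hmem x hx).1)]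
      refine Finset.card_le_card fun t ht ↦ ?_
      obtain ⟨x, hx, rfl⟩ := Finset.mem_image.mp ht
      obtain ⟨h1, h2, h3⟩ := hmem x hx
      obtain ⟨-, -, h4, h5⟩ := (hζ x (Finset.mem_Ico.mp h1)).1
      refine Finset.mem_filter.mpr ⟨Finset.mem_union_left _ (Finset.mem_union_left _
        (Finset.mem_image_of_mem _ h1)), ?_, ?_⟩
      · refine le_of_mul_le_mul_left (a := 2 * (N : ℝ)) ?_ (by positivity)
        linarith
      · refine le_of_mul_le_mul_left (a := 2 * (N : ℝ)) ?_ (by positivity)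
        linarith
    rw [Int.card_Icc] at hupper hlower
    set c := ((T₀ ∪ T₁ ∪ T₂).filter fun t ↦ t ∈ Set.Icc a b).card with hc
    have f₁ := Int.floor_le (2 * (N : ℝ) * a - 1)
    have f₂ := Int.lt_floor_add_one (2 * (N : ℝ) * a - 1)
    have f₃ := Int.le_ceil (2 * (N : ℝ) * b + r / 2)
    have f₄ := Int.ceil_lt_add_one (2 * (N : ℝ) * b + r / 2)
    have f₅ := Int.le_ceil (2 * (N : ℝ) * a + r / 2)
    have f₆ := Int.ceil_lt_add_one (2 * (N : ℝ) * a + r / 2)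
    have f₇ := Int.floor_le (2 * (N : ℝ) * b - 1)
    have f₈ := Int.lt_floor_add_one (2 * (N : ℝ) * b - 1)
    rw [abs_le]
    constructor
    · have h1 : ⌊2 * (N : ℝ) * b - 1⌋ + 1 - ⌈2 * (N : ℝ) * a + r / 2⌉ ≤ c := by omega
      have h2 : ((⌊2 * (N : ℝ) * b - 1⌋ : ℤ) : ℝ) + 1 - (⌈2 * (N : ℝ) * a + r / 2⌉ : ℤ) ≤ c := by
        exact_mod_cast h1
      linarith
    · have h0 : ⌊2 * (N : ℝ) * a - 1⌋ ≤ ⌈2 * (N : ℝ) * b + r / 2⌉ + 1 := by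
        have : ((⌊2 * (N : ℝ) * a - 1⌋ : ℤ) : ℝ) ≤ (⌈2 * (N : ℝ) * b + r / 2⌉ : ℤ) + 1 := by
          linarith
        exact_mod_cast this
      have h1 : (c : ℤ) ≤ ⌈2 * (N : ℝ) * b + r / 2⌉ + 1 - ⌊2 * (N : ℝ) * a - 1⌋ + 2 := by omega
      have h2 : (c : ℝ) ≤ ((⌈2 * (N : ℝ) * b + r / 2⌉ : ℤ) : ℝ) + 1 -
          (⌊2 * (N : ℝ) * a - 1⌋ : ℤ) + 2 := by
        exact_mod_cast h1
      linarith

end IsWeakEigenform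

/-! ### Zeros of the polynomials -/

/-- As many distinct roots as the degree leave room for no other root and no multiplicity. It is
applied over both `ℝ` and `ℂ`. -/
lemma roots_eq_of_card {K : Type*} [CommRing K] [IsDomain K] {P : K[X]} (hP : P.Monic)
    {Z : Finset K} (hZ : ∀ z ∈ Z, P.IsRoot z) (hcard : Z.card = P.natDegree) : P.roots = Z.val := by
  refine (Multiset.eq_of_le_of_card_le ?_ ?_).symm
  · rw [Finset.val_le_iff_val_subset]
    exact fun z hz ↦ (Polynomial.mem_roots hP.ne_zero).mpr (hZ z hz)
  · exact (Polynomial.card_roots' P).trans hcard.ge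

section

variable {P : ℝ[X]} {f : ℍ → ℂ} {T : Finset ℝ}

lemma isRoot_jArc (hP : ∀ τ, aeval (jInv τ) P = f τ) {t : ℝ}
    (ht : t ∈ Set.Icc (-(1 / 2) : ℝ) 0) (h : f (arcPt t) = 0) : P.IsRoot (jArc t) := by
  have h1 := hP (arcPt t)
  rw [h, ← coe_jArc ht, ← Complex.coe_algebraMap, Polynomial.aeval_algebraMap_apply] at h1
  simpa using h1

lemma roots_eq_image_jArc (hmonic : P.Monic) (hP : ∀ τ, aeval (jInv τ) P = f τ)
    (hT : ∀ t ∈ T, t ∈ Set.Icc (-(1 / 2) : ℝ) 0) (hz : ∀ t ∈ T, f (arcPt t) = 0)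
    (hcard : T.card = P.natDegree) : P.roots = (T.image jArc).val := by
  refine roots_eq_of_card hmonic (fun z hz' ↦ ?_) ?_
  · obtain ⟨t, ht, rfl⟩ := Finset.mem_image.mp hz'
    exact isRoot_jArc hP (hT t ht) (hz t ht)
  · rw [Finset.card_image_of_injOn (jArc_injOn.mono fun t ht ↦ hT t ht), hcard]

lemma aroots_eq_image_jArc (hmonic : P.Monic) (hP : ∀ τ, aeval (jInv τ) P = f τ)
    (hT : ∀ t ∈ T, t ∈ Set.Icc (-(1 / 2) : ℝ) 0) (hz : ∀ t ∈ T, f (arcPt t) = 0)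
    (hcard : T.card = P.natDegree) :
    P.aroots ℂ = ((T.image jArc).image (fun x : ℝ ↦ (x : ℂ))).val := by
  refine roots_eq_of_card (hmonic.map _) (fun z hz' ↦ ?_) ?_
  · obtain ⟨x, hx, rfl⟩ := Finset.mem_image.mp hz'
    obtain ⟨t, ht, rfl⟩ := Finset.mem_image.mp hx
    exact (isRoot_jArc hP (hT t ht) (hz t ht)).map (f := algebraMap ℝ ℂ)
  · rw [Finset.card_image_of_injective _ Complex.ofReal_injective,
      Finset.card_image_of_injOn (jArc_injOn.mono fun t ht ↦ hT t ht), hcard,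
      Polynomial.natDegree_map]

lemma ncard_isRoot_eq (hmonic : P.Monic) (hP : ∀ τ, aeval (jInv τ) P = f τ)
    (hT : ∀ t ∈ T, t ∈ Set.Icc (-(1 / 2) : ℝ) 0) (hz : ∀ t ∈ T, f (arcPt t) = 0)
    (hcard : T.card = P.natDegree) {a b : ℝ} (ha : a ∈ Set.Icc (-(1 / 2) : ℝ) 0)
    (hb : b ∈ Set.Icc (-(1 / 2) : ℝ) 0) :
    {x : ℝ | x ∈ Set.Icc (jArc a) (jArc b) ∧ P.IsRoot x}.ncard =
      (T.filter fun t ↦ t ∈ Set.Icc a b).card := by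
  have hroots := roots_eq_image_jArc hmonic hP hT hz hcard
  have h1 : {x : ℝ | x ∈ Set.Icc (jArc a) (jArc b) ∧ P.IsRoot x} =
      ((T.filter fun t ↦ t ∈ Set.Icc a b).image jArc : Finset ℝ) := by
    ext x
    rw [Set.mem_ofPred_eq, ← Polynomial.mem_roots hmonic.ne_zero, hroots, Finset.mem_val,
      Finset.mem_coe, Finset.mem_image, Finset.mem_image]
    constructor
    · rintro ⟨hx, t, ht, rfl⟩
      exact ⟨t, Finset.mem_filter.mpr ⟨ht, (jArc_strictMonoOn.le_iff_le ha (hT t ht)).mp hx.1,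
        (jArc_strictMonoOn.le_iff_le (hT t ht) hb).mp hx.2⟩, rfl⟩
    · rintro ⟨t, ht, rfl⟩
      obtain ⟨ht, h2⟩ := Finset.mem_filter.mp ht
      exact ⟨⟨jArc_strictMonoOn.monotoneOn ha (hT t ht) h2.1,
        jArc_strictMonoOn.monotoneOn (hT t ht) hb h2.2⟩, t, ht, rfl⟩
  rw [h1, Set.ncard_coe_finset, Finset.card_image_of_injOn]
  exact jArc_injOn.mono fun t ht ↦ hT t (Finset.mem_filter.mp ht).1

end

/-- Since `d n = mn - B`, the quotient differs from `2u` by a bounded quantity divided by `d n`,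
which tends to infinity. -/
lemma tendsto_div_of_abs_sub_le {c d : ℕ → ℝ} {u C B : ℝ} {m : ℕ} (hm : 1 ≤ m)
    (hc : ∀ᶠ n : ℕ in atTop, |c n - 2 * m * n * u| ≤ C)
    (hd : ∀ᶠ n : ℕ in atTop, d n = m * n - B) : Tendsto (fun n ↦ c n / d n) atTop (𝓝 (2 * u)) := by
  have hm0 : (0 : ℝ) < m := by exact_mod_cast hm
  have hd' : Tendsto d atTop atTop := by
    have h1 : Tendsto (fun n : ℕ ↦ (m : ℝ) * n - B) atTop atTop :=
      tendsto_atTop_add_const_right _ _ (tendsto_natCast_atTop_atTop.const_mul_atTop hm0)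
    exact h1.congr' (hd.mono fun n hn ↦ hn.symm)
  rw [tendsto_iff_norm_sub_tendsto_zero]
  have h2 : Tendsto (fun n ↦ (C + |2 * B * u|) / d n) atTop (𝓝 0) := hd'.const_div_atTop _
  refine squeeze_zero' (Eventually.of_forall fun _ ↦ norm_nonneg _) ?_ h2
  filter_upwards [hc, hd, hd'.eventually_gt_atTop 0] with n h3 h4 h5
  have h6 : c n / d n - 2 * u = (c n - 2 * m * n * u + 2 * B * u) / d n := by
    field_simp
    rw [h4]
    ring
  rw [h6, Real.norm_eq_abs, abs_div, abs_of_pos h5]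
  gcongr
  exact (abs_add_le _ _).trans (by gcongr)

namespace IsWeakEigenform

variable {r m : ℕ} {F : ℍ → ℂ} {α : ℕ → ℝ}

theorem zeros (hF : IsWeakEigenform r m F α) (hr : Even r) (hr4 : 4 ≤ r) :
    ∃ P : ℕ → ℝ[X],
      (∀ n : ℕ, 2 ≤ n → (P n).Monic ∧ ((P n).natDegree : ℤ) = m * n - bExp r ∧
        ∀ τ : ℍ, aeval (jInv τ) (P n) = heckeProd r F α n τ) ∧
      (∃ N : ℕ, ∀ n : ℕ, N ≤ n → ((P n).aroots ℂ).Nodup ∧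
        ∀ z ∈ (P n).aroots ℂ, ∃ x ∈ Set.Icc (0 : ℝ) 1728, (x : ℂ) = z) ∧
      ZerosEquidistributed P := by
  have hex (n : ℕ) : ∃ P : ℝ[X], 2 ≤ n → P.Monic ∧ (P.natDegree : ℤ) = m * n - bExp r ∧
      ∀ τ : ℍ, aeval (jInv τ) P = heckeProd r F α n τ := by
    by_cases hn : 2 ≤ n
    · obtain ⟨P, hP⟩ := hF.exists_polynomial hr (by omega) hn
      exact ⟨P, fun _ ↦ hP⟩
    · exact ⟨0, fun h ↦ absurd h hn⟩
  choose P hP using hex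
  refine ⟨P, hP, ?_, fun x y hx hxy hy ↦ ?_⟩
  · refine eventually_atTop.mp ?_
    filter_upwards [hF.eventually_exists_zeros hr hr4, eventually_ge_atTop 2] with
      n ⟨T, hT, hcard, hz, _⟩ hn
    obtain ⟨h1, h2, h3⟩ := hP n hn
    rw [aroots_eq_image_jArc h1 h3 hT hz (by omega)]
    refine ⟨Finset.nodup _, fun z hz' ↦ ?_⟩
    obtain ⟨x, hx, rfl⟩ := Finset.mem_image.mp (Finset.mem_val.mp hz')
    obtain ⟨t, ht, rfl⟩ := Finset.mem_image.mp hx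
    exact ⟨_, jArc_mem (hT t ht), rfl⟩
  · obtain ⟨a, ha, rfl⟩ := exists_jArc_eq ⟨hx, hxy.trans hy⟩
    obtain ⟨b, hb, rfl⟩ := exists_jArc_eq ⟨hx.trans hxy, hy⟩
    have hab : a ≤ b := (jArc_strictMonoOn.le_iff_le ha hb).mp hxy
    rw [arcProjection_eq ha hb, Real.volume_real_Icc_of_le hab]
    refine tendsto_div_of_abs_sub_le (C := r + 10) (B := bExp r) hF.one_le ?_ ?_
    · filter_upwards [hF.eventually_exists_zeros hr hr4, eventually_ge_atTop 2] with
        n ⟨T, hT, hcard, hz, hdisc⟩ hn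
      obtain ⟨h1, h2, h3⟩ := hP n hn
      rw [ncard_isRoot_eq h1 h3 hT hz (by omega) ha hb]
      exact hdisc a b ha.1 hab hb.2
    · filter_upwards [eventually_ge_atTop 2] with n hn
      exact_mod_cast (hP n hn).2.1

end IsWeakEigenform

end HeckeZeros

end


/-! ### The theorem in weight `k` -/

theorem corollary3 (k : ℤ) (hk : Even k) (m : ℕ) (F : ℍ → ℂ)
    (hF : HeckeZeros.IsHarmonicMaassForm (2 - k) F)
    (cPlus cMinus : ℤ → ℝ)
    (hexp : HeckeZeros.HasFourierExpansion k m F (fun l ↦ (cPlus l : ℂ)) (fun l ↦ (cMinus l : ℂ)))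
    (hlead : cPlus (-(m : ℤ)) = 1)
    (G : CuspForm 𝒮ℒ k) (hG : HeckeZeros.IsNormalizedEigenform G)
    (hshadow : ∃ c : ℂ, c ≠ 0 ∧ ∀ τ : ℍ, HeckeZeros.xi (2 - k) F τ = c * G τ) :
    ∃ P : ℕ → ℝ[X],
      (∀ n : ℕ, 2 ≤ n →
        (P n).Monic ∧ ((P n).natDegree : ℤ) = m * n - HeckeZeros.bExp (k - 2) ∧
        ∀ τ : ℍ, aeval (HeckeZeros.jInv τ) (P n) =
          HeckeZeros.heckeFun k F (HeckeZeros.cuspCoeff G) n τ) ∧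
      (∃ N : ℕ, ∀ n : ℕ, N ≤ n →
        ((P n).aroots ℂ).Nodup ∧
        ∀ z ∈ (P n).aroots ℂ, ∃ x ∈ Set.Icc (0 : ℝ) 1728, (x : ℂ) = z) ∧
      HeckeZeros.ZerosEquidistributed P := by
  -- A normalized eigenform is a nonzero cusp form of level one, so `k ≥ 12`. Hence `r = k - 2 ≥
  -- 10`, which covers every lower bound on `r` required above and excludes `r = 2`.
  have h12 := hG.twelve_le
  obtain ⟨r, rfl⟩ : ∃ r : ℕ, k = (r : ℤ) + 2 := ⟨(k - 2).toNat, by omega⟩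
  have hr : Even r := by
    obtain ⟨s, hs⟩ := hk
    exact ⟨(s - 1).toNat, by omega⟩
  obtain ⟨α, hα, hW⟩ := HeckeZeros.exists_isWeakEigenform (by omega) hF hexp hlead hG hshadow
  obtain ⟨P, h1, h2, h3⟩ := hW.zeros hr (by omega)
  refine ⟨P, fun n hn ↦ ?_, h2, h3⟩
  obtain ⟨h4, h5, h6⟩ := h1 n hn
  have hb := HeckeZeros.bExp_nonneg (r := r) (by omega)
  refine ⟨h4, by rw [h5, add_sub_cancel_right], fun τ ↦ ?_⟩
  rw [h6, HeckeZeros.IsWeakEigenform.heckeProd, HeckeZeros.heckeFun, hα n (by omega),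
    HeckeZeros.heckeOp_eq_heckeSum (by omega), add_sub_cancel_right, ← zpow_natCast,
    Int.toNat_of_nonneg hb]
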